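/- Let $k$ be an algebraically closed field and $L$ a finite quiver (finitely many vertices and arrows; loops, multiple arrows and oriented cycles are allowed). All representations are finite-dimensional over $k$. For an arrow $\alpha$ write $\alpha : n\alpha \to s\alpha$. The coefficient quiver of a representation $M$ with respect to a basis $\mathcal B=(\mathcal B_q)_{q}$ ($\mathcal B_q$ a basis of $M(q)$) has the elements of $\coprod_q \mathcal B_q$ as vertices and one arrow $b\to b'$ for each arrow $\alpha$ of $L$ with $b \in \mathcal B_{n\alpha}$, $b' \in \mathcal B_{s\alpha}$ such that the $(b',b)$-entry of the matrix of $M(\alpha)$ is nonzero. $\mathcal B$ is a tree basis if the underlying undirected multigraph of the coefficient quiver is a tree, and $M$ is a tree representation if it has a tree basis. Let $X$ and $Y$ be indecomposable tree representations of $L$ with $\operatorname{Hom}_L(X,Y)=0$. Let $R=J(\operatorname{End}X)\operatorname{Ext}^1_L(Y,X)+\operatorname{Ext}^1_L(Y,X)J(\operatorname{End}Y)$, where $J$ denotes the Jacobson radical, be the radical of $\operatorname{Ext}^1_L(Y,X)$ as an $\operatorname{End}_L(X)$-$\operatorname{End}_L(Y)$-bimodule, and let $n=\dim_k \operatorname{Ext}^1_L(Y,X)/R$.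 Let $Q_n$ be the quiver with two vertices $y,x$ and $n$ arrows $1,\dots,n$ from $y$ to $x$, with simple representations $E_y,E_x$. A family $\delta=(\delta_\alpha)_\alpha\in\bigoplus_\alpha \operatorname{Hom}_k(Y(n\alpha),X(s\alpha))$ gives the extension $0\to X\to X_\delta\to Y\to 0$ with $X_\delta(q)=X(q)\oplus Y(q)$ and $X_\delta(\alpha)=\begin{pmatrix}X(\alpha)&\delta_\alpha\\0&Y(\alpha)\end{pmatrix}$, and hence a class in $\operatorname{Ext}^1_L(Y,X)$. (A) Let tree bases of $X$ and $Y$ be given. Then there are families $\zeta_1,\dots,\zeta_n$ such that each $\zeta_i$ is nonzero on exactly one arrow, is there an elementary matrix (one entry $1$, all other entries $0$) with respect to the given bases, and the classes of the $\zeta_i$ form a basis of $\operatorname{Ext}^1_L(Y,X)/R$. For every such choice the functor $F$ from representations of $Q_n$ to representations of $L$ with $$FT(q)=(X(q)\otimes T(x))\oplus (Y(q)\otimes T(y)),\qquad FT(\alpha)=\begin{pmatrix}X(\alpha)\otimes \mathrm{id}&\sum_i(\zeta_i)_\alpha\otimes T(i)\\0&Y(\alpha)\otimes\mathrm{id}\end{pmatrix},$$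 $$(Ff)_q=(\mathrm{id}\otimes f_x)\oplus(\mathrm{id}\otimes f_y),$$ is $k$-linear, sends indecomposable tree representations to indecomposable tree representations, and satisfies: 1. $F$ is faithful and exact. 2. $F$ sends indecomposable representations to indecomposable representations. 3. $FT\cong FT'$ implies $T\cong T'$. 4. $F(E_y)\cong Y$ and $F(E_x)\cong X$. 5. Let $\mathcal F(Y,X)$ be the full subcategory of all $N$ for which there are $r,s\ge 0$ and an exact sequence $0\to X^r\to N\to Y^s\to 0$. If moreover $\operatorname{Hom}_L(Y,X)=0$ and $\operatorname{End}_L(X)=k=\operatorname{End}_L(Y)$, then $\mathcal F(Y,X)$ is closed under kernels and cokernels, and $F$ induces an equivalence between the category of representations of $Q_n$ and $\mathcal F(Y,X)$. (B) If $\dim_k\operatorname{Ext}^1_L(Y,X)=1$ and $0\to X\to M\to Y\to 0$ is a non-split exact sequence of representations of $L$, then $M$ is an indecomposable tree representation. -/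

import Mathlib

open CategoryTheory CategoryTheory.Limits CategoryTheory.Abelian
open scoped TensorProduct

universe u v w

noncomputable section

/-! ### Treelike quivers -/

/-- The undirected simple graph that underlies a quiver (loops and multiplicities of arrows are
forgotten). -/
def underlyingGraph (V : Type*) [Quiver V] : SimpleGraph V :=
  SimpleGraph.fromRel fun a b => Nonempty (a ⟶ b)

/-- A quiver is treelike if its underlying undirected (multi)graph is a tree: there are no loops,
there is at most one arrow, in either direction, between two vertices, and the underlying simple
graph is connected (in particular non-empty) and has no cycles. -/
structure IsTreelike (V : Type*) [Quiver V] : Prop where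
  no_loop : ∀ a : V, IsEmpty (a ⟶ a)
  no_multiple : Function.Injective fun e : Quiver.Total V => s(e.left, e.right)
  isTree : (underlyingGraph V).IsTree

/-! ### Representations -/

/-- The category of representations of the quiver `L` by finite-dimensional vector spaces over
`k`. -/
abbrev QuiverRep (k : Type u) [Field k] (L : Type v) [Quiver.{w} L] :=
  Paths L ⥤ FGModuleCat.{u} k

namespace QuiverRep

variable {k : Type u} [Field k] {L : Type v} [Quiver.{w} L]

/-- The vector space of a representation at a vertex. -/
abbrev space (M : QuiverRep k L) (q : L) : FGModuleCat.{u} k :=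
  M.obj ((Paths.of L).obj q)

/-- The linear map of a representation along an arrow. -/
def arrow (M : QuiverRep k L) {a b : L} (e : a ⟶ b) : M.space a →ₗ[k] M.space b :=
  (M.map ((Paths.of L).map e)).hom.hom

/-- The representation with prescribed vector spaces and linear maps. -/
def ofMaps (V : L → FGModuleCat.{u} k) (f : ∀ ⦃a b : L⦄, (a ⟶ b) → (V a →ₗ[k] V b)) :
    QuiverRep k L :=
  Paths.lift { obj := V, map := fun e => FGModuleCat.ofHom (f e) }

theorem ofMaps_arrow (V : L → FGModuleCat.{u} k)
    (f : ∀ ⦃a b : L⦄, (a ⟶ b) → (V a →ₗ[k] V b)) {a b : L} (e : a ⟶ b) :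
    (ofMaps V f).arrow e = f e := by
  unfold arrow ofMaps
  erw [Paths.lift_toPath]
  rfl

/-- The morphism of representations with prescribed linear maps at the vertices. -/
def homOfMaps {M N : QuiverRep k L} (g : ∀ q : L, M.space q →ₗ[k] N.space q)
    (hg : ∀ {a b : L} (e : a ⟶ b), N.arrow e ∘ₗ g a = g b ∘ₗ M.arrow e) : M ⟶ N where
  app q := FGModuleCat.ofHom (g q)
  naturality a b p := by
    induction p using Paths.induction with
    | id => simp
    | comp p e ih =>
      rw [M.map_comp, N.map_comp, Category.assoc]
      have h : M.map ((Paths.of L).map e) ≫ FGModuleCat.ofHom (g _) =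
          FGModuleCat.ofHom (g _) ≫ N.map ((Paths.of L).map e) :=
        FGModuleCat.hom_ext (hg e).symm
      erw [h, reassoc_of% ih]

/-- The coefficient quiver of a representation `M` with respect to the basis `B`: its vertices are
the basis elements. -/
def CoefficientQuiver (M : QuiverRep k L) {ι : L → Type*}
    (_B : ∀ q : L, Module.Basis (ι q) k (M.space q)) : Type _ :=
  Σ q : L, ι q

/-- There is one arrow from `b` to `b'` for every arrow of `L` such that the entry of its matrix in
row `b'` and column `b` is nonzero. -/
instance (M : QuiverRep k L) {ι : L → Type*} (B : ∀ q : L, Module.Basis (ι q) k (M.space q)) :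
    Quiver (CoefficientQuiver M B) where
  Hom b b' := {e : b.1 ⟶ b'.1 // (B b'.1).repr (M.arrow e (B b.1 b.2)) b'.2 ≠ 0}

/-- A basis of a representation is a tree basis if the coefficient quiver is treelike. -/
def IsTreeBasis (M : QuiverRep k L) {ι : L → Type*}
    (B : ∀ q : L, Module.Basis (ι q) k (M.space q)) : Prop :=
  IsTreelike (CoefficientQuiver M B)

/-- A tree representation is a representation that has a tree basis. -/
def IsTreeRep (M : QuiverRep k L) : Prop :=
  ∃ (ι : L → Type) (B : ∀ q : L, Module.Basis (ι q) k (M.space q)), M.IsTreeBasis B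

/-! ### Extensions -/

section Block

variable {A A' B B' : Type*} [AddCommGroup A] [Module k A] [AddCommGroup A'] [Module k A']
  [AddCommGroup B] [Module k B] [AddCommGroup B'] [Module k B']

/-- The linear map `A ⊕ B → A' ⊕ B'` with block matrix `(a, c; 0, b)`. -/
def block (a : A →ₗ[k] A') (c : B →ₗ[k] A') (b : B →ₗ[k] B') : A × B →ₗ[k] A' × B' :=
  LinearMap.prod (a ∘ₗ LinearMap.fst k A B + c ∘ₗ LinearMap.snd k A B) (b ∘ₗ LinearMap.snd k A B)

theorem block_comp_inl (a : A →ₗ[k] A') (c : B →ₗ[k] A') (b : B →ₗ[k] B') :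
    block a c b ∘ₗ LinearMap.inl k A B = LinearMap.inl k A' B' ∘ₗ a := by
  ext <;> simp [block]

theorem block_natural {n : ℕ} {C C' D D' : Type*} [AddCommGroup C] [Module k C] [AddCommGroup C']
    [Module k C'] [AddCommGroup D] [Module k D] [AddCommGroup D'] [Module k D']
    (a : A →ₗ[k] A') (b : B →ₗ[k] B') (z : Fin n → B →ₗ[k] A') (t : Fin n → D →ₗ[k] C)
    (t' : Fin n → D' →ₗ[k] C') (g : C →ₗ[k] C') (h : D →ₗ[k] D')
    (ht : ∀ i, t' i ∘ₗ h = g ∘ₗ t i) :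
    block (a.rTensor C') (∑ i, TensorProduct.map (z i) (t' i)) (b.rTensor D') ∘ₗ
        LinearMap.prodMap (g.lTensor A) (h.lTensor B) =
      LinearMap.prodMap (g.lTensor A') (h.lTensor B') ∘ₗ
        block (a.rTensor C) (∑ i, TensorProduct.map (z i) (t i)) (b.rTensor D) := by
  have ht' : ∀ i d, t' i (h d) = g (t i d) := fun i d => LinearMap.congr_fun (ht i) d
  ext <;> simp [block, ht', map_sum]

end Block

instance : HasFiniteBiproducts (QuiverRep k L) := Abelian.hasFiniteBiproducts

instance : HasExt.{max (u + 1) v w} (QuiverRep k L) := HasExt.standard _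

/-- Families of linear maps `Y(a) → X(b)`, indexed by the arrows `a ⟶ b` of the quiver. -/
abbrev OneCochain (Y X : QuiverRep k L) :=
  ∀ ⦃a b : L⦄, (a ⟶ b) → (Y.space a →ₗ[k] X.space b)

/-- The representation with spaces `X(q) ⊕ Y(q)` and maps `(X(α), δ(α); 0, Y(α))`. -/
def extRep (Y X : QuiverRep k L) (δ : OneCochain Y X) : QuiverRep k L :=
  ofMaps (fun q => FGModuleCat.of k (X.space q × Y.space q)) fun _ _ e =>
    block (X.arrow e) (δ e) (Y.arrow e)

/-- The sequence `0 → X → X_δ → Y → 0` given by the inclusion and the projection. -/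
def extSequence (Y X : QuiverRep k L) (δ : OneCochain Y X) : ShortComplex (QuiverRep k L) where
  X₁ := X
  X₂ := extRep Y X δ
  X₃ := Y
  f := homOfMaps (N := extRep Y X δ) (fun q => LinearMap.inl k (X.space q) (Y.space q)) (by
    intro a b e
    unfold extRep
    rw [ofMaps_arrow]
    exact block_comp_inl (X.arrow e) (δ e) (Y.arrow e))
  g := homOfMaps (M := extRep Y X δ) (fun q => LinearMap.snd k (X.space q) (Y.space q)) (by
    intro a b e
    unfold extRep
    rw [ofMaps_arrow]
    rfl)
  zero := by
    ext q x
    rfl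

theorem extSequence_shortExact (Y X : QuiverRep k L) (δ : OneCochain Y X) :
    (extSequence Y X δ).ShortExact := by
  have hpt : ∀ q : Paths L,
      ((extSequence Y X δ).map ((evaluation (Paths L) (FGModuleCat.{u} k)).obj q)).ShortExact := by
    intro q
    refine ShortComplex.Splitting.shortExact
      { r := FGModuleCat.ofHom (LinearMap.fst k (X.space q) (Y.space q))
        s := FGModuleCat.ofHom (LinearMap.inr k (X.space q) (Y.space q))
        f_r := rfl
        s_g := rfl
        id := ?_ }
    refine FGModuleCat.hom_ext (LinearMap.ext fun z => ?_)
    exact Prod.ext (add_zero _) (zero_add _)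
  have hm : Mono (extSequence Y X δ).f :=
    have : ∀ q, Mono ((extSequence Y X δ).f.app q) := fun q => (hpt q).mono_f
    NatTrans.mono_of_mono_app _
  have he : Epi (extSequence Y X δ).g :=
    have : ∀ q, Epi ((extSequence Y X δ).g.app q) := fun q => (hpt q).epi_g
    NatTrans.epi_of_epi_app _
  refine { exact := ?_ }
  rw [ShortComplex.exact_iff_isZero_homology, Functor.isZero_iff]
  intro q
  have h := (hpt q).exact
  rw [ShortComplex.exact_iff_isZero_homology] at h
  exact h.of_iso ((extSequence Y X δ).mapHomologyIso
    ((evaluation (Paths L) (FGModuleCat.{u} k)).obj q)).symm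

/-- The class in `Ext¹(Y, X)` of the extension given by a family of linear maps. -/
def extClass (Y X : QuiverRep k L) (δ : OneCochain Y X) : Ext Y X 1 :=
  (extSequence_shortExact Y X δ).extClass

/-- The radical `J(End X) · Ext¹(Y, X) + Ext¹(Y, X) · J(End Y)` of `Ext¹(Y, X)` as a bimodule over
`End X` and `End Y`, where `J` denotes the Jacobson radical. -/
def extRadical (Y X : QuiverRep k L) : Submodule k (Ext Y X 1) :=
  Submodule.span k
    ({η | ∃ f ∈ Ring.jacobson (End X), ∃ ξ : Ext Y X 1, η = ξ.comp (Ext.mk₀ f) (add_zero 1)} ∪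
      {η | ∃ g ∈ Ring.jacobson (End Y), ∃ ξ : Ext Y X 1, η = (Ext.mk₀ g).comp ξ (zero_add 1)})

/-- The dimension of `Ext¹(Y, X)` modulo its radical. -/
def extRadDim (Y X : QuiverRep k L) : ℕ :=
  Module.finrank k (Ext Y X 1 ⧸ extRadical Y X)

/-- The extensions given by the `ζ i` form a basis of `Ext¹(Y, X)` modulo its radical. -/
def RepresentsExtBasis {Y X : QuiverRep k L} {n : ℕ} (ζ : Fin n → OneCochain Y X) : Prop :=
  LinearIndependent k (fun i => (extRadical Y X).mkQ (extClass Y X (ζ i))) ∧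
    Submodule.span k (Set.range fun i => (extRadical Y X).mkQ (extClass Y X (ζ i))) = ⊤

/-- `ζ` is an elementary matrix with respect to the bases `BY` and `BX`: it vanishes on all arrows
but one, and on this one it sends one basis element to a basis element and all others to zero. -/
def IsElementary {Y X : QuiverRep k L} {ιY ιX : L → Type*}
    (BY : ∀ q : L, Module.Basis (ιY q) k (Y.space q))
    (BX : ∀ q : L, Module.Basis (ιX q) k (X.space q)) (ζ : OneCochain Y X) : Prop :=
  ∃ (α : Quiver.Total L) (i : ιY α.left) (j : ιX α.right),
    (∀ β : Quiver.Total L, β ≠ α → ζ β.hom = 0) ∧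
    ζ α.hom (BY _ i) = BX _ j ∧ ∀ i' ≠ i, ζ α.hom (BY _ i') = 0

/-- The full subcategory of all `N` that have an exact sequence `0 → X^r → N → Y^s → 0`. -/
def filtered (Y X : QuiverRep k L) : ObjectProperty (QuiverRep k L) := fun N =>
  ∃ (r s : ℕ) (f : (⨁ fun _ : Fin r => X) ⟶ N) (g : N ⟶ ⨁ fun _ : Fin s => Y) (h : f ≫ g = 0),
    (ShortComplex.mk f g h).ShortExact

end QuiverRep

/-! ### Kronecker quivers -/

/-- The vertices of the `n`-Kronecker quiver: the source `y` and the sink `x`. -/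
inductive Kronecker (n : ℕ) : Type
  | y
  | x

/-- The `n`-Kronecker quiver has `n` arrows from `y` to `x` and no others. -/
inductive Kronecker.Arrow (n : ℕ) : Kronecker n → Kronecker n → Type
  | arr (i : Fin n) : Kronecker.Arrow n .y .x

instance (n : ℕ) : Quiver (Kronecker n) where
  Hom := Kronecker.Arrow n

namespace Kronecker

open QuiverRep

variable {k : Type u} [Field k] {L : Type v} [Quiver.{w} L] {n : ℕ}

/-- The `i`-th arrow. -/
def arr (i : Fin n) : (y : Kronecker n) ⟶ x := Arrow.arr i

variable (k n) in
/-- The simple representation at the source. -/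
def simpleY : QuiverRep k (Kronecker n) :=
  ofMaps (fun | .y => FGModuleCat.of k k | .x => FGModuleCat.of k PUnit) fun _ _ _ => 0

variable (k n) in
/-- The simple representation at the sink. -/
def simpleX : QuiverRep k (Kronecker n) :=
  ofMaps (fun | .y => FGModuleCat.of k PUnit | .x => FGModuleCat.of k k) fun _ _ _ => 0

/-- The representation of `L` with spaces `X(q) ⊗ T(x) ⊕ Y(q) ⊗ T(y)` and maps
`(X(α) ⊗ id, ∑ i, ζ_i(α) ⊗ T(i); 0, Y(α) ⊗ id)`, for a representation `T` of the Kronecker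
quiver. -/
def glueObj {Y X : QuiverRep k L} (ζ : Fin n → OneCochain Y X) (T : QuiverRep k (Kronecker n)) :
    QuiverRep k L :=
  ofMaps (fun q => FGModuleCat.of k ((X.space q ⊗[k] T.space x) × (Y.space q ⊗[k] T.space y)))
    fun _ _ e => block ((X.arrow e).rTensor (T.space x))
      (∑ i, TensorProduct.map (ζ i e) (T.arrow (arr i))) ((Y.arrow e).rTensor (T.space y))

/-- The functor `T ↦ glueObj ζ T`; a morphism `f` acts by `id ⊗ f(x)` and `id ⊗ f(y)`. -/
def glue {Y X : QuiverRep k L} (ζ : Fin n → OneCochain Y X) :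
    QuiverRep k (Kronecker n) ⥤ QuiverRep k L where
  obj T := glueObj ζ T
  map {T T'} f := homOfMaps (M := glueObj ζ T) (N := glueObj ζ T')
    (fun q => LinearMap.prodMap
      ((f.app x).hom.hom.lTensor (X.space q)) ((f.app y).hom.hom.lTensor (Y.space q))) (by
    intro a b e
    have hf : ∀ i, T'.arrow (arr i) ∘ₗ (f.app y).hom.hom = (f.app x).hom.hom ∘ₗ T.arrow (arr i) :=
      fun i => (congrArg (fun h => h.hom.hom) (f.naturality ((Paths.of _).map (arr i)))).symm
    unfold glueObj
    rw [ofMaps_arrow, ofMaps_arrow]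
    exact block_natural (X.arrow e) (Y.arrow e) (fun i => ζ i e) (fun i => T.arrow (arr i))
      (fun i => T'.arrow (arr i)) (f.app x).hom.hom (f.app y).hom.hom hf)
  map_id T := by
    refine NatTrans.ext (funext fun q => FGModuleCat.hom_ext ?_)
    change LinearMap.prodMap (LinearMap.lTensor (X.space q) (LinearMap.id : T.space x →ₗ[k] _))
      (LinearMap.lTensor (Y.space q) (LinearMap.id : T.space y →ₗ[k] _)) = LinearMap.id
    rw [LinearMap.lTensor_id, LinearMap.lTensor_id, LinearMap.prodMap_id]
  map_comp f g := by
    refine NatTrans.ext (funext fun q => FGModuleCat.hom_ext ?_)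
    change LinearMap.prodMap
        (LinearMap.lTensor (X.space q) ((g.app x).hom.hom ∘ₗ (f.app x).hom.hom))
        (LinearMap.lTensor (Y.space q) ((g.app y).hom.hom ∘ₗ (f.app y).hom.hom)) =
      LinearMap.prodMap (LinearMap.lTensor (X.space q) (g.app x).hom.hom)
        (LinearMap.lTensor (Y.space q) (g.app y).hom.hom) ∘ₗ
      LinearMap.prodMap (LinearMap.lTensor (X.space q) (f.app x).hom.hom)
        (LinearMap.lTensor (Y.space q) (f.app y).hom.hom)
    rw [LinearMap.lTensor_comp, LinearMap.lTensor_comp, LinearMap.prodMap_comp]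

end Kronecker

end

/-! A glued representation `FT` is an extension of `Y ⊗ T(y)` by `X ⊗ T(x)` with cochain `∑ ζ_i ⊗
T(i)`. The proof reduces morphisms `FT ⟶ FT'` modulo the radicals of `End X` and `End Y`. As `Hom(X,
Y) = 0`, such a morphism is block triangular. As `X` is indecomposable and `k` is algebraically
closed, every endomorphism of `X` is a scalar modulo the nilpotent ideal `J(End X)`, so the diagonal
block on `X ⊗ T(x)` is `id ⊗ f` modulo the radical; likewise one gets `g` for `Y`. Compatibility
with the arrows says that the two composites of the diagonal blocks with the cochains differ by a
coboundary. Passing to `Ext¹(Y, X)/R`, where the `ζ_i` are independent, gives `T'(i) g = f T(i)`: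
the pair `(f, g)` is a morphism `T ⟶ T'` (`comp_eq_comp_of_blockReducesTo`).

This reduction is unique, compatible with composition, and takes `F p` back to `p`. Hence `F` is
faithful and reflects isomorphism. An idempotent that reduces to zero is zero, because the radicals
are nilpotent and a strictly triangular block matrix squares to zero; so idempotents of `FT` are
trivial when those of `T` are, and `F` preserves indecomposability (`indecomposable_glue`).

Cochains map onto `Ext¹(Y, X)` with the coboundaries as kernel (`extClassLinear_surjective`,
`extClass_eq_zero_iff`). Elementary matrices span the cochains, so some of them give a basis modulo
`R`. If the endomorphism rings are `k`, then `R = 0`, every cochain from `Y ⊗ V` to `X ⊗ W` is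
cohomologous to some `∑ ζ_i ⊗ t_i`, and `Hom(Y, X) = 0` removes the off-diagonal block of a
morphism; `F` is then full and dense in the filtered representations.

For tree bases, the coefficient quiver of `FT` consists of a copy of that of `X` for each basis
element of `T(x)`, a copy of that of `Y` for each one of `T(y)`, and one connecting arrow for each
arrow of the coefficient quiver of `T`. It is connected and has one arrow fewer than vertices, so it
is a tree (`isTreeBasis_glueBasis`).

In (B) the radical of the one-dimensional `Ext¹` vanishes, so `n = 1`, and `M` is `F` of the
representation `k → k` with a nonzero map. -/

noncomputable section

/-! ### Morphisms of representations at the vertices -/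

namespace QuiverRep

variable {k : Type u} [Field k] {L : Type v} [Quiver.{w} L]

/-- The linear map of a morphism of representations at a vertex. -/
def homAt {M N : QuiverRep k L} (f : M ⟶ N) (q : L) : M.space q →ₗ[k] N.space q :=
  (f.app ((Paths.of L).obj q)).hom.hom

theorem hom_ext_at {M N : QuiverRep k L} {f g : M ⟶ N} (h : ∀ q, homAt f q = homAt g q) :
    f = g :=
  NatTrans.ext (funext fun q => FGModuleCat.hom_ext (h q))

theorem arrow_comp_homAt {M N : QuiverRep k L} (f : M ⟶ N) {a b : L} (e : a ⟶ b) :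
    N.arrow e ∘ₗ homAt f a = homAt f b ∘ₗ M.arrow e :=
  (congrArg (fun h => h.hom.hom) (f.naturality ((Paths.of _).map e))).symm

theorem arrow_homAt {M N : QuiverRep k L} (f : M ⟶ N) {a b : L} (e : a ⟶ b) (m : M.space a) :
    N.arrow e (homAt f a m) = homAt f b (M.arrow e m) :=
  LinearMap.congr_fun (arrow_comp_homAt f e) m

@[simp]
theorem homAt_id (M : QuiverRep k L) (q : L) : homAt (𝟙 M) q = LinearMap.id := rfl

@[simp]
theorem homAt_comp {M N P : QuiverRep k L} (f : M ⟶ N) (g : N ⟶ P) (q : L) :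
    homAt (f ≫ g) q = homAt g q ∘ₗ homAt f q := rfl

@[simp]
theorem homAt_zero (M N : QuiverRep k L) (q : L) : homAt (0 : M ⟶ N) q = 0 := rfl

@[simp]
theorem homAt_add {M N : QuiverRep k L} (f g : M ⟶ N) (q : L) :
    homAt (f + g) q = homAt f q + homAt g q := rfl

@[simp]
theorem homAt_sub {M N : QuiverRep k L} (f g : M ⟶ N) (q : L) :
    homAt (f - g) q = homAt f q - homAt g q := rfl

@[simp]
theorem homAt_smul {M N : QuiverRep k L} (c : k) (f : M ⟶ N) (q : L) :
    homAt (c • f) q = c • homAt f q := rfl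

/-- The map `homAt` as a linear map. -/
def homAtLinear (M N : QuiverRep k L) (q : L) :
    (M ⟶ N) →ₗ[k] (M.space q →ₗ[k] N.space q) where
  toFun f := homAt f q
  map_add' _ _ := rfl
  map_smul' _ _ := rfl

@[simp]
theorem homAt_sum {M N : QuiverRep k L} {ι : Type*} (s : Finset ι) (f : ι → (M ⟶ N)) (q : L) :
    homAt (∑ i ∈ s, f i) q = ∑ i ∈ s, homAt (f i) q :=
  map_sum (homAtLinear M N q) f s

/-- Representations that are isomorphic at the vertices, compatibly with the arrows. -/
def isoOfEquivs {M N : QuiverRep k L} (g : ∀ q : L, M.space q ≃ₗ[k] N.space q)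
    (hg : ∀ {a b : L} (e : a ⟶ b), N.arrow e ∘ₗ (g a).toLinearMap =
      (g b).toLinearMap ∘ₗ M.arrow e) :
    M ≅ N where
  hom := homOfMaps (fun q => (g q).toLinearMap) hg
  inv := homOfMaps (fun q => (g q).symm.toLinearMap) (by
    intro a b e
    ext x
    have := LinearMap.congr_fun (hg e) ((g a).symm x)
    simp only [LinearMap.comp_apply, LinearEquiv.coe_coe, LinearEquiv.apply_symm_apply] at this ⊢
    rw [this, LinearEquiv.symm_apply_apply])
  hom_inv_id := hom_ext_at fun q => LinearMap.ext fun x => (g q).symm_apply_apply x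
  inv_hom_id := hom_ext_at fun q => LinearMap.ext fun x => (g q).apply_symm_apply x

instance (M : QuiverRep k L) (q : L) : Module.Finite k (M.space q) := (M.space q).2

instance finite_hom [Finite L] (M N : QuiverRep k L) : Module.Finite k (M ⟶ N) := by
  refine Module.Finite.of_injective (LinearMap.pi fun q => homAtLinear M N q) fun f g h => ?_
  exact hom_ext_at fun q => congrFun h q

/-! ### Tensor products of a representation with a vector space -/

section Tensor

variable (V W U : Type u) [AddCommGroup V] [Module k V] [Module.Finite k V]
  [AddCommGroup W] [Module k W] [Module.Finite k W] [AddCommGroup U] [Module k U]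
  [Module.Finite k U]

/-- The representation `M ⊗ V`. -/
def tens (M : QuiverRep k L) : QuiverRep k L :=
  ofMaps (fun q => FGModuleCat.of k (M.space q ⊗[k] V)) fun _ _ e => (M.arrow e).rTensor V

theorem tens_arrow (M : QuiverRep k L) {a b : L} (e : a ⟶ b) :
    (tens V M).arrow e = (M.arrow e).rTensor V :=
  ofMaps_arrow _ _ e

variable {V W U}

/-- The element `m ⊗ v` of `M ⊗ V`. -/
def tmulAt {M : QuiverRep k L} {q : L} : M.space q →ₗ[k] V →ₗ[k] (tens V M).space q :=
  TensorProduct.mk k (M.space q) V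

theorem tens_arrow_tmulAt {M : QuiverRep k L} {a b : L} (e : a ⟶ b) (m : M.space a) (v : V) :
    (tens V M).arrow e (tmulAt m v) = tmulAt (M.arrow e m) v := by
  rw [tens_arrow]
  rfl

/-- Extensionality is restated for the spaces of `tens V M`, so that later arguments need not unfold
them to tensor products. -/
theorem tens_map_ext {M : QuiverRep k L} {q : L} {P : Type*} [AddCommGroup P] [Module k P]
    {f g : (tens V M).space q →ₗ[k] P}
    (h : ∀ (m : M.space q) (v : V), f (tmulAt m v) = g (tmulAt m v)) : f = g :=
  TensorProduct.ext' h

theorem tens_hom_ext {M N : QuiverRep k L} {f g : tens V M ⟶ N}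
    (h : ∀ q (m : M.space q) (v : V), homAt f q (tmulAt m v) = homAt g q (tmulAt m v)) :
    f = g :=
  hom_ext_at fun q => tens_map_ext (h q)

/-- The linear map on `M ⊗ V` with prescribed values on the elements `m ⊗ v`. -/
def tensLift {M : QuiverRep k L} {q : L} {P : Type*} [AddCommGroup P] [Module k P]
    (f : M.space q →ₗ[k] V →ₗ[k] P) : (tens V M).space q →ₗ[k] P :=
  TensorProduct.lift f

theorem tensLift_tmulAt {M : QuiverRep k L} {q : L} {P : Type*} [AddCommGroup P] [Module k P]
    (f : M.space q →ₗ[k] V →ₗ[k] P) (m : M.space q) (v : V) : tensLift f (tmulAt m v) = f m v :=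
  rfl

/-- The morphism `f ⊗ g`. -/
def tensMap {M N : QuiverRep k L} (f : M ⟶ N) (g : V →ₗ[k] W) : tens V M ⟶ tens W N :=
  homOfMaps (fun q => tensLift (tmulAt.compl₁₂ (homAt f q) g)) fun e =>
    tens_map_ext fun m v => by
      rw [LinearMap.comp_apply, LinearMap.comp_apply, tensLift_tmulAt, LinearMap.compl₁₂_apply,
        tens_arrow_tmulAt, tens_arrow_tmulAt, arrow_homAt, tensLift_tmulAt,
        LinearMap.compl₁₂_apply]

/-- The inclusion `m ↦ m ⊗ v`. -/
def tensIns (M : QuiverRep k L) (v : V) : M ⟶ tens V M :=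
  homOfMaps (fun _ => tmulAt.flip v) fun e => LinearMap.ext fun m => tens_arrow_tmulAt e m v

/-- The projection `m ⊗ v ↦ w v • m`. -/
def tensProj (M : QuiverRep k L) (w : Module.Dual k V) : tens V M ⟶ M :=
  homOfMaps (fun _ => tensLift ((LinearMap.lsmul k _).flip.compl₂ w)) fun e =>
    tens_map_ext fun m v => by
      rw [LinearMap.comp_apply, LinearMap.comp_apply, tens_arrow_tmulAt]
      exact map_smul (M.arrow e) (w v) m

theorem homAt_tensMap {M N : QuiverRep k L} (f : M ⟶ N) (g : V →ₗ[k] W) (q : L)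
    (m : M.space q) (v : V) :
    homAt (tensMap f g) q (tmulAt m v) = tmulAt (homAt f q m) (g v) := rfl

theorem homAt_tensIns (M : QuiverRep k L) (v : V) (q : L) (m : M.space q) :
    homAt (tensIns M v) q m = tmulAt m v := rfl

theorem homAt_tensProj (M : QuiverRep k L) (w : Module.Dual k V) (q : L)
    (m : M.space q) (v : V) : homAt (tensProj M w) q (tmulAt m v) = w v • m := rfl

theorem tensMap_id (M : QuiverRep k L) : tensMap (𝟙 M) (LinearMap.id : V →ₗ[k] V) = 𝟙 _ :=
  tens_hom_ext fun _ _ _ => rfl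

theorem tensMap_comp {M N P : QuiverRep k L} (f : M ⟶ N) (f' : N ⟶ P) (g : V →ₗ[k] W)
    (g' : W →ₗ[k] U) : tensMap f g ≫ tensMap f' g' = tensMap (f ≫ f') (g' ∘ₗ g) :=
  tens_hom_ext fun _ _ _ => rfl

variable (V W) in
/-- The bilinear map `(f, g) ↦ f ⊗ g`. -/
def tensMapBilin (M N : QuiverRep k L) :
    (M ⟶ N) →ₗ[k] (V →ₗ[k] W) →ₗ[k] (tens V M ⟶ tens W N) :=
  LinearMap.mk₂ k tensMap
    (fun f _ g => tens_hom_ext fun q m v => LinearMap.map_add₂ tmulAt (homAt f q m) _ (g v))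
    (fun c f g => tens_hom_ext fun q m v => LinearMap.map_smul₂ tmulAt c (homAt f q m) (g v))
    (fun f g g' => tens_hom_ext fun q m v => map_add (tmulAt (homAt f q m)) (g v) (g' v))
    (fun c f g => tens_hom_ext fun q m v => map_smul (tmulAt (homAt f q m)) c (g v))

theorem tensMapBilin_apply {M N : QuiverRep k L} (f : M ⟶ N) (g : V →ₗ[k] W) :
    tensMapBilin V W M N f g = tensMap f g := rfl

theorem tensIns_tensMap_tensProj {M N : QuiverRep k L} (f : M ⟶ N) (g : V →ₗ[k] W) (v : V)
    (w : Module.Dual k W) : tensIns M v ≫ tensMap f g ≫ tensProj N w = w (g v) • f :=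
  hom_ext_at fun q => LinearMap.ext fun m => homAt_tensProj N w q (homAt f q m) (g v)

theorem sum_tensProj_tensIns {ι : Type*} [Fintype ι] (b : Module.Basis ι k V)
    (M : QuiverRep k L) : ∑ i, tensProj M (b.coord i) ≫ tensIns M (b i) = 𝟙 (tens V M) := by
  refine tens_hom_ext fun q m v => ?_
  have h : ∀ i, homAt (tensProj M (b.coord i) ≫ tensIns M (b i)) q (tmulAt m v) =
      tmulAt m (b.repr v i • b i) := fun i => by
    rw [homAt_comp, LinearMap.comp_apply, homAt_tensProj, homAt_tensIns, map_smul, map_smul,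
      LinearMap.smul_apply, Module.Basis.coord_apply]
  rw [homAt_sum, LinearMap.sum_apply]
  simp only [h]
  rw [← map_sum, b.sum_repr]
  rfl

theorem tensProj_comp_tensIns {M N : QuiverRep k L} (f : M ⟶ N) (v : Module.Dual k V) (w : W) :
    tensProj M v ≫ f ≫ tensIns N w = tensMap f (v.smulRight w) := by
  refine tens_hom_ext fun q m x => ?_
  rw [homAt_comp, homAt_comp, LinearMap.comp_apply, LinearMap.comp_apply, homAt_tensProj,
    homAt_tensIns, homAt_tensMap, LinearMap.smulRight_apply, map_smul, map_smul, map_smul,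
    LinearMap.smul_apply]

/-- The identities of `V ⊗ M` and `W ⊗ N`, resolved along bases as in `sum_tensProj_tensIns`, are
inserted on both sides of `φ`. Thus `φ` is a matrix with entries in `Hom(M, N)`. -/
theorem tens_hom_eq_sum {ι κ : Type*} [Fintype ι] [Fintype κ] (b : Module.Basis ι k V)
    (c : Module.Basis κ k W) {M N : QuiverRep k L} (φ : tens V M ⟶ tens W N) :
    φ = ∑ i, ∑ j, tensMap (tensIns M (b i) ≫ φ ≫ tensProj N (c.coord j))
      ((b.coord i).smulRight (c j)) := by
  conv_lhs => rw [← Category.id_comp φ, ← Category.comp_id φ, ← sum_tensProj_tensIns b,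
    ← sum_tensProj_tensIns c]
  simp only [← tensProj_comp_tensIns, Preadditive.sum_comp, Preadditive.comp_sum, Category.assoc]
  exact Finset.sum_comm

theorem tens_hom_eq_zero {M N : QuiverRep k L} (h : ∀ f : M ⟶ N, f = 0)
    (φ : tens V M ⟶ tens W N) : φ = 0 := by
  rw [tens_hom_eq_sum (Module.finBasis k V) (Module.finBasis k W) φ]
  refine Finset.sum_eq_zero fun i _ => Finset.sum_eq_zero fun j _ => ?_
  rw [h (_ ≫ _), ← tensMapBilin_apply, map_zero, LinearMap.zero_apply]

/-- `M ⊗ V` is a direct sum of copies of `M`. -/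
def biproductIsoTens {n : ℕ} (b : Module.Basis (Fin n) k V) (M : QuiverRep k L) :
    (⨁ fun _ : Fin n => M) ≅ tens V M :=
  let B : Bicone (fun _ : Fin n => M) :=
    { pt := tens V M
      π := fun i => tensProj M (b.coord i)
      ι := fun i => tensIns M (b i)
      ι_π := fun i j => by
        refine hom_ext_at fun q => LinearMap.ext fun m => ?_
        refine (homAt_tensProj M (b.coord j) q m (b i)).trans ?_
        by_cases h : i = j
        · subst h; simp
        · simp [h] }
  (biproduct.uniqueUpToIso (b := B) _ (isBilimitOfTotal B (sum_tensProj_tensIns b M))).symm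

end Tensor

end QuiverRep

end

/-! ### Indecomposable objects and their endomorphism rings -/

section Indecomposable

variable {C : Type*} [Category C] [Preadditive C] [HasBinaryBiproducts C]

/-- A decomposition `X ≅ Y ⊞ Z` yields the idempotent that projects onto `Y`; if it is zero then `Y
= 0`, and if it is the identity then `Z = 0`. -/
theorem indecomposable_of_idempotents {X : C} (h0 : ¬ IsZero X)
    (h : ∀ e : X ⟶ X, e ≫ e = e → e = 0 ∨ e = 𝟙 X) : Indecomposable X := by
  refine ⟨h0, fun Y Z i => ?_⟩
  rcases h (i.hom ≫ biprod.fst ≫ biprod.inl ≫ i.inv) (by simp) with he | he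
  · left
    rw [IsZero.iff_id_eq_zero]
    calc 𝟙 Y = biprod.inl ≫ i.inv ≫ (i.hom ≫ biprod.fst ≫ biprod.inl ≫ i.inv) ≫ i.hom ≫
          biprod.fst := by simp
      _ = 0 := by rw [he]; simp
  · right
    rw [IsZero.iff_id_eq_zero]
    calc 𝟙 Z = biprod.inr ≫ i.inv ≫ 𝟙 X ≫ i.hom ≫ biprod.snd := by simp
      _ = 0 := by rw [← he]; simp

/-- Both `e` and `1 - e` split, and their images are complementary summands of `X`. -/
theorem CategoryTheory.Indecomposable.eq_zero_or_eq_id [IsIdempotentComplete C] {X : C}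
    (hX : Indecomposable X)
    {e : X ⟶ X} (he : e ≫ e = e) : e = 0 ∨ e = 𝟙 X := by
  obtain ⟨Y, i, p, hip, hpi⟩ := IsIdempotentComplete.idempotents_split X e he
  have he' : (𝟙 X - e) ≫ (𝟙 X - e) = 𝟙 X - e := by
    simp [Preadditive.sub_comp, Preadditive.comp_sub, he]
  obtain ⟨Z, j, q, hjq, hqj⟩ := IsIdempotentComplete.idempotents_split X (𝟙 X - e) he'
  have hiq : i ≫ q = 0 := by
    have : i ≫ (𝟙 X - e) = 0 := by
      rw [← hpi, Preadditive.comp_sub, reassoc_of% hip]; simp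
    calc i ≫ q = (i ≫ (q ≫ j)) ≫ q := by simp [hjq]
      _ = 0 := by rw [hqj, this, zero_comp]
  have hjp : j ≫ p = 0 := by
    have : j ≫ e = 0 := by
      have h1 : e = 𝟙 X - q ≫ j := by rw [hqj]; abel
      rw [h1, Preadditive.comp_sub, reassoc_of% hjq]; simp
    calc j ≫ p = (j ≫ (p ≫ i)) ≫ p := by simp [hip]
      _ = 0 := by rw [hpi, this, zero_comp]
  have hsum : p ≫ i + q ≫ j = 𝟙 X := by rw [hpi, hqj]; abel
  let I : X ≅ Y ⊞ Z :=
    { hom := biprod.lift p q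
      inv := biprod.desc i j
      hom_inv_id := by rw [biprod.lift_desc, hsum]
      inv_hom_id := by
        ext <;> simp [hip, hjq, hiq, hjp] }
  rcases hX.2 Y Z I with hY | hZ
  · left; rw [← hpi, hY.eq_of_tgt p 0, zero_comp]
  · right
    have : q ≫ j = 0 := by rw [hZ.eq_of_tgt q 0, zero_comp]
    rw [← hsum, this, add_zero, hpi]

end Indecomposable

/-! ### Finite-dimensional algebras with only trivial idempotents -/

section LocalAlgebra

/-- Fitting's lemma for left multiplication by `a`: for suitable `n ≥ 1`, write `1 = x + a ^ n * z`
with `a ^ n * x = 0`. Then `x - x * x` lies in both the kernel and the range of `a ^ n`, so `x` is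
idempotent; `x = 0` makes `a ^ n` a unit, `x = 1` makes it zero. -/
theorem isNilpotent_or_isUnit_of_idempotents (K : Type*) {A : Type*} [Field K] [Ring A]
    [Algebra K A]
    [Module.Finite K A]
    (h : ∀ e : A, e * e = e → e = 0 ∨ e = 1) (a : A) :
    IsNilpotent a ∨ IsUnit a := by
  have : IsArtinianRing A := IsArtinianRing.of_finite K A
  obtain ⟨n, hn1, hn⟩ := ((Filter.eventually_ge_atTop 1).and
    (LinearMap.mulLeft K a).eventually_isCompl_ker_pow_range_pow).exists
  simp only [LinearMap.pow_mulLeft] at hn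
  obtain ⟨x, hx, y, ⟨z, rfl⟩, hxy⟩ := Submodule.mem_sup.mp
    ((hn.codisjoint.eq_top ▸ Submodule.mem_top : (1 : A) ∈ _))
  have hx' : a ^ n * x = 0 := hx
  have hxy' : x + a ^ n * z = 1 := hxy
  have hid : x - x * x = 0 := by
    refine (Submodule.disjoint_def.mp hn.disjoint) _ ?_ ⟨z * x, ?_⟩
    · change a ^ n * (x - x * x) = 0
      rw [mul_sub, ← mul_assoc, hx', zero_mul, sub_zero]
    · change a ^ n * (z * x) = _
      rw [← mul_assoc, eq_sub_iff_add_eq'.mpr hxy', sub_mul, one_mul]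
  rcases h x (sub_eq_zero.mp hid).symm with rfl | rfl
  · right
    rw [zero_add] at hxy'
    have : IsUnit (a ^ n) := IsUnit.of_mul_eq_one _ hxy'
    exact (isUnit_pow_iff (by omega)).mp this
  · left
    exact ⟨n, by rw [← hx', mul_one]⟩

/-- One-sided inverses in an Artinian ring are two-sided, so every left multiple `y * a` of a
non-unit is again a non-unit. It is therefore nilpotent, and `1 + y * a` is invertible. -/
theorem mem_jacobson_of_not_isUnit (K : Type*) {A : Type*} [Field K] [Ring A] [Algebra K A]
    [Module.Finite K A]
    (h : ∀ e : A, e * e = e → e = 0 ∨ e = 1) {a : A}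
    (ha : ¬ IsUnit a) : a ∈ Ring.jacobson A := by
  have : IsArtinianRing A := IsArtinianRing.of_finite K A
  rw [← Ideal.jacobson_bot, Ideal.mem_jacobson_iff]
  intro y
  have hy : ¬ IsUnit (y * a) := fun hu => ha (by
    obtain ⟨u, hu⟩ := hu
    refine IsUnit.of_mul_eq_one_right (↑u⁻¹ * y) ?_
    rw [mul_assoc, ← hu, Units.inv_mul])
  obtain ⟨u, hu⟩ := ((isNilpotent_or_isUnit_of_idempotents K h (y * a)).resolve_right
    hy).isUnit_one_add
  refine ⟨↑u⁻¹, ?_⟩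
  have : (↑u⁻¹ : A) * (1 + y * a) = 1 := by rw [← hu, Units.inv_mul]
  rw [mul_add, mul_one] at this
  rw [Submodule.mem_bot, mul_assoc, add_comm (_ * _), this, sub_self]

/-- Over an algebraically closed field `a` has a spectral value `c`, and the non-unit `a - c` lies
in the radical. -/
theorem exists_sub_algebraMap_mem_jacobson (K : Type*) {A : Type*} [Field K] [Ring A] [Algebra K A]
    [Module.Finite K A] [IsAlgClosed K] [Nontrivial A]
    (h : ∀ e : A, e * e = e → e = 0 ∨ e = 1) (a : A) :
    ∃ c : K, a - algebraMap K A c ∈ Ring.jacobson A := by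
  obtain ⟨c, hc⟩ := spectrum.nonempty_of_isAlgClosed_of_finiteDimensional K a
  refine ⟨c, ?_⟩
  have := mem_jacobson_of_not_isUnit K h (spectrum.mem_iff.mp hc)
  simpa using neg_mem this

end LocalAlgebra

/-! ### Extension classes come from short exact sequences -/

namespace CategoryTheory.Abelian.Ext

variable {C : Type*} [Category C] [Abelian C] [HasExt.{w} C]

/-- Every element of `Ext¹(Y, X)` is annihilated by a monomorphism out of `X`. -/
theorem exists_mono_comp_eq_zero {X Y : C} (α : Ext.{w} Y X 1) :
    ∃ (M : C) (f : X ⟶ M), Mono f ∧ α.comp (mk₀ f) (add_zero 1) = 0 := by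
  let := HasDerivedCategory.standard C
  -- The class is a morphism `Y ⟶ X[1]` in the derived category. It is completed to a triangle `X ⟶
  -- E ⟶ Y ⟶ X[1]`; as `X` and `Y` sit in degree zero, so does `E`, which therefore comes from an
  -- object `M`.
  obtain ⟨E, f, g, hT⟩ := Pretriangulated.distinguished_cocone_triangle₂ (α.hom)
  have hle : E.IsLE 0 := DerivedCategory.TStructure.t.isLE₂ _ hT 0
    (inferInstanceAs (((DerivedCategory.singleFunctor C 0).obj X).IsLE 0))
    (inferInstanceAs (((DerivedCategory.singleFunctor C 0).obj Y).IsLE 0))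
  have hge : E.IsGE 0 := DerivedCategory.TStructure.t.isGE₂ _ hT 0
    (inferInstanceAs (((DerivedCategory.singleFunctor C 0).obj X).IsGE 0))
    (inferInstanceAs (((DerivedCategory.singleFunctor C 0).obj Y).IsGE 0))
  obtain ⟨M, ⟨i⟩⟩ := DerivedCategory.exists_iso_singleFunctor_obj_of_isGE_of_isLE E 0
  obtain ⟨φ, hφ⟩ := (DerivedCategory.singleFunctor C 0).map_surjective (f ≫ i.hom)
  refine ⟨M, φ, ?_, ?_⟩
  -- In the long exact homology sequence the term before `H⁰(X)` is `H⁻¹(Y) = 0`.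
  · have h1 : Mono ((DerivedCategory.homologyFunctor C 0).map f) := by
      refine (DerivedCategory.HomologySequence.mono_homologyMap_mor₁_iff _ hT (-1) 0).mpr ?_
      exact (DerivedCategory.isZero_of_isGE ((DerivedCategory.singleFunctor C 0).obj Y) 0 (-1)
        (by omega)).eq_of_src _ _
    have h2 : Mono ((DerivedCategory.singleFunctor C 0 ⋙ DerivedCategory.homologyFunctor C 0).map
        φ) := by
      rw [Functor.comp_map, hφ, Functor.map_comp]
      infer_instance
    have h3 := NatIso.naturality_1 (DerivedCategory.singleFunctorCompHomologyFunctorIso C 0) φ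
    have h4 : Mono ((𝟭 C).map φ) := by
      rw [← h3]
      infer_instance
    exact h4
  · ext
    rw [comp_hom, mk₀_hom, ShiftedHom.comp_mk₀, hφ, zero_hom]
    have := Pretriangulated.comp_distTriang_mor_zero₃₁ _ hT
    rw [Functor.map_comp]
    erw [reassoc_of% this]
    exact Limits.zero_comp

/-- A class that dies in `Ext¹(Y, M)` under a monomorphism `f : X ⟶ M` comes from `Hom(Y, coker f)`
by the long exact sequence. That it is only a pullback of an extension class is enough, because
cochains can be pulled back too. -/
theorem exists_eq_comp_extClass {X Y : C} (α : Ext.{w} Y X 1) :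
    ∃ (M N : C) (f : X ⟶ M) (g : M ⟶ N) (h : f ≫ g = 0) (hS : (ShortComplex.mk f g h).ShortExact)
      (p : Y ⟶ N), α = (mk₀ p).comp hS.extClass (zero_add 1) := by
  obtain ⟨M, f, hf, hα⟩ := exists_mono_comp_eq_zero α
  have hS : (ShortComplex.mk f (cokernel.π f) (cokernel.condition f)).ShortExact :=
    { exact := ShortComplex.exact_cokernel f }
  obtain ⟨p, hp⟩ := covariant_sequence_exact₁ Y hS α hα (zero_add 1)
  obtain ⟨p, rfl⟩ := (mk₀_bijective _ _).2 p
  exact ⟨M, _, f, _, _, hS, p, hp.symm⟩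

end CategoryTheory.Abelian.Ext

/-! ### Short exact sequences at the vertices -/

namespace QuiverRep

variable {k : Type u} [Field k] {L : Type v} [Quiver.{w} L]

/-- The functor that sends a representation to its vector space at a vertex. -/
abbrev evalModule (k : Type u) [Field k] {L : Type v} [Quiver.{w} L] (q : L) :
    QuiverRep k L ⥤ ModuleCat.{u} k :=
  (evaluation (Paths L) (FGModuleCat.{u} k)).obj ((Paths.of L).obj q) ⋙ forget₂ _ _

theorem shortExact_map_evalModule {S : ShortComplex (QuiverRep k L)} (hS : S.ShortExact) (q : L) :
    (S.map (evalModule k q)).ShortExact :=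
  hS.map_of_exact _

theorem homAt_injective_of_shortExact {S : ShortComplex (QuiverRep k L)} (hS : S.ShortExact)
    (q : L) : Function.Injective (homAt S.f q) :=
  (shortExact_map_evalModule hS q).moduleCat_injective_f

theorem homAt_surjective_of_shortExact {S : ShortComplex (QuiverRep k L)} (hS : S.ShortExact)
    (q : L) : Function.Surjective (homAt S.g q) :=
  (shortExact_map_evalModule hS q).moduleCat_surjective_g

theorem homAt_exact_of_shortExact {S : ShortComplex (QuiverRep k L)} (hS : S.ShortExact)
    (q : L) : Function.Exact (homAt S.f q) (homAt S.g q) :=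
  (ShortComplex.ShortExact.moduleCat_exact_iff_function_exact _).mp
    (shortExact_map_evalModule hS q).exact

/-- Exactness in the middle is the vanishing of homology, which evaluation at a vertex preserves; at
a vertex it may be tested on the underlying modules. -/
theorem shortExact_of_homAt {S : ShortComplex (QuiverRep k L)}
    (hf : ∀ q, Function.Injective (homAt S.f q)) (hg : ∀ q, Function.Surjective (homAt S.g q))
    (hfg : ∀ q, Function.Exact (homAt S.f q) (homAt S.g q)) : S.ShortExact := by
  have hm : Mono S.f := by
    have : ∀ q, Mono (S.f.app q) := fun q =>
      (forget₂ (FGModuleCat k) (ModuleCat k)).mono_of_mono_map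
        ((ModuleCat.mono_iff_injective _).mpr (hf q))
    exact NatTrans.mono_of_mono_app _
  have he : Epi S.g := by
    have : ∀ q, Epi (S.g.app q) := fun q =>
      (forget₂ (FGModuleCat k) (ModuleCat k)).epi_of_epi_map
        ((ModuleCat.epi_iff_surjective _).mpr (hg q))
    exact NatTrans.epi_of_epi_app _
  refine { exact := ?_ }
  rw [ShortComplex.exact_iff_isZero_homology, Functor.isZero_iff]
  intro q
  have h : (S.map ((evaluation (Paths L) (FGModuleCat.{u} k)).obj q)).Exact := by
    rw [← ShortComplex.exact_map_iff_of_faithful _ (forget₂ (FGModuleCat k) (ModuleCat k)),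
      ShortComplex.ShortExact.moduleCat_exact_iff_function_exact]
    exact hfg q
  rw [ShortComplex.exact_iff_isZero_homology] at h
  exact h.of_iso (S.mapHomologyIso ((evaluation (Paths L) (FGModuleCat.{u} k)).obj q)).symm

end QuiverRep

noncomputable section

/-! ### Extensions and their classes -/

namespace QuiverRep

variable {k : Type u} [Field k] {L : Type v} [Quiver.{w} L]

section Ext

variable {X X' X'' Y Y' Y'' : QuiverRep k L}

/-- The inclusion `X(q) → X(q) ⊕ Y(q)`. -/
def extInl (δ : OneCochain Y X) (q : L) : X.space q →ₗ[k] (extRep Y X δ).space q :=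
  LinearMap.inl k (X.space q) (Y.space q)

/-- The inclusion `Y(q) → X(q) ⊕ Y(q)`. -/
def extInr (δ : OneCochain Y X) (q : L) : Y.space q →ₗ[k] (extRep Y X δ).space q :=
  LinearMap.inr k (X.space q) (Y.space q)

/-- The projection `X(q) ⊕ Y(q) → X(q)`. -/
def extFst (δ : OneCochain Y X) (q : L) : (extRep Y X δ).space q →ₗ[k] X.space q :=
  LinearMap.fst k (X.space q) (Y.space q)

/-- The projection `X(q) ⊕ Y(q) → Y(q)`. -/
def extSnd (δ : OneCochain Y X) (q : L) : (extRep Y X δ).space q →ₗ[k] Y.space q :=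
  LinearMap.snd k (X.space q) (Y.space q)

@[simp] theorem extFst_extInl (δ : OneCochain Y X) (q : L) (x : X.space q) :
    extFst δ q (extInl δ q x) = x := rfl

@[simp] theorem extFst_extInr (δ : OneCochain Y X) (q : L) (y : Y.space q) :
    extFst δ q (extInr δ q y) = 0 := rfl

@[simp] theorem extSnd_extInl (δ : OneCochain Y X) (q : L) (x : X.space q) :
    extSnd δ q (extInl δ q x) = 0 := rfl

@[simp] theorem extSnd_extInr (δ : OneCochain Y X) (q : L) (y : Y.space q) :
    extSnd δ q (extInr δ q y) = y := rfl

theorem extInl_extFst_add (δ : OneCochain Y X) (q : L) (z : (extRep Y X δ).space q) :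
    extInl δ q (extFst δ q z) + extInr δ q (extSnd δ q z) = z :=
  Prod.fst_add_snd _

theorem ext_map_ext {δ : OneCochain Y X} {q : L} {P : Type*} [AddCommGroup P] [Module k P]
    {f g : (extRep Y X δ).space q →ₗ[k] P} (h : ∀ x, f (extInl δ q x) = g (extInl δ q x))
    (h' : ∀ y, f (extInr δ q y) = g (extInr δ q y)) : f = g :=
  LinearMap.prod_ext (LinearMap.ext h) (LinearMap.ext h')

theorem ext_elt_ext {δ : OneCochain Y X} {q : L} {z z' : (extRep Y X δ).space q}
    (h : extFst δ q z = extFst δ q z') (h' : extSnd δ q z = extSnd δ q z') : z = z' :=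
  Prod.ext h h'

theorem extRep_arrow (δ : OneCochain Y X) {a b : L} (e : a ⟶ b) :
    (extRep Y X δ).arrow e = block (X.arrow e) (δ e) (Y.arrow e) :=
  ofMaps_arrow _ _ e

theorem extRep_arrow_extInl (δ : OneCochain Y X) {a b : L} (e : a ⟶ b) (x : X.space a) :
    (extRep Y X δ).arrow e (extInl δ a x) = extInl δ b (X.arrow e x) := by
  rw [extRep_arrow]
  exact LinearMap.congr_fun (block_comp_inl (X.arrow e) (δ e) (Y.arrow e)) x

theorem extRep_arrow_extInr (δ : OneCochain Y X) {a b : L} (e : a ⟶ b) (y : Y.space a) :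
    (extRep Y X δ).arrow e (extInr δ a y) =
      extInl δ b (δ e y) + extInr δ b (Y.arrow e y) := by
  rw [extRep_arrow]
  refine Prod.ext ?_ ?_
  · exact (congrArg (· + δ e y) (map_zero (X.arrow e))).trans
      ((zero_add _).trans (add_zero _).symm)
  · exact (zero_add (Y.arrow e y)).symm

/-- The linear map on `X(q) ⊕ Y(q)` with prescribed values on both summands. -/
def extDesc {δ : OneCochain Y X} {q : L} {P : Type*} [AddCommGroup P] [Module k P]
    (f : X.space q →ₗ[k] P) (g : Y.space q →ₗ[k] P) : (extRep Y X δ).space q →ₗ[k] P :=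
  f ∘ₗ extFst δ q + g ∘ₗ extSnd δ q

@[simp] theorem extDesc_extInl {δ : OneCochain Y X} {q : L} {P : Type*} [AddCommGroup P]
    [Module k P] (f : X.space q →ₗ[k] P) (g : Y.space q →ₗ[k] P) (x : X.space q) :
    extDesc (δ := δ) f g (extInl δ q x) = f x := by simp [extDesc]

@[simp] theorem extDesc_extInr {δ : OneCochain Y X} {q : L} {P : Type*} [AddCommGroup P]
    [Module k P] (f : X.space q →ₗ[k] P) (g : Y.space q →ₗ[k] P) (y : Y.space q) :
    extDesc (δ := δ) f g (extInr δ q y) = g y := by simp [extDesc]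

/-- The composition of a family of linear maps with a morphism of representations. -/
def push (φ : X ⟶ X') : OneCochain Y X →ₗ[k] OneCochain Y X' where
  toFun δ _ b e := homAt φ b ∘ₗ δ e
  map_add' δ δ' := by funext a b e; exact LinearMap.comp_add _ _ _
  map_smul' c δ := by funext a b e; exact LinearMap.comp_smul _ _ _

/-- The composition of a morphism of representations with a family of linear maps. -/
def pull (ψ : Y' ⟶ Y) : OneCochain Y X →ₗ[k] OneCochain Y' X where
  toFun δ a _ e := δ e ∘ₗ homAt ψ a
  map_add' δ δ' := by funext a b e; exact LinearMap.add_comp _ _ _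
  map_smul' c δ := by funext a b e; exact LinearMap.smul_comp _ _ _

theorem push_apply (φ : X ⟶ X') (δ : OneCochain Y X) {a b : L} (e : a ⟶ b) (y : Y.space a) :
    push φ δ e y = homAt φ b (δ e y) := rfl

theorem pull_apply (ψ : Y' ⟶ Y) (δ : OneCochain Y X) {a b : L} (e : a ⟶ b) (y : Y'.space a) :
    pull ψ δ e y = δ e (homAt ψ a y) := rfl

theorem push_id (δ : OneCochain Y X) : push (𝟙 X) δ = δ := rfl

theorem pull_id (δ : OneCochain Y X) : pull (𝟙 Y) δ = δ := rfl

theorem push_push (φ : X ⟶ X') (φ' : X' ⟶ X'') (δ : OneCochain Y X) :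
    push φ' (push φ δ) = push (φ ≫ φ') δ := rfl

theorem pull_pull (ψ : Y' ⟶ Y) (ψ' : Y'' ⟶ Y') (δ : OneCochain Y X) :
    pull ψ' (pull ψ δ) = pull (ψ' ≫ ψ) δ := rfl

theorem push_pull (φ : X ⟶ X') (ψ : Y' ⟶ Y) (δ : OneCochain Y X) :
    push φ (pull ψ δ) = pull ψ (push φ δ) := rfl

theorem push_add_hom (φ φ' : X ⟶ X') (δ : OneCochain Y X) :
    push (φ + φ') δ = push φ δ + push φ' δ := rfl

theorem pull_add_hom (ψ ψ' : Y' ⟶ Y) (δ : OneCochain Y X) :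
    pull (ψ + ψ') δ = pull ψ δ + pull ψ' δ := by
  funext a b e
  exact LinearMap.comp_add _ _ _

theorem push_smul_hom (c : k) (φ : X ⟶ X') (δ : OneCochain Y X) :
    push (c • φ) δ = c • push φ δ := rfl

theorem pull_smul_hom (c : k) (ψ : Y' ⟶ Y) (δ : OneCochain Y X) :
    pull (c • ψ) δ = c • pull ψ δ := by
  funext a b e
  exact LinearMap.comp_smul _ _ _

/-- The family `α ↦ X(α) h - h Y(α)`. -/
def coboundary (Y X : QuiverRep k L) :
    (∀ q : L, Y.space q →ₗ[k] X.space q) →ₗ[k] OneCochain Y X where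
  toFun h a b e := X.arrow e ∘ₗ h a - h b ∘ₗ Y.arrow e
  map_add' h h' := by
    funext a b e
    ext y
    simp only [Pi.add_apply, LinearMap.sub_apply, LinearMap.comp_apply, LinearMap.add_apply,
      map_add]
    abel
  map_smul' c h := by
    funext a b e
    ext y
    simp only [Pi.smul_apply, LinearMap.sub_apply, LinearMap.comp_apply, LinearMap.smul_apply,
      map_smul, smul_sub, RingHom.id_apply]

theorem coboundary_apply (h : ∀ q : L, Y.space q →ₗ[k] X.space q) {a b : L} (e : a ⟶ b)
    (y : Y.space a) :
    coboundary Y X h e y = X.arrow e (h a y) - h b (Y.arrow e y) := rfl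

theorem push_coboundary (φ : X ⟶ X') (h : ∀ q : L, Y.space q →ₗ[k] X.space q) :
    push φ (coboundary Y X h) = coboundary Y X' fun q => homAt φ q ∘ₗ h q := by
  funext a b e
  ext y
  rw [push_apply, coboundary_apply, coboundary_apply, map_sub, ← arrow_homAt]
  rfl

theorem pull_coboundary (ψ : Y' ⟶ Y) (h : ∀ q : L, Y.space q →ₗ[k] X.space q) :
    pull ψ (coboundary Y X h) = coboundary Y' X fun q => h q ∘ₗ homAt ψ q := by
  funext a b e
  ext y
  rw [pull_apply, coboundary_apply, coboundary_apply, arrow_homAt]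
  rfl

/-- The morphism `X_δ → X'_δ'` with block matrix `(φ, h; 0, ψ)`. -/
def extHom {δ : OneCochain Y X} {δ' : OneCochain Y' X'} (φ : X ⟶ X')
    (h : ∀ q : L, Y.space q →ₗ[k] X'.space q) (ψ : Y ⟶ Y')
    (hδ : push φ δ - pull ψ δ' = coboundary Y X' h) : extRep Y X δ ⟶ extRep Y' X' δ' :=
  homOfMaps (fun q => extDesc (extInl δ' q ∘ₗ homAt φ q)
      (extInl δ' q ∘ₗ h q + extInr δ' q ∘ₗ homAt ψ q)) fun {a b} e => by
    refine ext_map_ext (fun x => ?_) fun y => ?_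
    · simp [extRep_arrow_extInl, arrow_homAt]
    · have := LinearMap.congr_fun (congrFun (congrFun (congrFun hδ a) b) e) y
      have h1 : homAt φ b (δ e y) - δ' e (homAt ψ a y) =
        X'.arrow e (h a y) - h b (Y.arrow e y) := this
      rw [sub_eq_iff_eq_add] at h1
      simp only [LinearMap.comp_apply, extDesc_extInr, LinearMap.add_apply, map_add,
        extRep_arrow_extInl, extRep_arrow_extInr, extDesc_extInl, h1, map_sub, arrow_homAt]
      abel

theorem homAt_extHom_extInl {δ : OneCochain Y X} {δ' : OneCochain Y' X'} (φ : X ⟶ X')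
    (h : ∀ q : L, Y.space q →ₗ[k] X'.space q) (ψ : Y ⟶ Y')
    (hδ : push φ δ - pull ψ δ' = coboundary Y X' h) (q : L) (x : X.space q) :
    homAt (extHom φ h ψ hδ) q (extInl δ q x) = extInl δ' q (homAt φ q x) :=
  extDesc_extInl _ _ x

theorem homAt_extHom_extInr {δ : OneCochain Y X} {δ' : OneCochain Y' X'} (φ : X ⟶ X')
    (h : ∀ q : L, Y.space q →ₗ[k] X'.space q) (ψ : Y ⟶ Y')
    (hδ : push φ δ - pull ψ δ' = coboundary Y X' h) (q : L) (y : Y.space q) :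
    homAt (extHom φ h ψ hδ) q (extInr δ q y) =
      extInl δ' q (h q y) + extInr δ' q (homAt ψ q y) :=
  extDesc_extInr _ _ y

/-- Cohomologous families give isomorphic extensions. -/
def extIsoOfCoboundary {δ δ' : OneCochain Y X} (h : ∀ q : L, Y.space q →ₗ[k] X.space q)
    (hδ : push (𝟙 X) δ - pull (𝟙 Y) δ' = coboundary Y X h) : extRep Y X δ ≅ extRep Y X δ' :=
  have hδ' : push (𝟙 X) δ' - pull (𝟙 Y) δ = coboundary Y X (-h) := by
    rw [map_neg, ← hδ, neg_sub]; rfl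
  { hom := extHom (𝟙 X) h (𝟙 Y) hδ
    inv := extHom (𝟙 X) (-h) (𝟙 Y) hδ'
    hom_inv_id := hom_ext_at fun q => ext_map_ext
      (fun x => by simp [homAt_extHom_extInl])
      (fun y => by simp [homAt_extHom_extInl, homAt_extHom_extInr])
    inv_hom_id := hom_ext_at fun q => ext_map_ext
      (fun x => by simp [homAt_extHom_extInl])
      (fun y => by simp [homAt_extHom_extInl, homAt_extHom_extInr]) }

/-- The block matrix with diagonal `φ`, `id` is a morphism between the two extensions, and extension
classes are natural. -/
theorem extClass_push (φ : X ⟶ X') (δ : OneCochain Y X) :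
    extClass Y X' (push φ δ) = (extClass Y X δ).comp (Ext.mk₀ φ) (add_zero 1) := by
  have hδ : push φ δ - pull (𝟙 Y) (push φ δ) = coboundary Y X' 0 := by
    rw [pull_id, sub_self, map_zero]
  let T : extSequence Y X δ ⟶ extSequence Y X' (push φ δ) :=
    { τ₁ := φ
      τ₂ := extHom φ 0 (𝟙 Y) hδ
      τ₃ := 𝟙 Y
      comm₁₂ := hom_ext_at fun q => LinearMap.ext fun x => (homAt_extHom_extInl _ _ _ hδ q x).symm
      comm₂₃ := hom_ext_at fun q => ext_map_ext
        (fun x => congrArg (extSnd _ q) (homAt_extHom_extInl _ _ _ hδ q x))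
        (fun y => (congrArg (extSnd _ q) (homAt_extHom_extInr _ _ _ hδ q y)).trans (by simp; rfl)) }
  have := ShortComplex.ShortExact.extClass_naturality (extSequence_shortExact Y X δ)
    (extSequence_shortExact Y X' (push φ δ)) T
  exact (this.trans (Ext.mk₀_id_comp _)).symm

theorem extClass_pull (ψ : Y' ⟶ Y) (δ : OneCochain Y X) :
    extClass Y' X (pull ψ δ) = (Ext.mk₀ ψ).comp (extClass Y X δ) (zero_add 1) := by
  have hδ : push (𝟙 X) (pull ψ δ) - pull ψ δ = coboundary Y' X 0 := by
    rw [push_id, sub_self, map_zero]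
  let T : extSequence Y' X (pull ψ δ) ⟶ extSequence Y X δ :=
    { τ₁ := 𝟙 X
      τ₂ := extHom (𝟙 X) 0 ψ hδ
      τ₃ := ψ
      comm₁₂ := hom_ext_at fun q => LinearMap.ext fun x => (homAt_extHom_extInl _ _ _ hδ q x).symm
      comm₂₃ := hom_ext_at fun q => ext_map_ext
        (fun x => (congrArg (extSnd _ q) (homAt_extHom_extInl _ _ _ hδ q x)).trans
          (map_zero (homAt ψ q)).symm)
        (fun y => (congrArg (extSnd _ q) (homAt_extHom_extInr _ _ _ hδ q y)).trans (by simp; rfl)) }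
  have := ShortComplex.ShortExact.extClass_naturality (extSequence_shortExact Y' X (pull ψ δ))
    (extSequence_shortExact Y X δ) T
  exact (Ext.comp_mk₀_id _).symm.trans this

/-- The Baer sum in disguise: `δ` and `δ'` are the components of one cochain `Δ` with values in `X ⊞
X`, and `δ + δ'` is its image under `fst + snd`. Additivity of composition in `Ext` then does the
work. -/
theorem extClass_add (δ δ' : OneCochain Y X) :
    extClass Y X (δ + δ') = extClass Y X δ + extClass Y X δ' := by
  obtain ⟨Δ, h1, h2⟩ : ∃ Δ : OneCochain Y (X ⊞ X),
      push biprod.fst Δ = δ ∧ push biprod.snd Δ = δ' := by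
    refine ⟨push biprod.inl δ + push biprod.inr δ', ?_, ?_⟩
    · rw [map_add, push_push, push_push, biprod.inl_fst, biprod.inr_fst]
      exact add_zero δ
    · rw [map_add, push_push, push_push, biprod.inl_snd, biprod.inr_snd]
      exact zero_add δ'
  rw [← h1, ← h2, ← push_add_hom, extClass_push, extClass_push, extClass_push, Ext.mk₀_add,
    Ext.comp_add]

theorem extClass_smul (c : k) (δ : OneCochain Y X) :
    extClass Y X (c • δ) = c • extClass Y X δ := by
  rw [Ext.smul_eq_comp_mk₀, ← extClass_push, push_smul_hom, push_id]

/-- The linear map that sends a family of linear maps to its class in `Ext¹(Y, X)`. -/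
def extClassLinear (Y X : QuiverRep k L) : OneCochain Y X →ₗ[k] Ext Y X 1 where
  toFun := extClass Y X
  map_add' := extClass_add
  map_smul' := extClass_smul

theorem extClassLinear_apply (δ : OneCochain Y X) : extClassLinear Y X δ = extClass Y X δ := rfl

theorem exists_section_of_extClass_eq_zero {δ : OneCochain Y X} (h : extClass Y X δ = 0) :
    ∃ s : Y ⟶ extRep Y X δ, s ≫ (extSequence Y X δ).g = 𝟙 Y := by
  obtain ⟨s, hs⟩ := Ext.covariant_sequence_exact₃ Y (extSequence_shortExact Y X δ)
    (Ext.mk₀ (𝟙 Y)) (zero_add 1) ((Ext.mk₀_id_comp _).trans h)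
  obtain ⟨s, rfl⟩ := (Ext.mk₀_bijective _ _).2 s
  rw [Ext.mk₀_comp_mk₀] at hs
  exact ⟨s, (Ext.mk₀_bijective _ _).1 hs⟩

/-- The class vanishes exactly when the extension has a section `Y ⟶ X_δ`. In block form a section
is `(-h, id)`, and commuting with the arrows means that `δ` is the coboundary of `h`. -/
theorem extClass_eq_zero_iff (δ : OneCochain Y X) :
    extClass Y X δ = 0 ↔ ∃ h, δ = coboundary Y X h := by
  constructor
  · intro h0
    obtain ⟨s', hs'⟩ := exists_section_of_extClass_eq_zero h0
    have h2 : ∀ q y, extSnd δ q (homAt s' q y) = y := fun q y =>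
      LinearMap.congr_fun (congrArg (fun f => homAt f q) hs') y
    have h3 : ∀ q y, homAt s' q y = extInl δ q (extFst δ q (homAt s' q y)) + extInr δ q y :=
      fun q y => by
        conv_lhs => rw [← extInl_extFst_add δ q (homAt s' q y), h2]
    refine ⟨-fun q => extFst δ q ∘ₗ homAt s' q, ?_⟩
    rw [map_neg]
    funext a b e
    ext y
    have h4 := arrow_homAt s' e y
    rw [h3 a y, map_add, extRep_arrow_extInl, extRep_arrow_extInr] at h4
    have h5 := congrArg (extFst δ b) h4
    simp only [map_add, extFst_extInl, extFst_extInr, add_zero] at h5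
    change δ e y = -(X.arrow e (extFst δ a (homAt s' a y)) -
      extFst δ b (homAt s' b (Y.arrow e y)))
    rw [← h5]
    abel
  · rintro ⟨h, rfl⟩
    let s : Y ⟶ extRep Y X (coboundary Y X h) :=
      homOfMaps (fun q => extInr _ q - extInl _ q ∘ₗ h q) fun {a b} e =>
        LinearMap.ext fun y => by
          simp only [LinearMap.comp_apply, LinearMap.sub_apply, map_sub, extRep_arrow_extInr,
            extRep_arrow_extInl, coboundary_apply]
          abel
    have hs : s ≫ (extSequence Y X (coboundary Y X h)).g = 𝟙 Y :=
      hom_ext_at fun q => LinearMap.ext fun y => by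
        change extSnd (coboundary Y X h) q (extInr _ q y - extInl _ q (h q y)) = y
        rw [map_sub, extSnd_extInr, extSnd_extInl, sub_zero]
    have h1 : extClass Y X (coboundary Y X h) =
        (Ext.mk₀ (s ≫ (extSequence Y X (coboundary Y X h)).g)).comp
          (extClass Y X (coboundary Y X h)) (zero_add 1) := by
      rw [hs]
      exact (Ext.mk₀_id_comp _).symm
    refine h1.trans ((Ext.mk₀_comp_mk₀_assoc s _ _).symm.trans ((congrArg (fun ξ =>
      (Ext.mk₀ s).comp ξ (zero_add 1)) (ShortComplex.ShortExact.comp_extClass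
      (extSequence_shortExact Y X (coboundary Y X h)))).trans ?_))
    exact Ext.comp_zero (Ext.mk₀ s) X 1 1 (zero_add 1)

theorem extClass_eq_iff (δ δ' : OneCochain Y X) :
    extClass Y X δ = extClass Y X δ' ↔ ∃ h, δ - δ' = coboundary Y X h := by
  rw [← extClass_eq_zero_iff, ← extClassLinear_apply, ← extClassLinear_apply,
    ← extClassLinear_apply, map_sub, sub_eq_zero]

/-- Every short exact sequence is given by a family of linear maps. -/
theorem exists_iso_extSequence {M : QuiverRep k L} (f : X ⟶ M) (g : M ⟶ Y) (h : f ≫ g = 0)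
    (hS : (ShortComplex.mk f g h).ShortExact) :
    ∃ (δ : OneCochain Y X) (I : M ≅ extRep Y X δ), f ≫ I.hom = (extSequence Y X δ).f ∧
      I.hom ≫ (extSequence Y X δ).g = g := by
  have hf := homAt_injective_of_shortExact hS
  have hg := homAt_surjective_of_shortExact hS
  have hfg := homAt_exact_of_shortExact hS
  dsimp only at hf hg hfg
  -- Over a field each `f_q` has a linear retraction. Together with `g_q` it identifies `M(q)` with
  -- `X(q) ⊕ Y(q)`, and `δ` is the off-diagonal block of the maps of `M` under this identification.
  choose r hr using fun q => (homAt f q).exists_leftInverse_of_injective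
    (LinearMap.ker_eq_bot.mpr (hf q))
  have hr' : ∀ q x, r q (homAt f q x) = x := fun q x => LinearMap.congr_fun (hr q) x
  have hgf : ∀ q x, homAt g q (homAt f q x) = 0 := fun q x => (hfg q).apply_apply_eq_zero x
  have hbij : ∀ q, Function.Bijective ((r q).prod (homAt g q)) := fun q => by
    constructor
    · rw [← LinearMap.ker_eq_bot, LinearMap.ker_eq_bot']
      intro m hm
      have h1 : r q m = 0 := congrArg Prod.fst hm
      obtain ⟨x, rfl⟩ := (hfg q m).mp (congrArg Prod.snd hm)
      rw [hr'] at h1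
      rw [h1, map_zero]
    · rintro ⟨x, y⟩
      obtain ⟨m, rfl⟩ := hg q y
      refine ⟨m + homAt f q (x - r q m), Prod.ext ?_ ?_⟩
      · change r q (m + homAt f q (x - r q m)) = x
        rw [map_add, hr']
        abel
      · change homAt g q (m + homAt f q (x - r q m)) = homAt g q m
        rw [map_add, hgf, add_zero]
  let θ : ∀ q, M.space q ≃ₗ[k] X.space q × Y.space q := fun q => LinearEquiv.ofBijective _ (hbij q)
  have hθ : ∀ q m, θ q m = (r q m, homAt g q m) := fun _ _ => rfl
  let s : ∀ q, Y.space q →ₗ[k] M.space q := fun q =>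
    (θ q).symm.toLinearMap ∘ₗ LinearMap.inr k (X.space q) (Y.space q)
  have hs : ∀ q y, θ q (s q y) = (0, y) := fun q y => (θ q).apply_symm_apply (0, y)
  have hdec : ∀ q m, m = homAt f q (r q m) + s q (homAt g q m) := fun q m => by
    apply (θ q).injective
    rw [map_add, hs, hθ, hθ, hr', hgf]
    simp
  let δ : OneCochain Y X := fun a b e => r b ∘ₗ M.arrow e ∘ₗ s a
  let I : M ≅ extRep Y X δ := isoOfEquivs (N := extRep Y X δ) (fun q => θ q) (by
    intro a b e
    refine LinearMap.ext fun m => ext_elt_ext (δ := δ) ?_ ?_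
    · have h1 : (extRep Y X δ).arrow e (θ a m) = _ :=
        congrArg ((extRep Y X δ).arrow e) (extInl_extFst_add δ a (θ a m)).symm
      have h2 : extFst δ a (θ a m) = r a m := rfl
      have h3 : extSnd δ a (θ a m) = homAt g a m := rfl
      rw [map_add, extRep_arrow_extInl, extRep_arrow_extInr, h2, h3] at h1
      change extFst δ b ((extRep Y X δ).arrow e (θ a m)) = r b (M.arrow e m)
      rw [h1]
      simp only [map_add, extFst_extInl, extFst_extInr, add_zero]
      conv_rhs => rw [hdec a m, map_add, map_add, arrow_homAt, hr']
      rfl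
    · have h1 : (extRep Y X δ).arrow e (θ a m) = _ :=
        congrArg ((extRep Y X δ).arrow e) (extInl_extFst_add δ a (θ a m)).symm
      have h3 : extSnd δ a (θ a m) = homAt g a m := rfl
      rw [map_add, extRep_arrow_extInl, extRep_arrow_extInr, h3] at h1
      change extSnd δ b ((extRep Y X δ).arrow e (θ a m)) = homAt g b (M.arrow e m)
      rw [h1]
      simp only [map_add, extSnd_extInl, extSnd_extInr, zero_add]
      exact arrow_homAt g e m)
  refine ⟨δ, I, ?_, ?_⟩
  · refine hom_ext_at fun q => LinearMap.ext fun x => Prod.ext (hr' q x) (hgf q x)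
  · exact hom_ext_at fun q => LinearMap.ext fun m => rfl

/-- A class is the pullback along some `p : Y ⟶ N` of the class of a short exact sequence; that
sequence is given by a cochain `δ`, and `pull p δ` is the cochain sought. -/
theorem extClassLinear_surjective : Function.Surjective (extClassLinear Y X) := by
  intro α
  obtain ⟨M, N, f, g, h, hS, p, rfl⟩ := Ext.exists_eq_comp_extClass α
  obtain ⟨δ, I, h1, h2⟩ := exists_iso_extSequence f g h hS
  refine ⟨pull p δ, ?_⟩
  rw [extClassLinear_apply, extClass_pull]
  let T : ShortComplex.mk f g h ⟶ extSequence N X δ :=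
    { τ₁ := 𝟙 X
      τ₂ := I.hom
      τ₃ := 𝟙 N
      comm₁₂ := (Category.id_comp _).trans h1.symm
      comm₂₃ := h2.trans (Category.comp_id _).symm }
  have := ShortComplex.ShortExact.extClass_naturality hS (extSequence_shortExact N X δ) T
  have h3 : hS.extClass = extClass N X δ :=
    (Ext.comp_mk₀_id _).symm.trans (this.trans (Ext.mk₀_id_comp _))
  rw [h3]

end Ext

end QuiverRep

end

noncomputable section

/-! ### Endomorphisms modulo the radical -/

namespace QuiverRep

variable {k : Type u} [Field k] {L : Type v} [Quiver.{w} L]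

section Radical

variable {X : QuiverRep k L} {V W U : Type u} [AddCommGroup V] [Module k V] [Module.Finite k V]
  [AddCommGroup W] [Module k W] [Module.Finite k W] [AddCommGroup U] [Module k U]
  [Module.Finite k U]

instance finite_end [Finite L] (M : QuiverRep k L) : Module.Finite k (End M) :=
  finite_hom M M

theorem nontrivial_end {M : QuiverRep k L} (h : ¬ IsZero M) : Nontrivial (End M) :=
  ⟨⟨𝟙 M, 0, fun h0 => h ((IsZero.iff_id_eq_zero M).mpr h0)⟩⟩

variable (V W) in
/-- The span of the morphisms `r ⊗ g` with `r` in an ideal of the endomorphism ring. -/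
def idealSpan (I : Ideal (End X)) : Submodule k (tens V X ⟶ tens W X) :=
  Submodule.span k {φ | ∃ r ∈ I, ∃ g : V →ₗ[k] W, φ = tensMap (M := X) (N := X) r g}

theorem tensMap_mem_idealSpan {I : Ideal (End X)} {r : End X} (hr : r ∈ I) (g : V →ₗ[k] W) :
    tensMap (M := X) (N := X) r g ∈ idealSpan V W I :=
  Submodule.subset_span ⟨r, hr, g, rfl⟩

theorem idealSpan_bot : idealSpan V W (⊥ : Ideal (End X)) = ⊥ := by
  rw [idealSpan, Submodule.span_eq_bot]
  rintro _ ⟨r, hr, g, rfl⟩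
  rw [(Submodule.mem_bot _).mp hr]
  exact LinearMap.congr_fun (map_zero (tensMapBilin V W X X)) g

/-- The ideals are multiplied in the order `I' * I` because the product `r' * r` in `End X` is `r ≫
r'`. -/
theorem comp_mem_idealSpan {I I' : Ideal (End X)} {φ : tens V X ⟶ tens W X}
    {ψ : tens W X ⟶ tens U X} (hφ : φ ∈ idealSpan V W I) (hψ : ψ ∈ idealSpan W U I') :
    φ ≫ ψ ∈ idealSpan V U (I' * I) := by
  induction hφ using Submodule.span_induction with
  | mem φ hφ =>
    obtain ⟨r, hr, g, rfl⟩ := hφ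
    induction hψ using Submodule.span_induction with
    | mem ψ hψ =>
      obtain ⟨r', hr', g', rfl⟩ := hψ
      rw [tensMap_comp]
      exact tensMap_mem_idealSpan (Submodule.mul_mem_mul hr' hr) _
    | zero => rw [comp_zero]; exact zero_mem _
    | add ψ ψ' _ _ h h' => rw [Preadditive.comp_add]; exact add_mem h h'
    | smul c ψ _ h => rw [Linear.comp_smul]; exact Submodule.smul_mem _ c h
  | zero => rw [zero_comp]; exact zero_mem _
  | add φ φ' _ _ h h' => rw [Preadditive.add_comp]; exact add_mem h h'
  | smul c φ _ h => rw [Linear.smul_comp]; exact Submodule.smul_mem _ c h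

theorem comp_tensMap_mem_idealSpan {I : Ideal (End X)} {φ : tens V X ⟶ tens W X}
    (hφ : φ ∈ idealSpan V W I) (g : W →ₗ[k] U) :
    φ ≫ tensMap (𝟙 X) g ∈ idealSpan V U I := by
  induction hφ using Submodule.span_induction with
  | mem φ hφ =>
    obtain ⟨r, hr, g', rfl⟩ := hφ
    rw [tensMap_comp, Category.comp_id]
    exact tensMap_mem_idealSpan hr _
  | zero => rw [zero_comp]; exact zero_mem _
  | add φ φ' _ _ h h' => rw [Preadditive.add_comp]; exact add_mem h h'
  | smul c φ _ h => rw [Linear.smul_comp]; exact Submodule.smul_mem _ c h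

theorem tensMap_comp_mem_idealSpan {I : Ideal (End X)} {φ : tens W X ⟶ tens U X}
    (hφ : φ ∈ idealSpan W U I) (g : V →ₗ[k] W) :
    tensMap (𝟙 X) g ≫ φ ∈ idealSpan V U I := by
  induction hφ using Submodule.span_induction with
  | mem φ hφ =>
    obtain ⟨r, hr, g', rfl⟩ := hφ
    rw [tensMap_comp, Category.id_comp]
    exact tensMap_mem_idealSpan hr _
  | zero => rw [comp_zero]; exact zero_mem _
  | add φ φ' _ _ h h' => rw [Preadditive.comp_add]; exact add_mem h h'
  | smul c φ _ h => rw [Linear.comp_smul]; exact Submodule.smul_mem _ c h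

theorem tensIns_comp_tensProj_mem {I : Ideal (End X)} {φ : tens V X ⟶ tens W X}
    (hφ : φ ∈ idealSpan V W I) (v : V) (w : Module.Dual k W) :
    (tensIns X v ≫ φ ≫ tensProj X w : End X) ∈ I := by
  induction hφ using Submodule.span_induction with
  | mem φ hφ =>
    obtain ⟨r, hr, g, rfl⟩ := hφ
    rw [tensIns_tensMap_tensProj]
    exact Submodule.smul_of_tower_mem I _ hr
  | zero => rw [zero_comp, comp_zero]; exact zero_mem _
  | add φ φ' _ _ h h' =>
    rw [Preadditive.add_comp, Preadditive.comp_add]; exact add_mem h h'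
  | smul c φ _ h =>
    rw [Linear.smul_comp, Linear.comp_smul]; exact Submodule.smul_of_tower_mem I c h

/-- The morphism `φ` agrees with `id ⊗ f` modulo the radical of the endomorphism ring of `X`. -/
def ReducesTo (φ : tens V X ⟶ tens W X) (f : V →ₗ[k] W) : Prop :=
  φ - tensMap (𝟙 X) f ∈ idealSpan V W (Ring.jacobson (End X))

theorem reducesTo_tensMap_id (f : V →ₗ[k] W) : ReducesTo (tensMap (𝟙 X) f) f := by
  rw [ReducesTo, sub_self]
  exact zero_mem _

theorem reducesTo_id : ReducesTo (𝟙 (tens V X)) LinearMap.id := by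
  rw [← tensMap_id]
  exact reducesTo_tensMap_id _

theorem ReducesTo.sub {φ φ' : tens V X ⟶ tens W X} {f f' : V →ₗ[k] W} (h : ReducesTo φ f)
    (h' : ReducesTo φ' f') : ReducesTo (φ - φ') (f - f') := by
  have h1 : φ - φ' - tensMap (𝟙 X) (f - f') =
      (φ - tensMap (𝟙 X) f) - (φ' - tensMap (𝟙 X) f') := by
    rw [← tensMapBilin_apply, map_sub, tensMapBilin_apply, tensMapBilin_apply]
    abel
  rw [ReducesTo, h1]
  exact sub_mem h h'

theorem ReducesTo.comp {φ : tens V X ⟶ tens W X} {ψ : tens W X ⟶ tens U X} {f : V →ₗ[k] W}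
    {g : W →ₗ[k] U} (hφ : ReducesTo φ f) (hψ : ReducesTo ψ g) :
    ReducesTo (φ ≫ ψ) (g ∘ₗ f) := by
  have h1 : φ ≫ ψ - tensMap (𝟙 X) (g ∘ₗ f) =
      (φ - tensMap (𝟙 X) f) ≫ (ψ - tensMap (𝟙 X) g) + (φ - tensMap (𝟙 X) f) ≫ tensMap (𝟙 X) g +
        tensMap (𝟙 X) f ≫ (ψ - tensMap (𝟙 X) g) := by
    simp only [Preadditive.sub_comp, Preadditive.comp_sub, tensMap_comp, Category.comp_id]
    abel
  rw [ReducesTo, h1]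
  refine add_mem (add_mem ?_ (comp_tensMap_mem_idealSpan hφ g)) (tensMap_comp_mem_idealSpan hψ f)
  refine Submodule.span_mono ?_ (comp_mem_idealSpan hφ hψ)
  rintro _ ⟨r, hr, g, rfl⟩
  exact ⟨r, Ideal.mul_le_left hr, g, rfl⟩

/-- The matrix coefficients of `id ⊗ (f - f')` are scalar multiples of the identity that lie in the
Jacobson radical. A nonzero one would put `1` into the radical. -/
theorem ReducesTo.unique (hX : ¬ IsZero X) {φ : tens V X ⟶ tens W X} {f f' : V →ₗ[k] W}
    (h : ReducesTo φ f) (h' : ReducesTo φ f') : f = f' := by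
  have := nontrivial_end hX
  have h0 : tensMap (𝟙 X) (f - f') ∈ idealSpan V W (Ring.jacobson (End X)) := by
    have := h.sub h'
    rw [sub_self, ReducesTo, zero_sub] at this
    exact neg_mem_iff.mp this
  rw [← sub_eq_zero]
  refine LinearMap.ext fun v => ?_
  rw [LinearMap.zero_apply, ← Module.forall_dual_apply_eq_zero_iff k]
  intro w
  by_contra hw
  have h1 := tensIns_comp_tensProj_mem h0 v w
  rw [tensIns_tensMap_tensProj] at h1
  have h2 : (1 : End X) ∈ Ring.jacobson (End X) := by
    have := Submodule.smul_of_tower_mem (Ring.jacobson (End X)) ((w ((f - f') v))⁻¹) h1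
    rwa [smul_smul, inv_mul_cancel₀ hw, one_smul] at this
  exact (Ring.jacobson_lt_top (End X)).ne ((Ideal.eq_top_iff_one _).mpr h2)

/-- In bases of `V` and `W`, `φ` is a matrix of endomorphisms of `X`. Each of them is a scalar
modulo the radical, and these scalars are the matrix of `f`. -/
theorem exists_reducesTo [IsAlgClosed k] [Finite L] (hX : Indecomposable X)
    (φ : tens V X ⟶ tens W X) : ∃ f, ReducesTo φ f := by
  have := nontrivial_end hX.1
  have hid : ∀ e : End X, e * e = e → e = 0 ∨ e = 1 := fun e he => hX.eq_zero_or_eq_id he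
  let b := Module.finBasis k V
  let c := Module.finBasis k W
  choose s hs using fun i j => exists_sub_algebraMap_mem_jacobson k hid
    (tensIns X (b i) ≫ φ ≫ tensProj X (c.coord j) : End X)
  refine ⟨∑ i, ∑ j, s i j • (b.coord i).smulRight (c j), ?_⟩
  have h1 : φ - tensMap (𝟙 X) (∑ i, ∑ j, s i j • (b.coord i).smulRight (c j)) =
      ∑ i, ∑ j, tensMap (M := X) (N := X) (tensIns X (b i) ≫ φ ≫ tensProj X (c.coord j) -
        s i j • 𝟙 X) ((b.coord i).smulRight (c j)) := by
    conv_lhs => rw [tens_hom_eq_sum b c φ]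
    simp only [← tensMapBilin_apply, map_sum, map_sub, map_smul, LinearMap.sub_apply,
      LinearMap.smul_apply, Finset.sum_sub_distrib]
  rw [ReducesTo, h1]
  exact sum_mem fun i _ => sum_mem fun j _ => tensMap_mem_idealSpan (hs i j) _

/-- An idempotent equals all its positive powers, so it lies in the span attached to every power of
the radical, and the radical is nilpotent. -/
theorem eq_zero_of_idempotent_of_reducesTo_zero [Finite L] {φ : tens V X ⟶ tens V X}
    (hφ : φ ≫ φ = φ) (h : ReducesTo φ 0) : φ = 0 := by
  have : IsArtinianRing (End X) := IsArtinianRing.of_finite k _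
  obtain ⟨n, hn⟩ := IsSemiprimaryRing.isNilpotent (R := End X)
  have h' : φ ∈ idealSpan V V (Ring.jacobson (End X)) := by
    rwa [ReducesTo, ← tensMapBilin_apply, map_zero, sub_zero] at h
  have h2 : ∀ m, φ ∈ idealSpan V V (Ring.jacobson (End X) ^ (m + 1)) := by
    intro m
    induction m with
    | zero => rwa [zero_add, Submodule.pow_one]
    | succ m ih =>
      rw [← hφ, Submodule.pow_succ]
      exact comp_mem_idealSpan h' ih
  have h3 := h2 n
  rw [Submodule.pow_succ, hn, Submodule.zero_eq_bot, Submodule.bot_mul, idealSpan_bot] at h3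
  exact (Submodule.mem_bot k).mp h3

end Radical

end QuiverRep

end

noncomputable section

/-! ### Morphisms between extensions -/

namespace QuiverRep

variable {k : Type u} [Field k] {L : Type v} [Quiver.{w} L]

section Block

variable {X X' X'' Y Y' Y'' : QuiverRep k L} {δ : OneCochain Y X} {δ' : OneCochain Y' X'}
  {δ'' : OneCochain Y'' X''}

/-- If there are no nonzero morphisms from `X` to `Y'`, then all morphisms `X_δ → X'_δ'` have
triangular block matrices. -/
theorem exists_eq_extHom (h0 : ∀ f : X ⟶ Y', f = 0) (φ : extRep Y X δ ⟶ extRep Y' X' δ') :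
    ∃ (f : X ⟶ X') (h : ∀ q : L, Y.space q →ₗ[k] X'.space q) (g : Y ⟶ Y')
      (hδ : push f δ - pull g δ' = coboundary Y X' h), φ = extHom f h g hδ := by
  have h1 : ∀ q x, extSnd δ' q (homAt φ q (extInl δ q x)) = 0 := fun q x =>
    LinearMap.congr_fun (congrArg (fun f => homAt f q)
      (h0 ((extSequence Y X δ).f ≫ φ ≫ (extSequence Y' X' δ').g))) x
  have h2 : ∀ q x, extInl δ' q (extFst δ' q (homAt φ q (extInl δ q x))) =
      homAt φ q (extInl δ q x) := fun q x => by
    conv_rhs => rw [← extInl_extFst_add δ' q (homAt φ q (extInl δ q x)), h1, map_zero, add_zero]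
  have h3 := fun q y => extInl_extFst_add δ' q (homAt φ q (extInr δ q y))
  have h4 : ∀ {a b : L} (e : a ⟶ b) (y : Y.space a),
      X'.arrow e (extFst δ' a (homAt φ a (extInr δ a y))) +
        δ' e (extSnd δ' a (homAt φ a (extInr δ a y))) =
      extFst δ' b (homAt φ b (extInl δ b (δ e y))) +
        extFst δ' b (homAt φ b (extInr δ b (Y.arrow e y))) ∧
      Y'.arrow e (extSnd δ' a (homAt φ a (extInr δ a y))) =
        extSnd δ' b (homAt φ b (extInr δ b (Y.arrow e y))) := by
    intro a b e y
    have h5 := arrow_homAt φ e (extInr δ a y)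
    rw [← h3, map_add, extRep_arrow_extInl, extRep_arrow_extInr, extRep_arrow_extInr, map_add]
      at h5
    constructor
    · simpa using congrArg (extFst δ' b) h5
    · simpa [h1] using congrArg (extSnd δ' b) h5
  let f : X ⟶ X' := homOfMaps (fun q => extFst δ' q ∘ₗ homAt φ q ∘ₗ extInl δ q) fun {a b} e => by
    refine LinearMap.ext fun x => ?_
    have h5 := arrow_homAt φ e (extInl δ a x)
    rw [← h2, extRep_arrow_extInl, extRep_arrow_extInl] at h5
    exact congrArg (extFst δ' b) h5
  let g : Y ⟶ Y' := homOfMaps (fun q => extSnd δ' q ∘ₗ homAt φ q ∘ₗ extInr δ q) fun e =>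
    LinearMap.ext fun y => (h4 e y).2
  have hδ : push f δ - pull g δ' =
      coboundary Y X' fun q => extFst δ' q ∘ₗ homAt φ q ∘ₗ extInr δ q := by
    funext a b e
    refine LinearMap.ext fun y => ?_
    have h5 := (h4 e y).1
    change extFst δ' b (homAt φ b (extInl δ b (δ e y))) -
        δ' e (extSnd δ' a (homAt φ a (extInr δ a y))) =
      X'.arrow e (extFst δ' a (homAt φ a (extInr δ a y))) -
        extFst δ' b (homAt φ b (extInr δ b (Y.arrow e y)))
    rw [sub_eq_sub_iff_add_eq_add, h5]
  refine ⟨f, _, g, hδ, hom_ext_at fun q => ext_map_ext (fun x => ?_) fun y => ?_⟩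
  · rw [homAt_extHom_extInl]
    exact (h2 q x).symm
  · rw [homAt_extHom_extInr]
    exact (h3 q y).symm

theorem extHom_inj {f f' : X ⟶ X'} {h h' : ∀ q : L, Y.space q →ₗ[k] X'.space q} {g g' : Y ⟶ Y'}
    {hδ : push f δ - pull g δ' = coboundary Y X' h}
    {hδ' : push f' δ - pull g' δ' = coboundary Y X' h'}
    (H : extHom f h g hδ = extHom f' h' g' hδ') : f = f' ∧ g = g' := by
  constructor
  · refine hom_ext_at fun q => LinearMap.ext fun x => ?_
    have := congrArg (extFst δ' q) (LinearMap.congr_fun (congrArg (fun f => homAt f q) H)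
      (extInl δ q x))
    rwa [homAt_extHom_extInl, homAt_extHom_extInl] at this
  · refine hom_ext_at fun q => LinearMap.ext fun x => ?_
    have := congrArg (extSnd δ' q) (LinearMap.congr_fun (congrArg (fun f => homAt f q) H)
      (extInr δ q x))
    rwa [homAt_extHom_extInr, homAt_extHom_extInr, map_add, map_add, extSnd_extInl,
      extSnd_extInl, extSnd_extInr, extSnd_extInr, zero_add, zero_add] at this

/-- The off-diagonal block `f' h + h' g` stays existential, since reductions see only the diagonal.
-/
theorem extHom_comp {f : X ⟶ X'} {h : ∀ q : L, Y.space q →ₗ[k] X'.space q} {g : Y ⟶ Y'}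
    (hδ : push f δ - pull g δ' = coboundary Y X' h)
    {f' : X' ⟶ X''} {h' : ∀ q : L, Y'.space q →ₗ[k] X''.space q} {g' : Y' ⟶ Y''}
    (hδ' : push f' δ' - pull g' δ'' = coboundary Y' X'' h') :
    ∃ (h'' : ∀ q : L, Y.space q →ₗ[k] X''.space q)
      (hδ'' : push (f ≫ f') δ - pull (g ≫ g') δ'' = coboundary Y X'' h''),
      extHom f h g hδ ≫ extHom f' h' g' hδ' = extHom (f ≫ f') h'' (g ≫ g') hδ'' := by
  refine ⟨fun q => homAt f' q ∘ₗ h q + h' q ∘ₗ homAt g q, ?_, ?_⟩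
  · have h1 := (push_coboundary f' h).symm
    have h2 := (pull_coboundary g h').symm
    rw [← hδ, map_sub, push_push] at h1
    rw [← hδ', map_sub, pull_pull] at h2
    have h3 : (fun q => homAt f' q ∘ₗ h q + h' q ∘ₗ homAt g q) =
      (fun q => homAt f' q ∘ₗ h q) + fun q => h' q ∘ₗ homAt g q := rfl
    rw [h3, map_add, h1, h2, push_pull]
    abel
  · refine hom_ext_at fun q => ext_map_ext (fun x => ?_) fun y => ?_
    · rw [homAt_comp, LinearMap.comp_apply, homAt_extHom_extInl, homAt_extHom_extInl,
        homAt_extHom_extInl]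
      rfl
    · rw [homAt_comp, LinearMap.comp_apply, homAt_extHom_extInr, homAt_extHom_extInr, map_add,
        homAt_extHom_extInl, homAt_extHom_extInr, LinearMap.add_apply, map_add]
      simp only [LinearMap.comp_apply, homAt_comp]
      abel

theorem extHom_sub {f : X ⟶ X'} {h : ∀ q : L, Y.space q →ₗ[k] X'.space q} {g : Y ⟶ Y'}
    (hδ : push f δ - pull g δ' = coboundary Y X' h)
    {f' : X ⟶ X'} {h' : ∀ q : L, Y.space q →ₗ[k] X'.space q} {g' : Y ⟶ Y'}
    (hδ' : push f' δ - pull g' δ' = coboundary Y X' h') :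
    ∃ hδ'' : push (f - f') δ - pull (g - g') δ' = coboundary Y X' (h - h'),
      extHom f h g hδ - extHom f' h' g' hδ' = extHom (f - f') (h - h') (g - g') hδ'' := by
  refine ⟨?_, ?_⟩
  · rw [map_sub, ← hδ, ← hδ']
    funext a b e
    refine LinearMap.ext fun y => ?_
    change homAt f b (δ e y) - homAt f' b (δ e y) - δ' e (homAt g a y - homAt g' a y) =
      homAt f b (δ e y) - δ' e (homAt g a y) - (homAt f' b (δ e y) - δ' e (homAt g' a y))
    rw [map_sub]
    abel
  · refine hom_ext_at fun q => ext_map_ext (fun x => ?_) fun y => ?_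
    · rw [homAt_sub, LinearMap.sub_apply, homAt_extHom_extInl, homAt_extHom_extInl,
        homAt_extHom_extInl, homAt_sub, LinearMap.sub_apply, map_sub]
    · rw [homAt_sub, LinearMap.sub_apply, homAt_extHom_extInr, homAt_extHom_extInr,
        homAt_extHom_extInr, homAt_sub, LinearMap.sub_apply, map_sub, Pi.sub_apply,
        LinearMap.sub_apply, map_sub]
      abel

theorem id_eq_extHom : ∃ hδ : push (𝟙 X) δ - pull (𝟙 Y) δ = coboundary Y X 0,
    𝟙 (extRep Y X δ) = extHom (𝟙 X) 0 (𝟙 Y) hδ := by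
  refine ⟨by rw [push_id, pull_id, sub_self, map_zero], ?_⟩
  refine hom_ext_at fun q => ext_map_ext (fun x => ?_) fun y => ?_
  · rw [homAt_extHom_extInl]; rfl
  · rw [homAt_extHom_extInr]
    exact ((congrArg (· + _) (map_zero (extInl δ q))).trans (zero_add _)).symm

end Block

/-! ### Morphisms modulo the radical -/

section Reduction

variable {X Y : QuiverRep k L} {Vx Vy Wx Wy Ux Uy : Type u}
  [AddCommGroup Vx] [Module k Vx] [Module.Finite k Vx]
  [AddCommGroup Vy] [Module k Vy] [Module.Finite k Vy]
  [AddCommGroup Wx] [Module k Wx] [Module.Finite k Wx]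
  [AddCommGroup Wy] [Module k Wy] [Module.Finite k Wy]
  [AddCommGroup Ux] [Module k Ux] [Module.Finite k Ux]
  [AddCommGroup Uy] [Module k Uy] [Module.Finite k Uy]
  {δ : OneCochain (tens Vy Y) (tens Vx X)} {δ' : OneCochain (tens Wy Y) (tens Wx X)}
  {δ'' : OneCochain (tens Uy Y) (tens Ux X)}

/-- The morphism `φ` has a triangular block matrix whose diagonal entries agree with `id ⊗ f` and
`id ⊗ g` modulo the radicals. -/
def BlockReducesTo (φ : extRep (tens Vy Y) (tens Vx X) δ ⟶ extRep (tens Wy Y) (tens Wx X) δ')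
    (f : Vx →ₗ[k] Wx) (g : Vy →ₗ[k] Wy) : Prop :=
  ∃ (φx : tens Vx X ⟶ tens Wx X) (h : ∀ q : L, (tens Vy Y).space q →ₗ[k] (tens Wx X).space q)
    (φy : tens Vy Y ⟶ tens Wy Y)
    (hδ : push φx δ - pull φy δ' = coboundary (tens Vy Y) (tens Wx X) h),
    φ = extHom φx h φy hδ ∧ ReducesTo φx f ∧ ReducesTo φy g

theorem exists_blockReducesTo [IsAlgClosed k] [Finite L] (hX : Indecomposable X)
    (hY : Indecomposable Y) (hXY : ∀ f : X ⟶ Y, f = 0)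
    (φ : extRep (tens Vy Y) (tens Vx X) δ ⟶ extRep (tens Wy Y) (tens Wx X) δ') :
    ∃ f g, BlockReducesTo φ f g := by
  obtain ⟨φx, h, φy, hδ, rfl⟩ := exists_eq_extHom (tens_hom_eq_zero hXY) φ
  obtain ⟨f, hf⟩ := exists_reducesTo hX φx
  obtain ⟨g, hg⟩ := exists_reducesTo hY φy
  exact ⟨f, g, φx, h, φy, hδ, rfl, hf, hg⟩

theorem BlockReducesTo.unique (hX : ¬ IsZero X) (hY : ¬ IsZero Y)
    {φ : extRep (tens Vy Y) (tens Vx X) δ ⟶ extRep (tens Wy Y) (tens Wx X) δ'}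
    {f f' : Vx →ₗ[k] Wx} {g g' : Vy →ₗ[k] Wy} (h : BlockReducesTo φ f g)
    (h' : BlockReducesTo φ f' g') : f = f' ∧ g = g' := by
  obtain ⟨φx, h, φy, hδ, rfl, hf, hg⟩ := h
  obtain ⟨φx', h', φy', hδ', H, hf', hg'⟩ := h'
  obtain ⟨rfl, rfl⟩ := extHom_inj H
  exact ⟨hf.unique hX hf', hg.unique hY hg'⟩

theorem blockReducesTo_id :
    BlockReducesTo (𝟙 (extRep (tens Vy Y) (tens Vx X) δ)) LinearMap.id LinearMap.id := by
  obtain ⟨hδ, H⟩ := id_eq_extHom (δ := δ)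
  exact ⟨_, _, _, hδ, H, reducesTo_id, reducesTo_id⟩

theorem BlockReducesTo.comp
    {φ : extRep (tens Vy Y) (tens Vx X) δ ⟶ extRep (tens Wy Y) (tens Wx X) δ'}
    {ψ : extRep (tens Wy Y) (tens Wx X) δ' ⟶ extRep (tens Uy Y) (tens Ux X) δ''}
    {f : Vx →ₗ[k] Wx} {f' : Wx →ₗ[k] Ux} {g : Vy →ₗ[k] Wy} {g' : Wy →ₗ[k] Uy}
    (h : BlockReducesTo φ f g) (h' : BlockReducesTo ψ f' g') :
    BlockReducesTo (φ ≫ ψ) (f' ∘ₗ f) (g' ∘ₗ g) := by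
  obtain ⟨φx, h, φy, hδ, rfl, hf, hg⟩ := h
  obtain ⟨φx', h', φy', hδ', rfl, hf', hg'⟩ := h'
  obtain ⟨h'', hδ'', H⟩ := extHom_comp hδ hδ'
  exact ⟨_, _, _, hδ'', H, hf.comp hf', hg.comp hg'⟩

theorem BlockReducesTo.sub
    {φ φ' : extRep (tens Vy Y) (tens Vx X) δ ⟶ extRep (tens Wy Y) (tens Wx X) δ'}
    {f f' : Vx →ₗ[k] Wx} {g g' : Vy →ₗ[k] Wy}
    (h : BlockReducesTo φ f g) (h' : BlockReducesTo φ' f' g') :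
    BlockReducesTo (φ - φ') (f - f') (g - g') := by
  obtain ⟨φx, h, φy, hδ, rfl, hf, hg⟩ := h
  obtain ⟨φx', h', φy', hδ', rfl, hf', hg'⟩ := h'
  obtain ⟨hδ'', H⟩ := extHom_sub hδ hδ'
  exact ⟨_, _, _, hδ'', H, hf.sub hf', hg.sub hg'⟩

/-- The diagonal blocks of `φ` are idempotents that reduce to zero, hence vanish. Then `φ` is
strictly triangular and `φ = φ ≫ φ = 0`. -/
theorem eq_zero_of_idempotent_of_blockReducesTo_zero [Finite L]
    {φ : extRep (tens Vy Y) (tens Vx X) δ ⟶ extRep (tens Vy Y) (tens Vx X) δ}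
    (hφ : φ ≫ φ = φ) (h : BlockReducesTo φ 0 0) : φ = 0 := by
  obtain ⟨φx, h, φy, hδ, rfl, hf, hg⟩ := h
  obtain ⟨h'', hδ'', H⟩ := extHom_comp hδ hδ
  rw [hφ] at H
  obtain ⟨hx, hy⟩ := extHom_inj H
  obtain rfl := eq_zero_of_idempotent_of_reducesTo_zero hx.symm hf
  obtain rfl := eq_zero_of_idempotent_of_reducesTo_zero hy.symm hg
  rw [← hφ]
  refine hom_ext_at fun q => ext_map_ext (fun x => ?_) fun y => ?_
  · rw [homAt_comp, LinearMap.comp_apply, homAt_extHom_extInl, homAt_extHom_extInl]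
    exact map_zero (extInl δ q)
  · rw [homAt_comp, LinearMap.comp_apply, homAt_extHom_extInr, map_add, homAt_extHom_extInl]
    have h1 : extInr δ q (homAt (0 : tens Vy Y ⟶ tens Vy Y) q y) = 0 := map_zero (extInr δ q)
    rw [h1, map_zero, add_zero]
    exact map_zero (extInl δ q)

end Reduction

end QuiverRep

end

noncomputable section

/-! ### Glueing along a representation of the Kronecker quiver -/

namespace Kronecker

open QuiverRep

variable {k : Type u} [Field k] {L : Type v} [Quiver.{w} L] {n : ℕ}

/-- The representation of the Kronecker quiver with prescribed spaces and maps. -/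
def ofMaps (Vy Vx : Type u) [AddCommGroup Vy] [Module k Vy] [Module.Finite k Vy]
    [AddCommGroup Vx] [Module k Vx] [Module.Finite k Vx] (t : Fin n → Vy →ₗ[k] Vx) :
    QuiverRep k (Kronecker n) :=
  QuiverRep.ofMaps (fun | .y => FGModuleCat.of k Vy | .x => FGModuleCat.of k Vx)
    fun _ _ e => match e with | .arr i => t i

theorem ofMaps_arrow_arr (Vy Vx : Type u) [AddCommGroup Vy] [Module k Vy] [Module.Finite k Vy]
    [AddCommGroup Vx] [Module k Vx] [Module.Finite k Vx] (t : Fin n → Vy →ₗ[k] Vx) (i : Fin n) :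
    (ofMaps Vy Vx t).arrow (arr i) = t i :=
  QuiverRep.ofMaps_arrow _ _ (arr i)

/-- The morphism of representations of the Kronecker quiver given by two linear maps. -/
def homMk {T T' : QuiverRep k (Kronecker n)} (f : T.space x →ₗ[k] T'.space x)
    (g : T.space y →ₗ[k] T'.space y)
    (h : ∀ i, T'.arrow (arr i) ∘ₗ g = f ∘ₗ T.arrow (arr i)) : T ⟶ T' :=
  homOfMaps (fun | .y => g | .x => f) (by
    intro a b e
    match a, b, e with
    | _, _, .arr i => exact h i)

theorem hom_ext {T T' : QuiverRep k (Kronecker n)} {f g : T ⟶ T'} (hx : homAt f x = homAt g x)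
    (hy : homAt f y = homAt g y) : f = g :=
  hom_ext_at fun
    | .y => hy
    | .x => hx

section Glue

variable {X Y : QuiverRep k L} (ζ : Fin n → OneCochain Y X)

/-- The family `∑ i, ζ_i ⊗ t_i`. -/
def glueCochain {V W : Type u} [AddCommGroup V] [Module k V] [Module.Finite k V]
    [AddCommGroup W] [Module k W] [Module.Finite k W] (t : Fin n → V →ₗ[k] W) :
    OneCochain (tens V Y) (tens W X) :=
  fun _ _ e => ∑ i, tensLift (tmulAt.compl₁₂ (ζ i e) (t i))

theorem glueCochain_tmulAt {V W : Type u} [AddCommGroup V] [Module k V] [Module.Finite k V]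
    [AddCommGroup W] [Module k W] [Module.Finite k W] (t : Fin n → V →ₗ[k] W) {a b : L}
    (e : a ⟶ b) (m : Y.space a) (v : V) :
    glueCochain ζ t e (tmulAt m v) = ∑ i, tmulAt (M := X) (ζ i e m) (t i v) := by
  rw [glueCochain, LinearMap.sum_apply]
  rfl

/-- The representation `glueObj ζ T` as an extension of `Y ⊗ T(y)` by `X ⊗ T(x)`. -/
abbrev glueExt (T : QuiverRep k (Kronecker n)) : QuiverRep k L :=
  extRep (tens (T.space y) Y) (tens (T.space x) X) (glueCochain ζ fun i => T.arrow (arr i))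

/-- The identification of `glueObj ζ T` with an extension. -/
def glueIso (T : QuiverRep k (Kronecker n)) : (glue ζ).obj T ≅ glueExt ζ T :=
  -- Both representations have the same spaces and the same block matrices, so the identity at each
  -- vertex serves.
  isoOfEquivs (fun q => LinearEquiv.refl k ((X.space q ⊗[k] T.space x) × (Y.space q ⊗[k] T.space y)))
    fun {a b} e => by
      have h1 : ((glue ζ).obj T).arrow e = block ((X.arrow e).rTensor (T.space x))
          (∑ i, TensorProduct.map (ζ i e) (T.arrow (arr i))) ((Y.arrow e).rTensor (T.space y)) :=
        QuiverRep.ofMaps_arrow _ _ e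
      have h2 := extRep_arrow (glueCochain ζ fun i => T.arrow (arr i)) e
      rw [tens_arrow, tens_arrow] at h2
      change (glueExt ζ T).arrow e = ((glue ζ).obj T).arrow e
      rw [h2, h1]
      rfl

theorem glue_map_eq {T T' : QuiverRep k (Kronecker n)} (f : T ⟶ T') :
    ∃ hδ : push (tensMap (𝟙 X) (homAt f x)) (glueCochain ζ fun i => T.arrow (arr i)) -
        pull (tensMap (𝟙 Y) (homAt f y)) (glueCochain ζ fun i => T'.arrow (arr i)) =
        coboundary _ _ 0,
      (glue ζ).map f = (glueIso ζ T).hom ≫ extHom (tensMap (𝟙 X) (homAt f x)) 0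
        (tensMap (𝟙 Y) (homAt f y)) hδ ≫ (glueIso ζ T').inv := by
  have hδ : push (tensMap (𝟙 X) (homAt f x)) (glueCochain ζ fun i => T.arrow (arr i)) -
      pull (tensMap (𝟙 Y) (homAt f y)) (glueCochain ζ fun i => T'.arrow (arr i)) =
      coboundary _ _ 0 := by
    rw [map_zero, sub_eq_zero]
    funext a b e
    refine tens_map_ext fun m v => ?_
    rw [push_apply, pull_apply, homAt_tensMap, glueCochain_tmulAt, glueCochain_tmulAt, map_sum]
    refine Finset.sum_congr rfl fun i _ => ?_
    rw [homAt_tensMap, arrow_homAt]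
    rfl
  refine ⟨hδ, ?_⟩
  rw [← Category.assoc, Iso.eq_comp_inv]
  refine hom_ext_at fun q => ext_map_ext
    (δ := glueCochain ζ fun i => T.arrow (arr i)) (fun z => ?_) fun z => ?_
  · exact Eq.trans (Prod.ext rfl (map_zero ((homAt f y).lTensor (Y.space q))))
      (homAt_extHom_extInl _ _ _ hδ q z).symm
  · refine Eq.trans ?_ (homAt_extHom_extInr _ _ _ hδ q z).symm
    refine Prod.ext ?_ ?_
    · exact (map_zero ((homAt f x).lTensor (X.space q))).trans
        (add_zero (0 : (tens (T'.space x) X).space q)).symm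
    · exact (zero_add (homAt (tensMap (𝟙 Y) (homAt f y)) q z)).symm

theorem blockReducesTo_glue_map {T T' : QuiverRep k (Kronecker n)} (f : T ⟶ T') :
    BlockReducesTo ((glueIso ζ T).inv ≫ (glue ζ).map f ≫ (glueIso ζ T').hom)
      (homAt f x) (homAt f y) := by
  obtain ⟨hδ, H⟩ := glue_map_eq ζ f
  refine ⟨_, _, _, hδ, ?_, reducesTo_tensMap_id _, reducesTo_tensMap_id _⟩
  rw [H]
  simp

variable {ζ}

/-- Inserting `v` and applying `c` extracts a cochain from `Y` to `X`. This is linear in `φ`, and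
for `φ = r ⊗ g` it gives `∑ c (g (t_i v)) • r ζ_i`, whose class lies in the radical if `r ∈ J(End
X)`. Hence modulo the radical only the reduction `f` matters. -/
theorem extClass_push_glueCochain_mem {V W U : Type u} [AddCommGroup V] [Module k V]
    [Module.Finite k V] [AddCommGroup W] [Module k W] [Module.Finite k W] [AddCommGroup U]
    [Module k U] [Module.Finite k U]
    (t : Fin n → V →ₗ[k] W) {φ : tens W X ⟶ tens U X} {f : W →ₗ[k] U} (hφ : ReducesTo φ f) (v : V)
    (c : Module.Dual k U) :
    extClass Y X (pull (tensIns Y v) (push (tensProj X c) (push φ (glueCochain ζ t)))) -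
      ∑ i, c (f (t i v)) • extClass Y X (ζ i) ∈ extRadical Y X := by
  let Λ : (tens W X ⟶ tens U X) →ₗ[k] Ext Y X 1 :=
    { toFun := fun φ =>
        extClassLinear Y X (pull (tensIns Y v) (push (tensProj X c) (push φ (glueCochain ζ t))))
      map_add' := fun φ φ' => by rw [push_add_hom, map_add, map_add, map_add]
      map_smul' := fun c φ => by
        rw [push_smul_hom, map_smul, map_smul, map_smul, RingHom.id_apply] }
  have h1 : ∀ (r : X ⟶ X) (g : W →ₗ[k] U), Λ (tensMap r g) =
      ∑ i, c (g (t i v)) • (extClass Y X (ζ i)).comp (Ext.mk₀ r) (add_zero 1) := by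
    intro r g
    have h2 : pull (tensIns Y v) (push (tensProj X c) (push (tensMap r g) (glueCochain ζ t))) =
        ∑ i, c (g (t i v)) • push r (ζ i) := by
      funext a b e
      refine LinearMap.ext fun m => ?_
      rw [pull_apply, push_apply, push_apply, homAt_tensIns, glueCochain_tmulAt, map_sum, map_sum]
      simp only [Finset.sum_apply, LinearMap.sum_apply]
      rfl
    change extClassLinear Y X (pull (tensIns Y v) (push (tensProj X c) (push (tensMap r g)
      (glueCochain ζ t)))) = _
    rw [h2, map_sum]
    refine Finset.sum_congr rfl fun i _ => ?_
    rw [map_smul, extClassLinear_apply, extClass_push]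
  have h3 : ∀ ψ ∈ idealSpan W U (Ring.jacobson (End X)), Λ ψ ∈ extRadical Y X := by
    intro ψ hψ
    induction hψ using Submodule.span_induction with
    | mem ψ hψ =>
      obtain ⟨r, hr, g, rfl⟩ := hψ
      rw [h1]
      exact sum_mem fun i _ => Submodule.smul_mem _ _
        (Submodule.subset_span (Or.inl ⟨r, hr, _, rfl⟩))
    | zero => rw [map_zero]; exact zero_mem _
    | add _ _ _ _ h h' => rw [map_add]; exact add_mem h h'
    | smul c _ _ h => rw [map_smul]; exact Submodule.smul_mem _ _ h
  have h4 := h3 _ hφ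
  rw [map_sub, h1] at h4
  simp only [Ext.comp_mk₀_id] at h4
  exact h4

theorem extClass_pull_glueCochain_mem {V W U : Type u} [AddCommGroup V] [Module k V]
    [Module.Finite k V] [AddCommGroup W] [Module k W] [Module.Finite k W] [AddCommGroup U]
    [Module k U] [Module.Finite k U]
    (t : Fin n → V →ₗ[k] W) {φ : tens U Y ⟶ tens V Y} {f : U →ₗ[k] V} (hφ : ReducesTo φ f) (v : U)
    (c : Module.Dual k W) :
    extClass Y X (pull (tensIns Y v) (push (tensProj X c) (pull φ (glueCochain ζ t)))) -
      ∑ i, c (t i (f v)) • extClass Y X (ζ i) ∈ extRadical Y X := by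
  let Λ : (tens U Y ⟶ tens V Y) →ₗ[k] Ext Y X 1 :=
    { toFun := fun φ =>
        extClassLinear Y X (pull (tensIns Y v) (push (tensProj X c) (pull φ (glueCochain ζ t))))
      map_add' := fun φ φ' => by rw [pull_add_hom, map_add, map_add, map_add]
      map_smul' := fun c φ => by
        rw [pull_smul_hom, map_smul, map_smul, map_smul, RingHom.id_apply] }
  have h1 : ∀ (r : Y ⟶ Y) (g : U →ₗ[k] V), Λ (tensMap r g) =
      ∑ i, c (t i (g v)) • (Ext.mk₀ r).comp (extClass Y X (ζ i)) (zero_add 1) := by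
    intro r g
    have h2 : pull (tensIns Y v) (push (tensProj X c) (pull (tensMap r g) (glueCochain ζ t))) =
        ∑ i, c (t i (g v)) • pull r (ζ i) := by
      funext a b e
      refine LinearMap.ext fun m => ?_
      rw [pull_apply, push_apply, pull_apply, homAt_tensIns, homAt_tensMap, glueCochain_tmulAt,
        map_sum]
      simp only [Finset.sum_apply, LinearMap.sum_apply]
      rfl
    change extClassLinear Y X (pull (tensIns Y v) (push (tensProj X c) (pull (tensMap r g)
      (glueCochain ζ t)))) = _
    rw [h2, map_sum]
    refine Finset.sum_congr rfl fun i _ => ?_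
    rw [map_smul, extClassLinear_apply, extClass_pull]
  have h3 : ∀ ψ ∈ idealSpan U V (Ring.jacobson (End Y)), Λ ψ ∈ extRadical Y X := by
    intro ψ hψ
    induction hψ using Submodule.span_induction with
    | mem ψ hψ =>
      obtain ⟨r, hr, g, rfl⟩ := hψ
      rw [h1]
      exact sum_mem fun i _ => Submodule.smul_mem _ _
        (Submodule.subset_span (Or.inr ⟨r, hr, _, rfl⟩))
    | zero => rw [map_zero]; exact zero_mem _
    | add _ _ _ _ h h' => rw [map_add]; exact add_mem h h'
    | smul c _ _ h => rw [map_smul]; exact Submodule.smul_mem _ _ h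
  have h4 := h3 _ hφ
  rw [map_sub, h1] at h4
  simp only [Ext.mk₀_id_comp] at h4
  exact h4

/-- The reduction of a morphism between glued representations is a morphism of representations of
the Kronecker quiver. -/
theorem comp_eq_comp_of_blockReducesTo
    (hζ : LinearIndependent k fun i => (extRadical Y X).mkQ (extClass Y X (ζ i)))
    {T T' : QuiverRep k (Kronecker n)} {φ : glueExt ζ T ⟶ glueExt ζ T'}
    {f : T.space x →ₗ[k] T'.space x} {g : T.space y →ₗ[k] T'.space y}
    (h : BlockReducesTo φ f g) (i : Fin n) :
    T'.arrow (arr i) ∘ₗ g = f ∘ₗ T.arrow (arr i) := by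
  obtain ⟨φx, h, φy, hδ, rfl, hf, hg⟩ := h
  refine LinearMap.ext fun v => ?_
  rw [← sub_eq_zero, ← Module.forall_dual_apply_eq_zero_iff k]
  intro c
  -- Contracted with `v` and `c`, the relation `hδ` becomes a linear relation among the classes of
  -- the `ζ i` modulo the radical. Its coefficients are those of `f T(i) - T'(i) g` up to sign, and
  -- independence makes them vanish.
  have h1 := extClass_push_glueCochain_mem (Y := Y) (ζ := ζ) (fun i => T.arrow (arr i)) hf v c
  have h2 := extClass_pull_glueCochain_mem (X := X) (ζ := ζ) (fun i => T'.arrow (arr i)) hg v c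
  have h3 : extClass Y X (pull (tensIns Y v) (push (tensProj X c)
        (push φx (glueCochain ζ fun i => T.arrow (arr i))))) =
      extClass Y X (pull (tensIns Y v) (push (tensProj X c)
        (pull φy (glueCochain ζ fun i => T'.arrow (arr i))))) := by
    rw [extClass_eq_iff]
    rw [← map_sub, ← map_sub, hδ, push_coboundary, pull_coboundary]
    exact ⟨_, rfl⟩
  rw [h3] at h1
  have h4 := sub_mem h1 h2
  rw [sub_sub_sub_cancel_left, ← Finset.sum_sub_distrib] at h4
  have h5 := (Submodule.Quotient.mk_eq_zero (extRadical Y X)).mpr h4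
  rw [← Submodule.mkQ_apply, map_sum] at h5
  have h6 := Fintype.linearIndependent_iff.mp hζ
    (fun i => c (T'.arrow (arr i) (g v)) - c (f (T.arrow (arr i) v))) (by
      rw [← h5]
      refine Finset.sum_congr rfl fun i _ => ?_
      rw [← sub_smul, map_smul]) i
  rw [map_sub]
  exact h6

end Glue

end Kronecker

end

noncomputable section

/-! ### Properties of the glueing functor -/

namespace QuiverRep

variable {k : Type u} [Field k] {L : Type v} [Quiver.{w} L]

/-- A morphism of representations that is bijective at all vertices is an isomorphism. -/
def isoOfBijective {M N : QuiverRep k L} (f : M ⟶ N) (h : ∀ q, Function.Bijective (homAt f q)) :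
    M ≅ N :=
  isoOfEquivs (fun q => LinearEquiv.ofBijective (homAt f q) (h q)) fun e => arrow_comp_homAt f e

theorem tens_space_subsingleton {V : Type u} [AddCommGroup V] [Module k V] [Module.Finite k V]
    [Subsingleton V] (M : QuiverRep k L) (q : L) : Subsingleton ((tens V M).space q) := by
  have h : (LinearMap.id : (tens V M).space q →ₗ[k] (tens V M).space q) = 0 :=
    tens_map_ext fun m v => by
      rw [Subsingleton.elim v 0, map_zero, map_zero, map_zero]
  exact ⟨fun a b => (LinearMap.congr_fun h a).trans (LinearMap.congr_fun h b).symm⟩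

/-- The isomorphism `M ⊗ k ≅ M`. -/
def tensUnitIso (M : QuiverRep k L) : M ≅ tens k M :=
  isoOfBijective (tensIns M (1 : k)) fun q => (TensorProduct.rid k (M.space q)).symm.bijective

/-- An extension by the zero representation. -/
def extIsoOfLeftSubsingleton {Y X : QuiverRep k L} (δ : OneCochain Y X)
    (h : ∀ q, Subsingleton (X.space q)) : extRep Y X δ ≅ Y :=
  isoOfBijective (extSequence Y X δ).g fun q =>
    ⟨fun _ _ hab => ext_elt_ext (δ := δ) (Subsingleton.elim _ _) hab,
      fun y => ⟨extInr δ q y, extSnd_extInr δ q y⟩⟩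

/-- An extension of the zero representation. -/
def extIsoOfRightSubsingleton {Y X : QuiverRep k L} (δ : OneCochain Y X)
    (h : ∀ q, Subsingleton (Y.space q)) : X ≅ extRep Y X δ :=
  isoOfBijective (extSequence Y X δ).f fun q =>
    ⟨fun _ _ hab => congrArg (extFst δ q) hab,
      fun z => ⟨extFst δ q z, ext_elt_ext (δ := δ) (extFst_extInl δ q _) (Subsingleton.elim _ _)⟩⟩

end QuiverRep

namespace Kronecker

open QuiverRep

variable {k : Type u} [Field k] {L : Type v} [Quiver.{w} L] {n : ℕ} {X Y : QuiverRep k L}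
  (ζ : Fin n → OneCochain Y X)

theorem homAt_glue_map {T T' : QuiverRep k (Kronecker n)} (f : T ⟶ T') (q : L) :
    homAt ((glue ζ).map f) q = LinearMap.prodMap ((homAt f x).lTensor (X.space q))
      ((homAt f y).lTensor (Y.space q)) := rfl

instance glue_additive : (glue ζ).Additive where
  map_add {T T' f g} := hom_ext_at fun q => by
    rw [homAt_add, homAt_glue_map, homAt_glue_map, homAt_glue_map, homAt_add, homAt_add,
      LinearMap.lTensor_add, LinearMap.lTensor_add]
    rfl

instance glue_linear : (glue ζ).Linear k where
  map_smul {T T'} f c := hom_ext_at fun q => by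
    rw [homAt_smul, homAt_glue_map, homAt_glue_map, homAt_smul, homAt_smul,
      LinearMap.lTensor_smul, LinearMap.lTensor_smul]
    rfl

/-- The morphism `F f` reduces to the components of `f`, and reductions are unique. -/
theorem glue_faithful (hX : ¬ IsZero X) (hY : ¬ IsZero Y) : (glue ζ).Faithful where
  map_injective {T T' f g} h := by
    have h1 := blockReducesTo_glue_map ζ f
    rw [h] at h1
    obtain ⟨hx, hy⟩ := h1.unique hX hY (blockReducesTo_glue_map ζ g)
    exact hom_ext hx hy

/-- At each vertex the functor is a sum of tensor products with fixed vector spaces, so it preserves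
short exact sequences. -/
theorem glue_exact : PreservesFiniteLimits (glue ζ) ∧ PreservesFiniteColimits (glue ζ) := by
  refine ((glue ζ).exact_tfae.out 0 3).mp fun S hS => shortExact_of_homAt (fun q => ?_)
    (fun q => ?_) fun q => ?_
  · change Function.Injective (homAt ((glue ζ).map S.f) q)
    rw [homAt_glue_map]
    exact Function.Injective.prodMap
      (Module.Flat.lTensor_preserves_injective_linearMap _ (homAt_injective_of_shortExact hS x))
      (Module.Flat.lTensor_preserves_injective_linearMap _ (homAt_injective_of_shortExact hS y))
  · change Function.Surjective (homAt ((glue ζ).map S.g) q)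
    rw [homAt_glue_map]
    exact Function.Surjective.prodMap
      (LinearMap.lTensor_surjective _ (homAt_surjective_of_shortExact hS x))
      (LinearMap.lTensor_surjective _ (homAt_surjective_of_shortExact hS y))
  · change Function.Exact (homAt ((glue ζ).map S.f) q) (homAt ((glue ζ).map S.g) q)
    rw [homAt_glue_map, homAt_glue_map]
    have h1 := lTensor_exact (X.space q) (homAt_exact_of_shortExact hS x)
      (homAt_surjective_of_shortExact hS x)
    have h2 := lTensor_exact (Y.space q) (homAt_exact_of_shortExact hS y)
      (homAt_surjective_of_shortExact hS y)
    rintro ⟨a, b⟩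
    constructor
    · intro h
      obtain ⟨a, rfl⟩ := (h1 a).mp (congrArg Prod.fst h)
      obtain ⟨b, rfl⟩ := (h2 b).mp (congrArg Prod.snd h)
      exact ⟨(a, b), rfl⟩
    · rintro ⟨⟨a, b⟩, h⟩
      exact Prod.ext ((h1 _).mpr ⟨a, congrArg Prod.fst h⟩) ((h2 _).mpr ⟨b, congrArg Prod.snd h⟩)

theorem nonempty_glue_simpleY_iso : Nonempty ((glue ζ).obj (simpleY k n) ≅ Y) := by
  have : Subsingleton ((simpleY k n).space x) := inferInstanceAs (Subsingleton PUnit)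
  exact ⟨glueIso ζ _ ≪≫ extIsoOfLeftSubsingleton _ (tens_space_subsingleton X) ≪≫
    (tensUnitIso Y).symm⟩

theorem nonempty_glue_simpleX_iso : Nonempty ((glue ζ).obj (simpleX k n) ≅ X) := by
  have : Subsingleton ((simpleX k n).space y) := inferInstanceAs (Subsingleton PUnit)
  exact ⟨glueIso ζ _ ≪≫ (extIsoOfRightSubsingleton _ (tens_space_subsingleton Y)).symm ≪≫
    (tensUnitIso X).symm⟩

/-! ### Reduction to morphisms of the Kronecker quiver -/

section Reduction

variable {ζ} [IsAlgClosed k] [Finite L]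
  (hζ : LinearIndependent k fun i => (extRadical Y X).mkQ (extClass Y X (ζ i)))
  (hX : Indecomposable X) (hY : Indecomposable Y) (hXY : ∀ f : X ⟶ Y, f = 0)

include hζ hX hY hXY

/-- A retraction of `F` on morphisms, although `F` need not be full; both reflection of isomorphism
and preservation of indecomposability rest on it. -/
theorem exists_reduction {T T' : QuiverRep k (Kronecker n)}
    (φ : (glue ζ).obj T ⟶ (glue ζ).obj T') : ∃ p : T ⟶ T',
      BlockReducesTo ((glueIso ζ T).inv ≫ φ ≫ (glueIso ζ T').hom) (homAt p x) (homAt p y) := by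
  obtain ⟨f, g, h⟩ := exists_blockReducesTo hX hY hXY
    ((glueIso ζ T).inv ≫ φ ≫ (glueIso ζ T').hom)
  exact ⟨homMk f g (comp_eq_comp_of_blockReducesTo hζ h), h⟩

/-- Reduction respects composition and identities, so the reductions of `I.hom` and `I.inv` are
mutually inverse. -/
theorem nonempty_iso_of_glue_iso {T T' : QuiverRep k (Kronecker n)}
    (I : (glue ζ).obj T ≅ (glue ζ).obj T') : Nonempty (T ≅ T') := by
  obtain ⟨p, hp⟩ := exists_reduction hζ hX hY hXY I.hom
  obtain ⟨p', hp'⟩ := exists_reduction hζ hX hY hXY I.inv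
  have h1 := hp.comp hp'
  have h2 := hp'.comp hp
  simp only [Category.assoc, Iso.hom_inv_id_assoc, Iso.inv_hom_id_assoc, Iso.inv_hom_id] at h1 h2
  obtain ⟨h3, h4⟩ := h1.unique hX.1 hY.1 blockReducesTo_id
  obtain ⟨h5, h6⟩ := h2.unique hX.1 hY.1 blockReducesTo_id
  exact ⟨⟨p, p', hom_ext h3 h4, hom_ext h5 h6⟩⟩

/-- The reduction of an idempotent `e` is an idempotent of `T`, hence `0` or the identity.
Accordingly `e` or `1 - e` is an idempotent that reduces to zero, and so is zero. -/
theorem indecomposable_glue {T : QuiverRep k (Kronecker n)} (hT : Indecomposable T) :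
    Indecomposable ((glue ζ).obj T) := by
  have := glue_faithful ζ hX.1 hY.1
  have key : ∀ e : (glue ζ).obj T ⟶ (glue ζ).obj T, e ≫ e = e →
      BlockReducesTo ((glueIso ζ T).inv ≫ e ≫ (glueIso ζ T).hom) 0 0 → e = 0 := by
    intro e he h
    have h1 := eq_zero_of_idempotent_of_blockReducesTo_zero (by simp [reassoc_of% he]) h
    calc e = (glueIso ζ T).hom ≫ ((glueIso ζ T).inv ≫ e ≫ (glueIso ζ T).hom) ≫
          (glueIso ζ T).inv := by simp
      _ = 0 := by rw [h1]; simp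
  refine indecomposable_of_idempotents (fun h0 => hT.1 ?_) fun e he => ?_
  · rw [IsZero.iff_id_eq_zero] at h0 ⊢
    apply (glue ζ).map_injective
    rw [(glue ζ).map_id, h0, (glue ζ).map_zero]
  · obtain ⟨p, hp⟩ := exists_reduction hζ hX hY hXY e
    have h1 := hp.comp hp
    simp only [Category.assoc, Iso.hom_inv_id_assoc, reassoc_of% he] at h1
    obtain ⟨h2, h3⟩ := h1.unique hX.1 hY.1 hp
    rcases hT.eq_zero_or_eq_id (e := p) (hom_ext h2 h3) with rfl | rfl
    · exact Or.inl (key e he hp)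
    · right
      have h4 := blockReducesTo_id.sub hp
      rw [homAt_id, homAt_id, sub_self, sub_self] at h4
      have h5 : 𝟙 _ - (glueIso ζ T).inv ≫ e ≫ (glueIso ζ T).hom =
          (glueIso ζ T).inv ≫ (𝟙 _ - e) ≫ (glueIso ζ T).hom := by
        simp [Preadditive.sub_comp, Preadditive.comp_sub]
      rw [h5] at h4
      have h6 := key (𝟙 _ - e) (by simp [Preadditive.sub_comp, Preadditive.comp_sub, he]) h4
      exact (sub_eq_zero.mp h6).symm

end Reduction

end Kronecker

end

noncomputable section

/-! ### Filtered representations -/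

namespace QuiverRep

variable {k : Type u} [Field k] {L : Type v} [Quiver.{w} L]

theorem filtered_of_iso {Y X N N' : QuiverRep k L} (I : N ≅ N') (h : filtered Y X N) :
    filtered Y X N' := by
  obtain ⟨r, s, f, g, h, hS⟩ := h
  refine ⟨r, s, f ≫ I.hom, I.inv ≫ g, by simp [h], ?_⟩
  exact ShortComplex.shortExact_of_iso (ShortComplex.isoMk (S₁ := ShortComplex.mk f g h)
    (S₂ := ShortComplex.mk (f ≫ I.hom) (I.inv ≫ g) (by simp [h])) (Iso.refl _) I (Iso.refl _)
    (by simp) (by simp)) hS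

theorem filtered_extRep {X Y : QuiverRep k L} {Vx Vy : Type u} [AddCommGroup Vx] [Module k Vx]
    [Module.Finite k Vx] [AddCommGroup Vy] [Module k Vy] [Module.Finite k Vy]
    (δ : OneCochain (tens Vy Y) (tens Vx X)) :
    filtered Y X (extRep (tens Vy Y) (tens Vx X) δ) := by
  let Ix := biproductIsoTens (Module.finBasis k Vx) X
  let Iy := biproductIsoTens (Module.finBasis k Vy) Y
  let f : tens Vx X ⟶ extRep (tens Vy Y) (tens Vx X) δ := (extSequence _ _ δ).f
  let g : extRep (tens Vy Y) (tens Vx X) δ ⟶ tens Vy Y := (extSequence _ _ δ).g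
  have h0 : f ≫ g = 0 := (extSequence _ _ δ).zero
  have hS : (ShortComplex.mk f g h0).ShortExact := extSequence_shortExact _ _ δ
  refine ⟨_, _, Ix.hom ≫ f, g ≫ Iy.inv, by simp [reassoc_of% h0], ?_⟩
  exact ShortComplex.shortExact_of_iso (ShortComplex.isoMk (S₁ := ShortComplex.mk f g h0)
    (S₂ := ShortComplex.mk (Ix.hom ≫ f) (g ≫ Iy.inv) (by simp [reassoc_of% h0]))
    Ix.symm (Iso.refl _) Iy.symm (by simp) (by simp)) hS

/-- Replacing `X^r` and `Y^s` by tensor products with `k^r` and `k^s` brings a filtered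
representation into the shape of glued ones, except for its cochain. -/
theorem exists_iso_extRep_of_filtered {X Y N : QuiverRep k L} (h : filtered Y X N) :
    ∃ (r s : ℕ) (δ : OneCochain (tens (Fin s → k) Y) (tens (Fin r → k) X)),
      Nonempty (N ≅ extRep (tens (Fin s → k) Y) (tens (Fin r → k) X) δ) := by
  obtain ⟨r, s, f, g, h, hS⟩ := h
  let Ix := biproductIsoTens (Pi.basisFun k (Fin r)) X
  let Iy := biproductIsoTens (Pi.basisFun k (Fin s)) Y
  have hS' : (ShortComplex.mk (Ix.inv ≫ f) (g ≫ Iy.hom)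
      (by rw [Category.assoc, reassoc_of% h, zero_comp, comp_zero])).ShortExact :=
    ShortComplex.shortExact_of_iso (ShortComplex.isoMk (S₁ := ShortComplex.mk f g h)
      (S₂ := ShortComplex.mk (Ix.inv ≫ f) (g ≫ Iy.hom) (by simp [reassoc_of% h]))
      Ix (Iso.refl _) Iy (by simp) (by simp)) hS
  obtain ⟨δ, I, -, -⟩ := exists_iso_extSequence _ _ _ hS'
  exact ⟨r, s, δ, ⟨I⟩⟩

theorem jacobson_end_eq_bot {M : QuiverRep k L} (h0 : ¬ IsZero M)
    (h : ∀ f : M ⟶ M, ∃ c : k, f = c • 𝟙 M) : Ring.jacobson (End M) = ⊥ := by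
  have := nontrivial_end h0
  rw [Submodule.eq_bot_iff]
  intro r hr
  obtain ⟨c, rfl⟩ := h r
  by_cases hc : c = 0
  · rw [hc]
    exact zero_smul k _
  · have h1 := Submodule.smul_of_tower_mem (Ring.jacobson (End M)) c⁻¹ hr
    have h2 : (c⁻¹ • c • 𝟙 M : M ⟶ M) = 𝟙 M := by rw [smul_smul, inv_mul_cancel₀ hc, one_smul]
    exact absurd ((Ideal.eq_top_iff_one _).mpr
      ((congrArg (· ∈ Ring.jacobson (End M)) h2).mp h1)) (Ring.jacobson_lt_top (End M)).ne

theorem ReducesTo.eq_tensMap {M : QuiverRep k L} (h : Ring.jacobson (End M) = ⊥) {V W : Type u}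
    [AddCommGroup V] [Module k V] [Module.Finite k V] [AddCommGroup W] [Module k W]
    [Module.Finite k W] {φ : tens V M ⟶ tens W M} {f : V →ₗ[k] W} (hφ : ReducesTo φ f) :
    φ = tensMap (𝟙 M) f := by
  rw [ReducesTo, h, idealSpan_bot] at hφ
  exact sub_eq_zero.mp hφ

theorem extRadical_eq_bot {X Y : QuiverRep k L} (hX : Ring.jacobson (End X) = ⊥)
    (hY : Ring.jacobson (End Y) = ⊥) : extRadical Y X = ⊥ := by
  rw [extRadical, Submodule.span_eq_bot, hX, hY]
  rintro _ (⟨f, hf, ξ, rfl⟩ | ⟨f, hf, ξ, rfl⟩)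
  · rw [(Submodule.mem_bot _).mp hf]
    exact (congrArg (fun η => ξ.comp η _) (Ext.mk₀_zero _ _)).trans (Ext.comp_zero ξ _ _ _ _)
  · rw [(Submodule.mem_bot _).mp hf]
    exact (congrArg (fun η => Ext.comp η ξ _) (Ext.mk₀_zero _ _)).trans (Ext.zero_comp _ _ ξ _ _)

end QuiverRep

namespace Kronecker

open QuiverRep

variable {k : Type u} [Field k] {L : Type v} [Quiver.{w} L] {n : ℕ} {X Y : QuiverRep k L}

theorem filtered_glue (ζ : Fin n → OneCochain Y X) (T : QuiverRep k (Kronecker n)) :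
    filtered Y X ((glue ζ).obj T) :=
  filtered_of_iso (glueIso ζ T).symm (filtered_extRep _)

/-- If the classes of the `ζ i` span `Ext¹(Y, X)`, then every family of maps from `Y ⊗ V` to
`X ⊗ W` is cohomologous to some `∑ i, ζ_i ⊗ t_i`. -/
theorem exists_sub_glueCochain_mem_range {ζ : Fin n → OneCochain Y X}
    (hζ : Submodule.span k (Set.range fun i => extClass Y X (ζ i)) = ⊤) {V W : Type u}
    [AddCommGroup V] [Module k V] [Module.Finite k V] [AddCommGroup W] [Module k W]
    [Module.Finite k W] (δ : OneCochain (tens V Y) (tens W X)) :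
    ∃ t : Fin n → V →ₗ[k] W, δ - glueCochain ζ t ∈ LinearMap.range (coboundary _ _) := by
  let b := Module.finBasis k V
  let b' := Module.finBasis k W
  -- `Ψ i j` places a cochain from `Y` to `X` into the block `(i, j)`, and `D i j` reads off that
  -- block of `δ`. Since `Ψ i j` preserves coboundaries, it is enough to express each block by the
  -- `ζ l`.
  let Ψ : ∀ i j, OneCochain Y X →ₗ[k] OneCochain (tens V Y) (tens W X) := fun i j =>
    push (tensIns X (b' j)) ∘ₗ pull (tensProj Y (b.coord i))
  let D : ∀ i j, OneCochain Y X := fun i j =>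
    push (tensProj X (b'.coord j)) (pull (tensIns Y (b i)) δ)
  have hδ : δ = ∑ i, ∑ j, Ψ i j (D i j) := by
    have h1 : ∀ a c (e : a ⟶ c) (z : (tens V Y).space a), δ e z =
        ∑ i, ∑ j, homAt (tensProj X (b'.coord j) ≫ tensIns X (b' j)) c
          (δ e (homAt (tensProj Y (b.coord i) ≫ tensIns Y (b i)) a z)) := by
      intro a c e z
      have hz := LinearMap.congr_fun (congrArg (fun f => homAt f a) (sum_tensProj_tensIns b Y)) z
      have hw := fun z' => LinearMap.congr_fun (congrArg (fun f => homAt f c)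
        (sum_tensProj_tensIns b' X)) z'
      simp only [homAt_sum, LinearMap.sum_apply, homAt_id, LinearMap.id_apply] at hz hw
      simp only [hw]
      rw [← map_sum, hz]
    funext a c e
    refine LinearMap.ext fun z => ?_
    rw [h1]
    simp only [Finset.sum_apply, LinearMap.sum_apply]
    rfl
  have hD : ∀ i j, ∃ s : Fin n → k, D i j - ∑ l, s l • ζ l ∈ LinearMap.range (coboundary Y X) := by
    intro i j
    have h1 : extClass Y X (D i j) ∈ Submodule.span k (Set.range fun i => extClass Y X (ζ i)) :=
      hζ ▸ Submodule.mem_top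
    obtain ⟨s, hs⟩ := (Submodule.mem_span_range_iff_exists_fun k).mp h1
    refine ⟨s, ?_⟩
    have h2 : extClass Y X (D i j) = extClass Y X (∑ l, s l • ζ l) := by
      rw [← hs, ← extClassLinear_apply, map_sum]
      simp only [map_smul, extClassLinear_apply]
    obtain ⟨h, hh⟩ := (extClass_eq_iff _ _).mp h2
    exact ⟨h, hh.symm⟩
  choose s hs using hD
  have hΨ : ∀ i j ξ, ξ ∈ LinearMap.range (coboundary Y X) →
      Ψ i j ξ ∈ LinearMap.range (coboundary (tens V Y) (tens W X)) := by
    rintro i j _ ⟨h, rfl⟩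
    change push _ (pull _ _) ∈ _
    rw [pull_coboundary, push_coboundary]
    exact ⟨_, rfl⟩
  -- The matrix of `t l` collects the coefficients of `ζ l` in all the blocks.
  refine ⟨fun l => ∑ i, ∑ j, s i j l • (b.coord i).smulRight (b' j), ?_⟩
  have h2 : glueCochain ζ (fun l => ∑ i, ∑ j, s i j l • (b.coord i).smulRight (b' j)) =
      ∑ i, ∑ j, Ψ i j (∑ l, s i j l • ζ l) := by
    funext a c e
    refine tens_map_ext fun m v => ?_
    rw [glueCochain_tmulAt]
    have h3 : ∀ i j l, Ψ i j (ζ l) e (tmulAt m v) =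
        tmulAt (M := X) (ζ l e m) (b.coord i v • b' j) := by
      intro i j l
      change homAt (tensIns X (b' j)) c (ζ l e (homAt (tensProj Y (b.coord i)) a (tmulAt m v))) = _
      rw [homAt_tensIns, homAt_tensProj, map_smul, map_smul, map_smul, LinearMap.smul_apply]
    simp only [map_sum, map_smul, Finset.sum_apply, LinearMap.sum_apply, Pi.smul_apply,
      LinearMap.smul_apply, h3, LinearMap.smulRight_apply]
    rw [Finset.sum_comm]
    refine Finset.sum_congr rfl fun i _ => ?_
    rw [Finset.sum_comm]
  have h4 : δ - glueCochain ζ (fun l => ∑ i, ∑ j, s i j l • (b.coord i).smulRight (b' j)) =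
      ∑ i, ∑ j, Ψ i j (D i j - ∑ l, s i j l • ζ l) := by
    rw [h2]
    conv_lhs => rw [hδ]
    simp only [map_sub, Finset.sum_sub_distrib]
  rw [h4]
  exact sum_mem fun i _ => sum_mem fun j _ => hΨ _ _ _ (hs i j)

theorem span_extClass_eq_top {n : ℕ} {ζ : Fin n → OneCochain Y X} (h : extRadical Y X = ⊥)
    (hζ : RepresentsExtBasis ζ) :
    Submodule.span k (Set.range fun i => extClass Y X (ζ i)) = ⊤ := by
  have h1 : LinearMap.ker (extRadical Y X).mkQ = ⊥ := by rw [Submodule.ker_mkQ, h]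
  have h2 := hζ.2
  rw [Set.range_comp' (extRadical Y X).mkQ, Submodule.span_image] at h2
  rw [eq_top_iff]
  intro ξ _
  have h3 : (extRadical Y X).mkQ ξ ∈ Submodule.map (extRadical Y X).mkQ
    (Submodule.span k (Set.range fun i => extClass Y X (ζ i))) := h2 ▸ Submodule.mem_top
  obtain ⟨ξ', hξ', h4⟩ := h3
  rwa [← LinearMap.ker_eq_bot.mp h1 h4]

theorem exists_iso_glue_of_filtered {ζ : Fin n → OneCochain Y X}
    (hζ : Submodule.span k (Set.range fun i => extClass Y X (ζ i)) = ⊤) {N : QuiverRep k L}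
    (hN : filtered Y X N) : ∃ T, Nonempty (N ≅ (glue ζ).obj T) := by
  obtain ⟨r, s, δ, ⟨I⟩⟩ := exists_iso_extRep_of_filtered hN
  obtain ⟨t, h, ht⟩ := exists_sub_glueCochain_mem_range hζ δ
  have h1 : (fun i => (ofMaps (Fin s → k) (Fin r → k) t).arrow (arr i)) = t :=
    funext fun i => ofMaps_arrow_arr _ _ t i
  have h2 := glueIso ζ (ofMaps (Fin s → k) (Fin r → k) t)
  refine ⟨ofMaps (Fin s → k) (Fin r → k) t, ⟨I ≪≫ ?_ ≪≫ h2.symm⟩⟩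
  refine extIsoOfCoboundary (X := tens (Fin r → k) X) (Y := tens (Fin s → k) Y) h ?_
  refine Eq.trans ?_ ht.symm
  exact congrArg (fun t => δ - glueCochain ζ t) h1

/-! ### Fullness and the equivalence with the filtered representations -/

section Equivalence

variable {ζ : Fin n → OneCochain Y X} [IsAlgClosed k] [Finite L]
  (hX : Indecomposable X) (hY : Indecomposable Y) (hXY : ∀ f : X ⟶ Y, f = 0)
  (hYX : ∀ f : Y ⟶ X, f = 0) (hXX : ∀ f : X ⟶ X, ∃ c : k, f = c • 𝟙 X)
  (hYY : ∀ f : Y ⟶ Y, ∃ c : k, f = c • 𝟙 Y)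

include hX hY hXY hYX hXX hYY in
-- Scalar endomorphism rings have zero radical, so `φ` and `F p`, for the reduction `p` of `φ`, have
-- equal diagonals. The off-diagonal block of their difference has zero coboundary, hence is a
-- morphism `Y ⊗ T(y) ⟶ X ⊗ T'(x)`, and this vanishes because `Hom(Y, X) = 0`.
theorem glue_full (hζ : LinearIndependent k fun i => (extRadical Y X).mkQ (extClass Y X (ζ i))) :
    (glue ζ).Full where
  map_surjective {T T'} φ := by
    obtain ⟨p, hp⟩ := exists_reduction hζ hX hY hXY φ
    refine ⟨p, ?_⟩
    obtain ⟨φx, h, φy, hδ, H, hf, hg⟩ := hp.sub (blockReducesTo_glue_map ζ p)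
    rw [sub_self] at hf hg
    obtain rfl := hf.eq_tensMap (jacobson_end_eq_bot hX.1 hXX)
    obtain rfl := hg.eq_tensMap (jacobson_end_eq_bot hY.1 hYY)
    have h1 : coboundary (tens (T.space y) Y) (tens (T'.space x) X) h = 0 := by
      rw [← hδ]
      funext a b e
      refine LinearMap.ext fun z => ?_
      change homAt (tensMap (𝟙 X) 0) b _ - _ = 0
      rw [pull_apply, ← tensMapBilin_apply, ← tensMapBilin_apply, map_zero, map_zero]
      exact sub_eq_zero.mpr (map_zero _).symm
    let h' : tens (T.space y) Y ⟶ tens (T'.space x) X := homOfMaps h fun {a b} e =>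
      LinearMap.ext fun z => sub_eq_zero.mp
        (LinearMap.congr_fun (congrFun (congrFun (congrFun h1 a) b) e) z)
    have h2 : h' = 0 := tens_hom_eq_zero hYX h'
    have h3 : h = 0 := funext fun q => congrArg (fun f => homAt f q) h2
    subst h3
    have h4 : (glueIso ζ T).inv ≫ φ ≫ (glueIso ζ T').hom -
        (glueIso ζ T).inv ≫ (glue ζ).map p ≫ (glueIso ζ T').hom = 0 := by
      rw [H]
      refine hom_ext_at fun q => ext_map_ext (fun z => ?_) fun z => ?_
      · rw [homAt_extHom_extInl, ← tensMapBilin_apply, map_zero]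
        exact map_zero (extInl _ q)
      · rw [homAt_extHom_extInr, ← tensMapBilin_apply, map_zero]
        exact (congrArg₂ (· + ·) (map_zero (extInl _ q)) (map_zero (extInr _ q))).trans
          (add_zero _)
    have h5 := sub_eq_zero.mp h4
    rw [Iso.cancel_iso_inv_left, Iso.cancel_iso_hom_right] at h5
    exact h5.symm

include hX hY hXY hYX hXX hYY in
-- Every morphism between filtered representations is, up to isomorphism, `F p` for some `p`. As `F`
-- is exact, its kernel and cokernel are `F` of those of `p`, and all values of `F` are filtered.
theorem glue_equivalence (hζ : RepresentsExtBasis ζ) :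
    (filtered Y X).IsClosedUnderKernels ∧ (filtered Y X).IsClosedUnderCokernels ∧
      ∃ h : ∀ T, filtered Y X ((glue ζ).obj T),
        ((filtered Y X).lift (glue ζ) h).IsEquivalence := by
  have hfaith := glue_faithful ζ hX.1 hY.1
  have hfull := glue_full hX hY hXY hYX hXX hYY hζ.1
  obtain ⟨hlim, hcolim⟩ := glue_exact ζ
  have hspan := span_extClass_eq_top (extRadical_eq_bot (jacobson_end_eq_bot hX.1 hXX)
    (jacobson_end_eq_bot hY.1 hYY)) hζ
  have hess := fun N hN => exists_iso_glue_of_filtered (N := N) hspan hN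
  refine ⟨⟨?_⟩, ⟨?_⟩, filtered_glue ζ, ?_⟩
  · rintro _ ⟨f, c, hc, hf1, hf2⟩
    obtain ⟨T, ⟨I⟩⟩ := hess _ hf1
    obtain ⟨T', ⟨I'⟩⟩ := hess _ hf2
    obtain ⟨p, hp⟩ := (glue ζ).map_surjective (I.inv ≫ f ≫ I'.hom)
    have J : kernel f ≅ kernel ((glue ζ).map p) :=
      kernel.mapIso f _ I I' (by rw [hp, Iso.hom_inv_id_assoc])
    refine filtered_of_iso ?_ (filtered_glue ζ (kernel p))
    exact PreservesKernel.iso (glue ζ) p ≪≫ J.symm ≪≫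
      (kernelIsKernel f).conePointUniqueUpToIso hc
  · rintro _ ⟨f, c, hc, hf1, hf2⟩
    obtain ⟨T, ⟨I⟩⟩ := hess _ hf1
    obtain ⟨T', ⟨I'⟩⟩ := hess _ hf2
    obtain ⟨p, hp⟩ := (glue ζ).map_surjective (I.inv ≫ f ≫ I'.hom)
    have J : cokernel f ≅ cokernel ((glue ζ).map p) :=
      cokernel.mapIso f _ I I' (by rw [hp, Iso.hom_inv_id_assoc])
    refine filtered_of_iso ?_ (filtered_glue ζ (cokernel p))
    exact PreservesCokernel.iso (glue ζ) p ≪≫ J.symm ≪≫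
      (cokernelIsCokernel f).coconePointUniqueUpToIso hc
  · have : ((filtered Y X).lift (glue ζ) (filtered_glue ζ)).EssSurj := by
      refine ⟨fun N => ?_⟩
      obtain ⟨T, ⟨I⟩⟩ := hess N.obj N.property
      exact ⟨T, ⟨(filtered Y X).isoMk I.symm⟩⟩
    exact { }

end Equivalence

end Kronecker

end

noncomputable section

/-! ### Counting arrows of treelike quivers -/

section Treelike

variable {V W : Type*} [Quiver V] [Quiver W]

theorem underlyingGraph_adj {a b : V} :
    (underlyingGraph V).Adj a b ↔ a ≠ b ∧ (Nonempty (a ⟶ b) ∨ Nonempty (b ⟶ a)) :=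
  SimpleGraph.fromRel_adj _ _ _

theorem reachable_of_hom {a b : V} (e : a ⟶ b) : (underlyingGraph V).Reachable a b := by
  by_cases h : a = b
  · rw [h]
  · exact SimpleGraph.Adj.reachable (underlyingGraph_adj.mpr ⟨h, Or.inl ⟨e⟩⟩)

/-- Reachability in the underlying graph is the smallest equivalence relation that contains all
arrows. -/
theorem reachable_induction {r : V → V → Prop} (hr : Equivalence r)
    (h : ∀ {a b : V}, (a ⟶ b) → r a b) {a b : V} (hab : (underlyingGraph V).Reachable a b) :
    r a b := by
  rw [SimpleGraph.reachable_iff_reflTransGen] at hab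
  induction hab with
  | refl => exact hr.refl a
  | tail _ hbc ih =>
    refine hr.trans ih ?_
    obtain ⟨-, ⟨⟨e⟩⟩ | ⟨⟨e⟩⟩⟩ := underlyingGraph_adj.mp hbc
    · exact h e
    · exact hr.symm (h e)

theorem reachable_map (f : V → W) (hf : ∀ {a b : V}, (a ⟶ b) → Nonempty (f a ⟶ f b)) {a b : V}
    (h : (underlyingGraph V).Reachable a b) : (underlyingGraph W).Reachable (f a) (f b) :=
  reachable_induction (r := fun a b => (underlyingGraph W).Reachable (f a) (f b))
    ⟨fun _ => .refl _, fun h => h.symm, fun h h' => h.trans h'⟩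
    (fun e => reachable_of_hom (hf e).some) h

/-- A quiver that maps to a connected quiver with connected fibres, such that arrows lift to
paths, is connected. -/
theorem connected_of_fibration (p : V → W) (hp : Function.Surjective p)
    (hfib : ∀ a b, p a = p b → (underlyingGraph V).Reachable a b)
    (hlift : ∀ {w w' : W}, (w ⟶ w') → ∃ a b, p a = w ∧ p b = w' ∧
      (underlyingGraph V).Reachable a b)
    (hW : (underlyingGraph W).Connected) : (underlyingGraph V).Connected := by
  have : Nonempty V := ⟨(hp hW.nonempty.some).choose⟩
  refine ⟨fun a b => ?_⟩
  refine reachable_induction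
    (r := fun w w' => ∀ a b, p a = w → p b = w' → (underlyingGraph V).Reachable a b)
    ⟨fun w a b ha hb => hfib a b (ha.trans hb.symm), fun h a b ha hb => (h b a hb ha).symm,
      fun {w w' w''} h h' a b ha hb => ?_⟩ ?_ (hW.preconnected (p a) (p b)) a b rfl rfl
  · obtain ⟨c, hc⟩ := hp w'
    exact (h a c ha hc).trans (h' c b hc hb)
  · intro w w' e a b ha hb
    obtain ⟨a', b', ha', hb', h⟩ := hlift e
    exact ((hfib a a' (ha.trans ha'.symm)).trans h).trans (hfib b' b (hb'.trans hb.symm))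

/-- Without loops and multiple arrows, the arrows inject into the edges of a tree. -/
theorem IsTreelike.card_total_add_one_le [Finite V] (h : IsTreelike V) :
    Nat.card (Quiver.Total V) + 1 ≤ Nat.card V := by
  have h1 := (SimpleGraph.isTree_iff_connected_and_card.mp h.isTree).2
  rw [← h1]
  refine Nat.add_le_add_right ?_ 1
  refine Nat.card_le_card_of_injective
    (fun e : Quiver.Total V => (⟨s(e.left, e.right), ?_⟩ : (underlyingGraph V).edgeSet)) ?_
  · rw [SimpleGraph.mem_edgeSet]
    refine underlyingGraph_adj.mpr ⟨fun h' => ?_, Or.inl ⟨e.hom⟩⟩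
    obtain ⟨a, b, e⟩ := e
    obtain rfl : a = b := h'
    exact (h.no_loop a).false e
  · intro e e' hee
    exact h.no_multiple (congrArg Subtype.val hee)

/-- Every edge comes from an arrow that is not a loop, so edges ≤ non-loops ≤ arrows ≤ vertices - 1
≤ edges, the last by connectedness. Equality throughout excludes loops and multiple arrows and makes
the graph a tree. -/
theorem isTreelike_of_connected [Finite V] [Finite (Quiver.Total V)]
    (hc : (underlyingGraph V).Connected) (h : Nat.card (Quiver.Total V) + 1 ≤ Nat.card V) :
    IsTreelike V := by
  let S := {e : Quiver.Total V // e.left ≠ e.right}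
  let φ : S → (underlyingGraph V).edgeSet := fun e => ⟨s(e.1.left, e.1.right),
    underlyingGraph_adj.mpr ⟨e.2, Or.inl ⟨e.1.hom⟩⟩⟩
  have hφ : Function.Surjective φ := by
    rintro ⟨z, hz⟩
    induction z using Sym2.inductionOn with
    | hf a b =>
      obtain ⟨hab, ⟨⟨e⟩⟩ | ⟨⟨e⟩⟩⟩ := underlyingGraph_adj.mp hz
      · exact ⟨⟨⟨a, b, e⟩, hab⟩, rfl⟩
      · exact ⟨⟨⟨b, a, e⟩, hab.symm⟩, Subtype.ext Sym2.eq_swap⟩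
  have h1 := hc.card_vert_le_card_edgeSet_add_one
  have h2 := Nat.card_le_card_of_surjective φ hφ
  have h3 : Nat.card S ≤ Nat.card (Quiver.Total V) :=
    Nat.card_le_card_of_injective Subtype.val Subtype.val_injective
  have h4 : Function.Bijective (Subtype.val : S → Quiver.Total V) :=
    Subtype.val_injective.bijective_of_nat_card_le (by
      change _ ≤ Nat.card S
      omega)
  have h5 : Function.Bijective φ := hφ.bijective_of_nat_card_le (by omega)
  have h6 : ∀ e : Quiver.Total V, e.left ≠ e.right := fun e => by
    obtain ⟨e', rfl⟩ := h4.2 e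
    exact e'.2
  refine ⟨fun a => ⟨fun e => h6 ⟨a, a, e⟩ rfl⟩, fun e e' hee => ?_,
    SimpleGraph.isTree_iff_connected_and_card.mpr ⟨hc, by omega⟩⟩
  exact congrArg Subtype.val (h5.1 (a₁ := ⟨e, h6 e⟩) (a₂ := ⟨e', h6 e'⟩) (Subtype.ext hee))

end Treelike

/-! ### Matrix entries of cochains -/

namespace QuiverRep

variable {k : Type u} [Field k] {L : Type v} [Quiver.{w} L]

/-- The positions of matrix entries of cochains, with respect to families of bases that are indexed
by `κ` and `ι`. -/
abbrev Slot (κ ι : L → Type) : Type (max v w) :=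
  Σ (p : Σ q, κ q) (p' : Σ q, ι q), (p.1 ⟶ p'.1)

variable {Y X : QuiverRep k L} {κ ι : L → Type} (BY : ∀ q : L, Module.Basis (κ q) k (Y.space q))
  (BX : ∀ q : L, Module.Basis (ι q) k (X.space q))

/-- The matrix entry of a cochain. -/
def entry (s : Slot κ ι) : OneCochain Y X →ₗ[k] k where
  toFun δ := (BX s.2.1.1).repr (δ s.2.2 (BY s.1.1 s.1.2)) s.2.1.2
  map_add' δ δ' := by simp
  map_smul' c δ := by simp

variable {BY BX} in
theorem entry_ext {δ δ' : OneCochain Y X} (h : ∀ s, entry BY BX s δ = entry BY BX s δ') :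
    δ = δ' := by
  funext a b e
  refine (BY a).ext fun i => (BX b).repr.injective (Finsupp.ext fun j => ?_)
  exact h ⟨⟨a, i⟩, ⟨b, j⟩, e⟩

-- Merging the arrow, the row and the column into one `Slot` turns elementary cochains into matrix
-- units of a single index type, which suits both spanning and counting.
open Classical in
variable {BY BX} in
theorem isElementary_iff {ζ : OneCochain Y X} : IsElementary BY BX ζ ↔
    ∃ s, ∀ s', entry BY BX s' ζ = if s' = s then 1 else 0 := by
  constructor
  · rintro ⟨⟨a, b, e⟩, i, j, h0, h1, h2⟩
    refine ⟨⟨⟨a, i⟩, ⟨b, j⟩, e⟩, ?_⟩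
    rintro ⟨⟨a', i'⟩, ⟨b', j'⟩, e'⟩
    by_cases h : (⟨a', b', e'⟩ : Quiver.Total L) = ⟨a, b, e⟩
    · cases h
      change (BX b).repr (ζ e (BY a i')) j' = _
      by_cases hi : i' = i
      · subst hi
        have h1' : ζ e (BY a i') = BX b j := h1
        rw [h1', Module.Basis.repr_self, Finsupp.single_apply]
        refine if_congr ⟨?_, ?_⟩ rfl rfl
        · rintro rfl
          rfl
        · intro h
          simpa using h.symm
      · have h2' : ζ e (BY a i') = 0 := h2 i' hi
        rw [h2', map_zero, Finsupp.zero_apply, if_neg]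
        intro h
        simp [hi] at h
    · have h3 : ζ e' = 0 := h0 ⟨a', b', e'⟩ h
      change (BX b').repr (ζ e' (BY a' i')) j' = _
      rw [h3, LinearMap.zero_apply, map_zero, Finsupp.zero_apply, if_neg]
      intro h'
      cases h'
      exact h rfl
  · rintro ⟨⟨⟨a, i⟩, ⟨b, j⟩, e⟩, hs⟩
    refine ⟨⟨a, b, e⟩, i, j, ?_, ?_, ?_⟩
    · rintro ⟨a', b', e'⟩ h
      refine (BY a').ext fun i' => (BX b').repr.injective (Finsupp.ext fun j' => ?_)
      refine (hs ⟨⟨a', i'⟩, ⟨b', j'⟩, e'⟩).trans ?_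
      rw [if_neg, LinearMap.zero_apply, map_zero, Finsupp.zero_apply]
      intro h'
      cases h'
      exact h rfl
    · refine (BX b).repr.injective (Finsupp.ext fun j' => ?_)
      refine (hs ⟨⟨a, i⟩, ⟨b, j'⟩, e⟩).trans ?_
      rw [Module.Basis.repr_self, Finsupp.single_apply]
      refine if_congr ⟨fun h => ?_, ?_⟩ rfl rfl
      · simpa using h.symm
      · rintro rfl
        rfl
    · intro i' hi
      refine (BX b).repr.injective (Finsupp.ext fun j' => ?_)
      refine (hs ⟨⟨a, i'⟩, ⟨b, j'⟩, e⟩).trans ?_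
      rw [if_neg, map_zero, Finsupp.zero_apply]
      intro h
      simp [hi] at h

open Classical in
/-- The cochain with a given entry `1` and all other entries `0`. -/
def single (s : Slot κ ι) : OneCochain Y X := fun a b e =>
  have := Module.Finite.finite_basis (BX b)
  (BY a).constr k fun i => (BX b).equivFun.symm fun j =>
    if (⟨⟨a, i⟩, ⟨b, j⟩, e⟩ : Slot κ ι) = s then 1 else 0

open Classical in
theorem entry_single (s s' : Slot κ ι) :
    entry BY BX s' (single BY BX s) = if s' = s then 1 else 0 := by
  obtain ⟨⟨a, i⟩, ⟨b, j⟩, e⟩ := s'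
  have := Module.Finite.finite_basis (BX b)
  change (BX b).repr ((BY a).constr k _ (BY a i)) j = _
  rw [Module.Basis.constr_basis, ← Module.Basis.equivFun_apply, LinearEquiv.apply_symm_apply]

theorem isElementary_single (s : Slot κ ι) : IsElementary BY BX (single BY BX s) :=
  isElementary_iff.mpr ⟨s, entry_single BY BX s⟩

theorem span_isElementary [Finite L] [∀ a b : L, Finite (a ⟶ b)] :
    Submodule.span k {δ : OneCochain Y X | IsElementary BY BX δ} = ⊤ := by
  have hκ := fun q => Module.Finite.finite_basis (BY q)
  have hι := fun q => Module.Finite.finite_basis (BX q)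
  have := Fintype.ofFinite (Slot κ ι)
  rw [eq_top_iff]
  intro δ _
  have h : δ = ∑ s, entry BY BX s δ • single BY BX s := by
    refine entry_ext (BY := BY) (BX := BX) fun s => ?_
    classical
    simp [map_sum, entry_single]
  rw [h]
  exact sum_mem fun s _ => Submodule.smul_mem _ _ (Submodule.subset_span (isElementary_single _ _ s))

/-- Needed so that different `ζ i` have their nonzero entries in different slots. -/
theorem RepresentsExtBasis.injective {n : ℕ} {ζ : Fin n → OneCochain Y X}
    (hζ : RepresentsExtBasis ζ) : Function.Injective ζ := fun _ _ hij =>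
  hζ.1.injective (congrArg (fun δ => (extRadical Y X).mkQ (extClass Y X δ)) hij)

/-- There are elementary matrices whose classes form a basis of `Ext¹(Y, X)` modulo its
radical. -/
theorem exists_isElementary_representsExtBasis [Finite L] [∀ a b : L, Finite (a ⟶ b)] :
    ∃ ζ : Fin (extRadDim Y X) → OneCochain Y X,
      (∀ i, IsElementary BY BX (ζ i)) ∧ RepresentsExtBasis ζ := by
  let π : OneCochain Y X →ₗ[k] Ext Y X 1 ⧸ extRadical Y X :=
    (extRadical Y X).mkQ ∘ₗ extClassLinear Y X
  -- Since elementary cochains span and `π` is onto, their images span the quotient, and a basis can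
  -- be selected among these images.
  have hπ : Function.Surjective π :=
    (Submodule.mkQ_surjective _).comp (extClassLinear_surjective)
  have hspan : Submodule.span k (π '' {δ | IsElementary BY BX δ}) = ⊤ := by
    rw [Submodule.span_image, span_isElementary, Submodule.map_top, LinearMap.range_eq_top.mpr hπ]
  have : Module.Finite k (Ext Y X 1 ⧸ extRadical Y X) := Module.Finite.of_surjective π hπ
  obtain ⟨f, hf, hf', hf''⟩ := Submodule.exists_fun_fin_finrank_span_eq k
    (π '' {δ | IsElementary BY BX δ})
  have hdim : extRadDim Y X = Module.finrank k
      (Submodule.span k (π '' {δ | IsElementary BY BX δ})) := by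
    rw [hspan, finrank_top, extRadDim]
  choose ζ hζ hζ' using hf
  rw [hdim]
  refine ⟨ζ, hζ, ?_⟩
  have h : (fun i => (extRadical Y X).mkQ (extClass Y X (ζ i))) = f := funext hζ'
  rw [RepresentsExtBasis, h]
  exact ⟨hf'', hf'.trans hspan⟩

end QuiverRep

end

noncomputable section

/-! ### Tree bases of glued representations -/

namespace QuiverRep

variable {k : Type u} [Field k] {L : Type v} [Quiver.{w} L] {ι : L → Type}

/-- The cochain of the structure maps of a representation. -/
abbrev arrows (M : QuiverRep k L) : OneCochain M M := fun _ _ e => M.arrow e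

theorem finite_coefficientQuiver [Finite L] (M : QuiverRep k L)
    (B : ∀ q : L, Module.Basis (ι q) k (M.space q)) : Finite (CoefficientQuiver M B) := by
  have := fun q => Module.Finite.finite_basis (B q)
  exact inferInstanceAs (Finite (Σ q, ι q))

/-- The arrows of the coefficient quiver are the nonzero matrix entries. -/
def totalEquiv (M : QuiverRep k L) (B : ∀ q : L, Module.Basis (ι q) k (M.space q)) :
    Quiver.Total (CoefficientQuiver M B) ≃ {s : Slot ι ι // entry B B s M.arrows ≠ 0} where
  toFun e := ⟨⟨e.left, e.right, e.hom.1⟩, e.hom.2⟩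
  invFun s := ⟨s.1.1, s.1.2.1, ⟨s.1.2.2, s.2⟩⟩
  left_inv _ := rfl
  right_inv _ := rfl

theorem finite_total [Finite L] [∀ a b : L, Finite (a ⟶ b)] (M : QuiverRep k L)
    (B : ∀ q : L, Module.Basis (ι q) k (M.space q)) :
    Finite (Quiver.Total (CoefficientQuiver M B)) := by
  have := fun q => Module.Finite.finite_basis (B q)
  exact Finite.of_equiv _ (totalEquiv M B).symm

/-- The transported basis gives the same matrix entries, so the two coefficient quivers are equal as
quiver structures on one and the same vertex type. -/
theorem isTreeRep_of_iso {M N : QuiverRep k L} (I : M ≅ N) (h : M.IsTreeRep) : N.IsTreeRep := by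
  obtain ⟨ι, B, hB⟩ := h
  let E : ∀ q, M.space q ≃ₗ[k] N.space q := fun q => LinearEquiv.ofLinearMap (homAt I.hom q)
    (homAt I.inv q) (by rw [← homAt_comp, I.inv_hom_id, homAt_id])
    (by rw [← homAt_comp, I.hom_inv_id, homAt_id])
  let B' : ∀ q, Module.Basis (ι q) k (N.space q) := fun q => (B q).map (E q)
  have h1 : ∀ s, entry B' B' s N.arrows = entry B B s M.arrows := by
    rintro ⟨⟨a, i⟩, ⟨b, j⟩, e⟩
    change (B b).repr ((E b).symm (N.arrow e (E a (B a i)))) j = (B b).repr (M.arrow e (B a i)) j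
    congr 2
    rw [LinearEquiv.symm_apply_eq]
    exact arrow_homAt I.hom e (B a i)
  have h2 : (instQuiverCoefficientQuiver M B : Quiver (Σ q, ι q)) =
      instQuiverCoefficientQuiver N B' := by
    refine congrArg Quiver.mk ?_
    funext b b'
    refine congrArg Subtype (funext fun e => ?_)
    exact congrArg (· ≠ 0) (h1 ⟨b, b', e⟩).symm
  exact ⟨ι, B', (congrArg (fun Q => @IsTreelike (Σ q, ι q) Q) h2).mp hB⟩

section TensorBasis

variable {A A' B B' C D ιA ιA' ιB ιB' ιC ιD : Type*} [AddCommGroup A] [Module k A]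
  [AddCommGroup A'] [Module k A'] [AddCommGroup B] [Module k B] [AddCommGroup B'] [Module k B']
  [AddCommGroup C] [Module k C] [AddCommGroup D] [Module k D]
  (bA : Module.Basis ιA k A) (bA' : Module.Basis ιA' k A')
  (bB : Module.Basis ιB k B) (bB' : Module.Basis ιB' k B')
  (bC : Module.Basis ιC k C) (bD : Module.Basis ιD k D)

/-- The basis of `A ⊗ C ⊕ B ⊗ D` that consists of the tensor products of basis elements. -/
def prodTensorBasis : Module.Basis ((ιA × ιC) ⊕ (ιB × ιD)) k ((A ⊗[k] C) × (B ⊗[k] D)) :=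
  (bA.tensorProduct bC).prod (bB.tensorProduct bD)

open Classical in
theorem prodTensorBasis_repr_block_inl (a : A →ₗ[k] A') (c : B ⊗[k] D →ₗ[k] A' ⊗[k] C)
    (b : B →ₗ[k] B') (i : ιA) (t : ιC) (j : ιA') (t' : ιC) :
    (prodTensorBasis bA' bB' bC bD).repr (block (a.rTensor C) c (b.rTensor D)
      (prodTensorBasis bA bB bC bD (.inl (i, t)))) (.inl (j, t')) =
      bA'.repr (a (bA i)) j * if t = t' then 1 else 0 := by
  simp [prodTensorBasis, block, Module.Basis.prod_apply, Finsupp.single_apply, mul_comm]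

open Classical in
theorem prodTensorBasis_repr_block_inr (a : A →ₗ[k] A') (c : B ⊗[k] D →ₗ[k] A' ⊗[k] C)
    (b : B →ₗ[k] B') (i : ιB) (t : ιD) (j : ιB') (t' : ιD) :
    (prodTensorBasis bA' bB' bC bD).repr (block (a.rTensor C) c (b.rTensor D)
      (prodTensorBasis bA bB bC bD (.inr (i, t)))) (.inr (j, t')) =
      bB'.repr (b (bB i)) j * if t = t' then 1 else 0 := by
  simp [prodTensorBasis, block, Module.Basis.prod_apply, Finsupp.single_apply, mul_comm]

theorem prodTensorBasis_repr_block_inl_inr (a : A →ₗ[k] A') (c : B ⊗[k] D →ₗ[k] A' ⊗[k] C)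
    (b : B →ₗ[k] B') (i : ιA) (t : ιC) (j : ιB') (t' : ιD) :
    (prodTensorBasis bA' bB' bC bD).repr (block (a.rTensor C) c (b.rTensor D)
      (prodTensorBasis bA bB bC bD (.inl (i, t)))) (.inr (j, t')) = 0 := by
  simp [prodTensorBasis, block, Module.Basis.prod_apply]

theorem prodTensorBasis_repr_block_inr_inl {n : ℕ} (a : A →ₗ[k] A') (z : Fin n → B →ₗ[k] A')
    (f : Fin n → D →ₗ[k] C) (b : B →ₗ[k] B') (i : ιB) (t : ιD) (j : ιA') (t' : ιC) :
    (prodTensorBasis bA' bB' bC bD).repr (block (a.rTensor C)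
      (∑ l, TensorProduct.map (z l) (f l)) (b.rTensor D)
      (prodTensorBasis bA bB bC bD (.inr (i, t)))) (.inl (j, t')) =
      ∑ l, bA'.repr (z l (bB i)) j * bC.repr (f l (bD t)) t' := by
  simp [prodTensorBasis, block, Module.Basis.prod_apply, mul_comm]

end TensorBasis

end QuiverRep

namespace Kronecker

open QuiverRep

variable {k : Type u} [Field k] {L : Type v} [Quiver.{w} L] {n : ℕ} {X Y : QuiverRep k L}
  {ιX ιY : L → Type} {ιT : Kronecker n → Type} {T : QuiverRep k (Kronecker n)}
  (BX : ∀ q : L, Module.Basis (ιX q) k (X.space q))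
  (BY : ∀ q : L, Module.Basis (ιY q) k (Y.space q))
  (BT : ∀ q : Kronecker n, Module.Basis (ιT q) k (T.space q))
  (ζ : Fin n → OneCochain Y X)

/-- The basis of a glued representation that consists of the tensor products of basis elements. -/
def glueBasis (q : L) :
    Module.Basis ((ιX q × ιT x) ⊕ (ιY q × ιT y)) k (((glue ζ).obj T).space q) :=
  prodTensorBasis (BX q) (BY q) (BT x) (BT y)

theorem arrow_glue {a b : L} (e : a ⟶ b) : ((glue ζ).obj T).arrow e =
    block ((X.arrow e).rTensor (T.space x))
      (∑ i, TensorProduct.map (ζ i e) (T.arrow (arr i))) ((Y.arrow e).rTensor (T.space y)) :=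
  ofMaps_arrow _ _ e

/-- The positions of the matrix entries of a glued representation. -/
abbrev GlueSlot (ιX ιY : L → Type) (ιT : Kronecker n → Type) :=
  Slot (fun q => (ιX q × ιT x) ⊕ (ιY q × ιT y)) (fun q => (ιX q × ιT x) ⊕ (ιY q × ιT y))

/-- The matrix entries of a glued representation. -/
abbrev glueEntry (s : GlueSlot ιX ιY ιT) : k :=
  entry (glueBasis BX BY BT ζ) (glueBasis BX BY BT ζ) s ((glue ζ).obj T).arrows

open Classical in
theorem glueEntry_inl_inl {a b : L} (e : a ⟶ b) (i : ιX a) (t : ιT x) (j : ιX b) (t' : ιT x) :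
    glueEntry BX BY BT ζ ⟨⟨a, .inl (i, t)⟩, ⟨b, .inl (j, t')⟩, e⟩ =
      entry BX BX ⟨⟨a, i⟩, ⟨b, j⟩, e⟩ X.arrows * if t = t' then 1 else 0 := by
  refine Eq.trans ?_ (prodTensorBasis_repr_block_inl (BX a) (BX b) (BY a) (BY b) (BT x) (BT y)
    (X.arrow e) (∑ i, TensorProduct.map (ζ i e) (T.arrow (arr i))) (Y.arrow e) i t j t')
  rw [← arrow_glue]
  rfl

open Classical in
theorem glueEntry_inr_inr {a b : L} (e : a ⟶ b) (i : ιY a) (t : ιT y) (j : ιY b) (t' : ιT y) :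
    glueEntry BX BY BT ζ ⟨⟨a, .inr (i, t)⟩, ⟨b, .inr (j, t')⟩, e⟩ =
      entry BY BY ⟨⟨a, i⟩, ⟨b, j⟩, e⟩ Y.arrows * if t = t' then 1 else 0 := by
  refine Eq.trans ?_ (prodTensorBasis_repr_block_inr (BX a) (BX b) (BY a) (BY b) (BT x) (BT y)
    (X.arrow e) (∑ i, TensorProduct.map (ζ i e) (T.arrow (arr i))) (Y.arrow e) i t j t')
  rw [← arrow_glue]
  rfl

theorem glueEntry_inl_inr {a b : L} (e : a ⟶ b) (i : ιX a) (t : ιT x) (j : ιY b) (t' : ιT y) :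
    glueEntry BX BY BT ζ ⟨⟨a, .inl (i, t)⟩, ⟨b, .inr (j, t')⟩, e⟩ = 0 := by
  refine Eq.trans ?_ (prodTensorBasis_repr_block_inl_inr (BX a) (BX b) (BY a) (BY b) (BT x) (BT y)
    (X.arrow e) (∑ i, TensorProduct.map (ζ i e) (T.arrow (arr i))) (Y.arrow e) i t j t')
  rw [← arrow_glue]
  rfl

theorem glueEntry_inr_inl {a b : L} (e : a ⟶ b) (i : ιY a) (t : ιT y) (j : ιX b) (t' : ιT x) :
    glueEntry BX BY BT ζ ⟨⟨a, .inr (i, t)⟩, ⟨b, .inl (j, t')⟩, e⟩ =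
      ∑ l, entry BY BX ⟨⟨a, i⟩, ⟨b, j⟩, e⟩ (ζ l) *
        entry BT BT ⟨⟨y, t⟩, ⟨x, t'⟩, arr l⟩ T.arrows := by
  refine Eq.trans ?_ (prodTensorBasis_repr_block_inr_inl (BX a) (BX b) (BY a) (BY b) (BT x) (BT y)
    (X.arrow e) (fun i => ζ i e) (fun i => T.arrow (arr i)) (Y.arrow e) i t j t')
  rw [← arrow_glue]
  rfl

end Kronecker

end

noncomputable section

/-! ### Glueing tree bases -/

namespace Kronecker

open QuiverRep

variable {k : Type u} [Field k] {L : Type v} [Quiver.{w} L] {n : ℕ} {X Y : QuiverRep k L}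
  {ιX ιY : L → Type} {ιT : Kronecker n → Type} {T : QuiverRep k (Kronecker n)}
  {BX : ∀ q : L, Module.Basis (ιX q) k (X.space q)}
  {BY : ∀ q : L, Module.Basis (ιY q) k (Y.space q)}
  {BT : ∀ q : Kronecker n, Module.Basis (ιT q) k (T.space q)}
  {ζ : Fin n → OneCochain Y X}

open Classical in
/-- Linearly independent elementary matrices have their nonzero entries in different
positions. -/
theorem exists_injective_slot (hζ : ∀ i, IsElementary BY BX (ζ i)) (h : Function.Injective ζ) :
    ∃ s : Fin n → Slot ιY ιX, Function.Injective s ∧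
      ∀ i s', entry BY BX s' (ζ i) = if s' = s i then 1 else 0 := by
  choose s hs using fun i => isElementary_iff.mp (hζ i)
  refine ⟨s, fun i j hij => h (entry_ext (BY := BY) (BX := BX) fun s' => ?_), hs⟩
  rw [hs, hs, hij]

/-- The vertices of the coefficient quiver of a glued representation. -/
def glueVertexEquiv (ιX ιY : L → Type) (ιT : Kronecker n → Type) :
    (Σ q, (ιX q × ιT x) ⊕ (ιY q × ιT y)) ≃ ((Σ q, ιX q) × ιT x) ⊕ ((Σ q, ιY q) × ιT y) where
  toFun
    | ⟨q, .inl (i, t)⟩ => .inl (⟨q, i⟩, t)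
    | ⟨q, .inr (i, t)⟩ => .inr (⟨q, i⟩, t)
  invFun
    | .inl (p, t) => ⟨p.1, .inl (p.2, t)⟩
    | .inr (p, t) => ⟨p.1, .inr (p.2, t)⟩
  left_inv := by rintro ⟨q, ⟨i, t⟩ | ⟨i, t⟩⟩ <;> rfl
  right_inv := by rintro (⟨⟨q, i⟩, t⟩ | ⟨⟨q, i⟩, t⟩) <;> rfl

/-- The vertices of the coefficient quiver of a representation of the Kronecker quiver. -/
def vertexEquiv (ιT : Kronecker n → Type) : (Σ q, ιT q) ≃ ιT x ⊕ ιT y where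
  toFun
    | ⟨.x, t⟩ => .inl t
    | ⟨.y, t⟩ => .inr t
  invFun
    | .inl t => ⟨x, t⟩
    | .inr t => ⟨y, t⟩
  left_inv := by rintro ⟨_ | _, t⟩ <;> rfl
  right_inv := by rintro (t | t) <;> rfl

/-- The projection of the coefficient quiver of a glued representation onto the coefficient quiver
of the representation of the Kronecker quiver. -/
def glueVertexProj : (Σ q, (ιX q × ιT x) ⊕ (ιY q × ιT y)) → Σ q, ιT q
  | ⟨_, .inl (_, t)⟩ => ⟨x, t⟩
  | ⟨_, .inr (_, t)⟩ => ⟨y, t⟩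

instance finite : Finite (Kronecker n) := by
  refine Finite.of_injective (β := Bool) (fun | .y => true | .x => false) ?_
  rintro (_ | _) (_ | _) h <;> simp_all

instance finite_hom (a b : Kronecker n) : Finite (a ⟶ b) := by
  refine Finite.of_injective (β := Option (Fin n)) (fun | .arr i => some i) ?_
  rintro ⟨i⟩ ⟨j⟩ hij
  cases hij
  rfl

/-- An upper bound is enough, because connectedness supplies the opposite inequality. Each nonzero
entry lies in a copy of `X`, in a copy of `Y`, or in the upper right block, where it is caused by an
arrow of the coefficient quiver of `T`. -/
theorem card_total_glueBasis_le [Finite L] [∀ a b : L, Finite (a ⟶ b)]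
    (hζ : ∀ i, IsElementary BY BX (ζ i)) (h : Function.Injective ζ) :
    Nat.card (Quiver.Total (CoefficientQuiver ((glue ζ).obj T) (glueBasis BX BY BT ζ))) ≤
      Nat.card (Quiver.Total (CoefficientQuiver X BX)) * Nat.card (ιT x) +
        (Nat.card (Quiver.Total (CoefficientQuiver Y BY)) * Nat.card (ιT y) +
        Nat.card (Quiver.Total (CoefficientQuiver T BT))) := by
  classical
  obtain ⟨s, -, hs⟩ := exists_injective_slot hζ h
  have hTx := Module.Finite.finite_basis (BT x)
  have hTy := Module.Finite.finite_basis (BT y)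
  have := finite_total X BX
  have := finite_total Y BY
  have := finite_total T BT
  have hfin := Finite.of_equiv _ (totalEquiv T BT)
  rw [Nat.card_congr (totalEquiv T BT), ← Nat.card_prod, ← Nat.card_prod, ← Nat.card_sum,
    ← Nat.card_sum, Nat.card_congr (totalEquiv _ (glueBasis BX BY BT ζ))]
  -- As `ζ l` is elementary, a nonzero entry of `T(l)` shows up in the glued representation only at
  -- the slot `s l`.
  let G₃ : {s : Slot ιT ιT // entry BT BT s T.arrows ≠ 0} → GlueSlot ιX ιY ιT := fun τ =>
    match τ with
    | ⟨⟨⟨_, t⟩, ⟨_, t'⟩, .arr l⟩, _⟩ =>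
      ⟨⟨(s l).1.1, .inr ((s l).1.2, t)⟩, ⟨(s l).2.1.1, .inl ((s l).2.1.2, t')⟩, (s l).2.2⟩
  let G : (Quiver.Total (CoefficientQuiver X BX) × ιT x) ⊕
      ((Quiver.Total (CoefficientQuiver Y BY) × ιT y) ⊕
        {s : Slot ιT ιT // entry BT BT s T.arrows ≠ 0}) → GlueSlot ιX ιY ιT :=
    Sum.elim (fun z => ⟨⟨z.1.left.1, .inl (z.1.left.2, z.2)⟩,
        ⟨z.1.right.1, .inl (z.1.right.2, z.2)⟩, z.1.hom.1⟩)
      (Sum.elim (fun z => ⟨⟨z.1.left.1, .inr (z.1.left.2, z.2)⟩,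
        ⟨z.1.right.1, .inr (z.1.right.2, z.2)⟩, z.1.hom.1⟩) G₃)
  have hG : ∀ σ, glueEntry BX BY BT ζ σ ≠ 0 → ∃ z, G z = σ := by
    rintro ⟨⟨a, ⟨i, t⟩ | ⟨i, t⟩⟩, ⟨b, ⟨j, t'⟩ | ⟨j, t'⟩⟩, e⟩ hσ
    · rw [glueEntry_inl_inl] at hσ
      obtain rfl : t = t' := by
        by_contra htt
        simp [htt] at hσ
      exact ⟨.inl (⟨⟨a, i⟩, ⟨b, j⟩, ⟨e, left_ne_zero_of_mul hσ⟩⟩, t), rfl⟩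
    · exact absurd (glueEntry_inl_inr ..) hσ
    · rw [glueEntry_inr_inl] at hσ
      obtain ⟨l, -, hl⟩ := Finset.exists_ne_zero_of_sum_ne_zero hσ
      refine ⟨.inr (.inr ⟨_, right_ne_zero_of_mul hl⟩), ?_⟩
      have h1 : (⟨⟨a, i⟩, ⟨b, j⟩, e⟩ : Slot ιY ιX) = s l := by
        by_contra hne
        have := left_ne_zero_of_mul hl
        rw [hs, if_neg hne] at this
        exact this rfl
      change (⟨⟨(s l).1.1, .inr ((s l).1.2, t)⟩, ⟨(s l).2.1.1, .inl ((s l).2.1.2, t')⟩,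
        (s l).2.2⟩ : GlueSlot ιX ιY ιT) = _
      rw [← h1]
    · rw [glueEntry_inr_inr] at hσ
      obtain rfl : t = t' := by
        by_contra htt
        simp [htt] at hσ
      exact ⟨.inr (.inl (⟨⟨a, i⟩, ⟨b, j⟩, ⟨e, left_ne_zero_of_mul hσ⟩⟩, t)), rfl⟩
  choose H hH using hG
  refine Nat.card_le_card_of_injective (fun σ => H σ.1 σ.2) fun σ σ' hσ => Subtype.ext ?_
  rw [← hH σ.1 σ.2, ← hH σ'.1 σ'.2]
  exact congrArg G hσ

/-- The coefficient quiver lies over that of `T`. The fibres are copies of the coefficient quivers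
of `X` and `Y`, and each arrow of the base over the arrow `l` lifts to the slot `s l`. -/
theorem connected_glueBasis (hζ : ∀ i, IsElementary BY BX (ζ i)) (h : Function.Injective ζ)
    (hX : (underlyingGraph (CoefficientQuiver X BX)).Connected)
    (hY : (underlyingGraph (CoefficientQuiver Y BY)).Connected)
    (hT : (underlyingGraph (CoefficientQuiver T BT)).Connected) :
    (underlyingGraph (CoefficientQuiver ((glue ζ).obj T) (glueBasis BX BY BT ζ))).Connected := by
  classical
  obtain ⟨s, hs', hs⟩ := exists_injective_slot hζ h
  let V := CoefficientQuiver ((glue ζ).obj T) (glueBasis BX BY BT ζ)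
  let fx : ιT x → CoefficientQuiver X BX → V := fun t p => ⟨p.1, .inl (p.2, t)⟩
  have hx : ∀ (t : ιT x) (p p' : CoefficientQuiver X BX), (underlyingGraph V).Reachable
      ⟨p.1, .inl (p.2, t)⟩ ⟨p'.1, .inl (p'.2, t)⟩ := fun t p p' =>
    have hf : ∀ {a b : CoefficientQuiver X BX}, (a ⟶ b) →
        Nonempty (fx t a ⟶ fx t b) := fun {a b} e => ⟨⟨e.1, by
      refine (glueEntry_inl_inl BX BY BT ζ e.1 a.2 t b.2 t).trans_ne ?_
      rw [if_pos rfl, mul_one]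
      exact e.2⟩⟩
    reachable_map (fx t) hf (hX.preconnected p p')
  let fy : ιT y → CoefficientQuiver Y BY → V := fun t p => ⟨p.1, .inr (p.2, t)⟩
  have hy : ∀ (t : ιT y) (p p' : CoefficientQuiver Y BY), (underlyingGraph V).Reachable
      ⟨p.1, .inr (p.2, t)⟩ ⟨p'.1, .inr (p'.2, t)⟩ := fun t p p' =>
    have hf : ∀ {a b : CoefficientQuiver Y BY}, (a ⟶ b) →
        Nonempty (fy t a ⟶ fy t b) := fun {a b} e => ⟨⟨e.1, by
      refine (glueEntry_inr_inr BX BY BT ζ e.1 a.2 t b.2 t).trans_ne ?_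
      rw [if_pos rfl, mul_one]
      exact e.2⟩⟩
    reachable_map (fy t) hf (hY.preconnected p p')
  refine connected_of_fibration (V := V) (W := CoefficientQuiver T BT) glueVertexProj ?_ ?_ ?_ hT
  · obtain ⟨p⟩ := hX.nonempty
    obtain ⟨p'⟩ := hY.nonempty
    rintro ⟨_ | _, t⟩
    · exact ⟨⟨p'.1, .inr (p'.2, t)⟩, rfl⟩
    · exact ⟨⟨p.1, .inl (p.2, t)⟩, rfl⟩
  · rintro ⟨a, ⟨i, t⟩ | ⟨i, t⟩⟩ ⟨b, ⟨j, t'⟩ | ⟨j, t'⟩⟩ hab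
    · cases hab
      exact hx t ⟨a, i⟩ ⟨b, j⟩
    · cases hab
    · cases hab
    · cases hab
      exact hy t ⟨a, i⟩ ⟨b, j⟩
  · rintro ⟨_, t⟩ ⟨_, t'⟩ ⟨⟨l⟩, he⟩
    refine ⟨⟨(s l).1.1, .inr ((s l).1.2, t)⟩, ⟨(s l).2.1.1, .inl ((s l).2.1.2, t')⟩, rfl, rfl,
      reachable_of_hom (V := V) ⟨(s l).2.2, ?_⟩⟩
    refine (glueEntry_inr_inl BX BY BT ζ (s l).2.2 (s l).1.2 t (s l).2.1.2 t').trans_ne ?_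
    -- The slots are distinct, so only the summand `l` contributes and no cancellation occurs.
    rw [Finset.sum_eq_single l]
    · rw [hs, if_pos rfl, one_mul]
      exact he
    · intro l' _ hl
      rw [hs, if_neg fun h' => hl (hs' h').symm, zero_mul]
    · exact fun hl => absurd (Finset.mem_univ l) hl

theorem isTreeBasis_glueBasis [Finite L] [∀ a b : L, Finite (a ⟶ b)]
    (hζ : ∀ i, IsElementary BY BX (ζ i)) (h : Function.Injective ζ) (hX : X.IsTreeBasis BX)
    (hY : Y.IsTreeBasis BY) (hT : T.IsTreeBasis BT) :
    ((glue ζ).obj T).IsTreeBasis (glueBasis BX BY BT ζ) := by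
  have := finite_coefficientQuiver ((glue ζ).obj T) (glueBasis BX BY BT ζ)
  have := finite_total ((glue ζ).obj T) (glueBasis BX BY BT ζ)
  have := finite_coefficientQuiver X BX
  have := finite_coefficientQuiver Y BY
  have hTx := Module.Finite.finite_basis (BT x)
  have hTy := Module.Finite.finite_basis (BT y)
  have : Finite (CoefficientQuiver T BT) := Finite.of_equiv _ (vertexEquiv ιT).symm
  refine isTreelike_of_connected
    (connected_glueBasis hζ h hX.isTree.1 hY.isTree.1 hT.isTree.1) ?_
  have h1 := card_total_glueBasis_le (T := T) (BT := BT) hζ h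
  have h2 := hX.card_total_add_one_le
  have h3 := hY.card_total_add_one_le
  have h4 := hT.card_total_add_one_le
  have h5 : Nat.card (CoefficientQuiver ((glue ζ).obj T) (glueBasis BX BY BT ζ)) =
      Nat.card (CoefficientQuiver X BX) * Nat.card (ιT x) +
        Nat.card (CoefficientQuiver Y BY) * Nat.card (ιT y) := by
    rw [← Nat.card_prod, ← Nat.card_prod, ← Nat.card_sum]
    exact Nat.card_congr (glueVertexEquiv ιX ιY ιT)
  have h6 : Nat.card (CoefficientQuiver T BT) = Nat.card (ιT x) + Nat.card (ιT y) := by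
    rw [← Nat.card_sum]
    exact Nat.card_congr (vertexEquiv ιT)
  rw [h5]
  -- The inequality "arrows + 1 ≤ vertices" is taken once per copy of `X`, once per copy of `Y`, and
  -- once for `T`, whose vertices number the copies; adding up leaves exactly one to spare.
  have h7 := Nat.mul_le_mul_right (Nat.card (ιT x)) h2
  have h8 := Nat.mul_le_mul_right (Nat.card (ιT y)) h3
  rw [add_one_mul] at h7 h8
  omega

/-- The glueing functor sends tree representations to tree representations. -/
theorem isTreeRep_glue [Finite L] [∀ a b : L, Finite (a ⟶ b)]
    (hζ : ∀ i, IsElementary BY BX (ζ i)) (h : Function.Injective ζ) (hX : X.IsTreeBasis BX)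
    (hY : Y.IsTreeBasis BY) (hT : T.IsTreeRep) : ((glue ζ).obj T).IsTreeRep := by
  obtain ⟨ιT, BT, hT⟩ := hT
  exact ⟨_, glueBasis BX BY BT ζ, isTreeBasis_glueBasis hζ h hX hY hT⟩

end Kronecker

end

noncomputable section

/-! ### One-dimensional extension spaces -/

namespace QuiverRep

variable {k : Type u} [Field k] {L : Type v} [Quiver.{w} L] {X Y : QuiverRep k L}

theorem isNilpotent_of_mem_jacobson [Finite L] {f : End X} (hf : f ∈ Ring.jacobson (End X)) :
    ∃ m : ℕ, f ^ m = 0 := by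
  have : IsArtinianRing (End X) := IsArtinianRing.of_finite k _
  obtain ⟨m, hm⟩ := IsSemiprimaryRing.isNilpotent (R := End X)
  have h := Submodule.pow_mem_pow _ hf m
  rw [hm] at h
  exact ⟨m, h⟩

/-- If `Ext¹(Y, X)` is one-dimensional, then its radical vanishes. -/
theorem extRadical_eq_bot_of_finrank_eq_one [Finite L]
    (h : Module.finrank k (Ext Y X 1) = 1) : extRadical Y X = ⊥ := by
  obtain ⟨η, hη, hη'⟩ := finrank_eq_one_iff'.mp h
  rw [extRadical, Submodule.span_eq_bot]
  rintro _ (⟨f, hf, ξ, rfl⟩ | ⟨f, hf, ξ, rfl⟩)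
  · obtain ⟨c, hc⟩ := hη' (η.comp (Ext.mk₀ f) (add_zero 1))
    obtain ⟨m, hm⟩ := isNilpotent_of_mem_jacobson hf
    have h1 : ∀ m : ℕ, η.comp (Ext.mk₀ (f ^ m)) (add_zero 1) = c ^ m • η := by
      intro m
      induction m with
      | zero => rw [pow_zero, pow_zero, one_smul]; exact Ext.comp_mk₀_id η
      | succ m ih =>
        rw [pow_succ, End.mul_def, ← Ext.mk₀_comp_mk₀, ← Ext.comp_assoc_of_second_deg_zero, ← hc,
          Ext.smul_comp, ih, smul_smul, pow_succ']
    have h2 := h1 m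
    rw [hm] at h2
    have h3 : η.comp (Ext.mk₀ (0 : End X)) (add_zero 1) = 0 :=
      (congrArg (fun ξ => η.comp ξ _) (Ext.mk₀_zero _ _)).trans (Ext.comp_zero η _ _ _ _)
    have h4 : c = 0 := by
      have := (smul_eq_zero.mp (h2.symm.trans h3)).resolve_right hη
      by_contra hc
      exact pow_ne_zero m hc this
    obtain ⟨d, rfl⟩ := hη' ξ
    rw [Ext.smul_comp, ← hc, h4, zero_smul, smul_zero]
  · obtain ⟨c, hc⟩ := hη' ((Ext.mk₀ f).comp η (zero_add 1))
    obtain ⟨m, hm⟩ := isNilpotent_of_mem_jacobson hf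
    have h1 : ∀ m : ℕ, (Ext.mk₀ (f ^ m)).comp η (zero_add 1) = c ^ m • η := by
      intro m
      induction m with
      | zero => rw [pow_zero, pow_zero, one_smul]; exact Ext.mk₀_id_comp η
      | succ m ih =>
        rw [pow_succ', End.mul_def, ← Ext.mk₀_comp_mk₀, Ext.comp_assoc_of_second_deg_zero, ← hc,
          Ext.comp_smul, ih, smul_smul, pow_succ']
    have h2 := h1 m
    rw [hm] at h2
    have h3 : (Ext.mk₀ (0 : End Y)).comp η (zero_add 1) = 0 :=
      (congrArg (fun ξ => Ext.comp ξ η _) (Ext.mk₀_zero _ _)).trans (Ext.zero_comp _ _ η _ _)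
    have h4 : c = 0 := by
      have := (smul_eq_zero.mp (h2.symm.trans h3)).resolve_right hη
      by_contra hc
      exact pow_ne_zero m hc this
    obtain ⟨d, rfl⟩ := hη' ξ
    rw [Ext.comp_smul, ← hc, h4, zero_smul, smul_zero]

theorem indecomposable_of_iso {C : Type*} [Category* C] [HasZeroMorphisms C] [HasBinaryBiproducts C]
    {M N : C} (I : M ≅ N) (h : Indecomposable M) : Indecomposable N :=
  ⟨fun h0 => h.1 (h0.of_iso I), fun Y Z J => h.2 Y Z (I ≪≫ J)⟩

end QuiverRep

namespace Kronecker

open QuiverRep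

variable {k : Type u} [Field k] {L : Type v} [Quiver.{w} L] {X Y : QuiverRep k L}

/-- A representation of the quiver with one arrow by one-dimensional spaces and a nonzero map is
indecomposable. -/
theorem indecomposable_ofMaps_one {t : Fin 1 → k →ₗ[k] k} (ht : t 0 ≠ 0) :
    Indecomposable (ofMaps k k t) := by
  have ht1 : t 0 1 ≠ 0 := fun h => ht (LinearMap.ext_ring h)
  refine indecomposable_of_idempotents (fun h0 => ?_) fun e he => ?_
  · have h1 := (IsZero.iff_id_eq_zero _).mp h0
    exact one_ne_zero (α := k) (LinearMap.congr_fun (congrArg (fun f => homAt f y) h1) (1 : k))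
  -- The idempotent is a pair of scalars. Compatibility with the nonzero map makes them equal, and
  -- an idempotent scalar is `0` or `1`.
  · let ex : k →ₗ[k] k := homAt e x
    let ey : k →ₗ[k] k := homAt e y
    have h1 : t 0 ∘ₗ ey = ex ∘ₗ t 0 := by
      have := arrow_comp_homAt e (arr 0)
      rwa [ofMaps_arrow_arr] at this
    have h2 : ex ∘ₗ ex = ex := congrArg (fun f => homAt f x) he
    have hx : ∀ a, ex a = a * ex 1 := fun a => by
      rw [← smul_eq_mul, ← map_smul, smul_eq_mul, mul_one]
    have hy : ∀ a, ey a = a * ey 1 := fun a => by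
      rw [← smul_eq_mul, ← map_smul, smul_eq_mul, mul_one]
    have ht' : ∀ a, t 0 a = a * t 0 1 := fun a => by
      rw [← smul_eq_mul, ← map_smul, smul_eq_mul, mul_one]
    have h3 : ey 1 = ex 1 := by
      have := LinearMap.congr_fun h1 1
      rw [LinearMap.comp_apply, LinearMap.comp_apply, ht', hx, mul_comm] at this
      exact mul_left_cancel₀ ht1 this
    have h4 : ex 1 * ex 1 = ex 1 := (hx _).symm.trans (LinearMap.congr_fun h2 1)
    have h6 : ex 1 * (ex 1 - 1) = 0 := by rw [mul_sub, h4, mul_one, sub_self]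
    rcases (mul_eq_zero.mp h6).imp_right sub_eq_zero.mp with h5 | h5
    · left
      exact hom_ext (LinearMap.ext_ring (h5 : ex 1 = 0))
        (LinearMap.ext_ring (h3.trans h5 : ey 1 = 0))
    · right
      exact hom_ext (LinearMap.ext_ring (h5 : ex 1 = 1))
        (LinearMap.ext_ring (h3.trans h5 : ey 1 = 1))

/-- Such a representation is a tree representation. -/
theorem isTreeRep_ofMaps_one {t : Fin 1 → k →ₗ[k] k} (ht : t 0 ≠ 0) :
    (ofMaps k k t).IsTreeRep := by
  have ht1 : t 0 1 ≠ 0 := fun h => ht (LinearMap.ext_ring h)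
  let B : ∀ q : Kronecker 1, Module.Basis Unit k ((ofMaps k k t).space q) := fun
    | .y => Module.Basis.singleton Unit k
    | .x => Module.Basis.singleton Unit k
  let V := CoefficientQuiver (ofMaps k k t) B
  have := finite_coefficientQuiver (ofMaps k k t) B
  have := finite_total (ofMaps k k t) B
  let a : V := ⟨y, ()⟩
  let b : V := ⟨x, ()⟩
  have e : (underlyingGraph V).Reachable a b := reachable_of_hom (V := V) (⟨arr 0, by
    rw [ofMaps_arrow_arr]
    change (Module.Basis.singleton Unit k).repr (t 0 (Module.Basis.singleton Unit k ())) () ≠ 0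
    simpa using ht1⟩ : a ⟶ b)
  have hc : (underlyingGraph V).Connected := by
    have : Nonempty V := ⟨a⟩
    have h : ∀ z : V, (underlyingGraph V).Reachable a z := by
      rintro ⟨_ | _, ⟨⟩⟩
      · exact .refl _
      · exact e
    exact ⟨fun z z' => (h z).symm.trans (h z')⟩
  refine ⟨fun _ => Unit, B, isTreelike_of_connected hc ?_⟩
  have h1 : Nat.card (Quiver.Total V) ≤ 1 := by
    rw [Finite.card_le_one_iff_subsingleton]
    refine ⟨?_⟩
    rintro ⟨⟨_, ⟨⟩⟩, ⟨_, ⟨⟩⟩, ⟨⟨i⟩, hi⟩⟩ ⟨⟨_, ⟨⟩⟩, ⟨_, ⟨⟩⟩, ⟨⟨j⟩, hj⟩⟩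
    obtain rfl := Subsingleton.elim i j
    rfl
  have h2 : 1 < Nat.card V := by
    rw [Finite.one_lt_card_iff_nontrivial]
    exact ⟨a, b, fun h => by cases (congrArg Sigma.fst h : (y : Kronecker 1) = x)⟩
  change Nat.card (Quiver.Total V) + 1 ≤ Nat.card V
  omega

/-- The middle term of a nonsplit extension of `Y` by `X` is glued from the representation of the
quiver with one arrow, if `Ext¹(Y, X)` is one-dimensional. -/
theorem exists_iso_glue_ofMaps_one {ζ : Fin 1 → OneCochain Y X}
    (hζ : Submodule.span k (Set.range fun i => extClass Y X (ζ i)) = ⊤) {M : QuiverRep k L}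
    (f : X ⟶ M) (g : M ⟶ Y) (h : f ≫ g = 0) (hS : (ShortComplex.mk f g h).ShortExact)
    (hM : IsEmpty (ShortComplex.mk f g h).Splitting) :
    ∃ t : Fin 1 → k →ₗ[k] k, t 0 ≠ 0 ∧ Nonempty (M ≅ (glue ζ).obj (ofMaps k k t)) := by
  let Ix := tensUnitIso X
  let Iy := tensUnitIso Y
  have hS' : (ShortComplex.mk (Ix.inv ≫ f) (g ≫ Iy.hom) (by simp [reassoc_of% h])).ShortExact :=
    ShortComplex.shortExact_of_iso (ShortComplex.isoMk (S₁ := ShortComplex.mk f g h)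
      (S₂ := ShortComplex.mk (Ix.inv ≫ f) (g ≫ Iy.hom) (by simp [reassoc_of% h]))
      Ix (Iso.refl _) Iy (by simp) (by simp)) hS
  obtain ⟨δ, I, -, hI⟩ := exists_iso_extSequence _ _ _ hS'
  obtain ⟨t, h', ht⟩ := exists_sub_glueCochain_mem_range hζ δ
  refine ⟨t, fun ht0 => ?_, ?_⟩
  -- If `t 0` were zero, `δ` would be a coboundary, and the resulting section would split the given
  -- sequence.
  · have h1 : glueCochain ζ t = 0 := by
      funext a b e
      refine tens_map_ext fun m v => ?_
      rw [glueCochain_tmulAt, Finset.univ_unique, Finset.sum_singleton]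
      change tmulAt _ (t 0 v) = _
      rw [ht0, LinearMap.zero_apply, map_zero]
      rfl
    rw [h1, sub_zero] at ht
    obtain ⟨s, hs⟩ := exists_section_of_extClass_eq_zero
      ((extClass_eq_zero_iff δ).mpr ⟨h', ht.symm⟩)
    refine hM.false (ShortComplex.Splitting.ofExactOfSection _ hS.exact
      (Iy.hom ≫ s ≫ I.inv) ?_ hS.mono_f)
    have h2 : I.inv ≫ g ≫ Iy.hom = (extSequence _ _ δ).g := (Iso.inv_comp_eq I).mpr hI.symm
    change (Iy.hom ≫ s ≫ I.inv) ≫ g = 𝟙 Y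
    rw [← cancel_mono Iy.hom, Category.assoc, Category.assoc, Category.assoc, h2]
    exact (congrArg (fun z => Iy.hom ≫ z) hs).trans
      ((Category.comp_id _).trans (Category.id_comp _).symm)
  · have h1 : (fun i => (ofMaps k k t).arrow (arr i)) = t :=
      funext fun i => ofMaps_arrow_arr _ _ t i
    refine ⟨I ≪≫ ?_ ≪≫ (glueIso ζ (ofMaps k k t)).symm⟩
    refine extIsoOfCoboundary (X := tens k X) (Y := tens k Y) h' ?_
    refine Eq.trans ?_ ht.symm
    exact congrArg (fun t : Fin 1 → k →ₗ[k] k => δ - glueCochain ζ t) h1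

end Kronecker

end

/-! ### The corollary on nonsplit extensions and the final theorem -/

noncomputable section

namespace Kronecker

open QuiverRep

variable {k : Type u} [Field k] [IsAlgClosed k] {L : Type v} [Quiver.{w} L] [Finite L]
  [∀ a b : L, Finite (a ⟶ b)] {X Y : QuiverRep k L}

/-- If `Ext¹(Y, X)` is one-dimensional, then the middle term of a nonsplit extension of `Y` by `X`
is an indecomposable tree representation. -/
theorem indecomposable_isTreeRep_of_finrank_eq_one (hX : Indecomposable X) (hXtree : X.IsTreeRep)
    (hY : Indecomposable Y) (hYtree : Y.IsTreeRep) (hXY : ∀ f : X ⟶ Y, f = 0)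
    (hdim : Module.finrank k (Ext Y X 1) = 1) {M : QuiverRep k L} (f : X ⟶ M) (g : M ⟶ Y)
    (h : f ≫ g = 0) (hS : (ShortComplex.mk f g h).ShortExact)
    (hM : IsEmpty (ShortComplex.mk f g h).Splitting) : Indecomposable M ∧ M.IsTreeRep := by
  obtain ⟨ιX, BX, hBX⟩ := hXtree
  obtain ⟨ιY, BY, hBY⟩ := hYtree
  -- With zero radical the quotient is all of `Ext¹(Y, X)`, so exactly one elementary cochain is
  -- glued along.
  have hR := extRadical_eq_bot_of_finrank_eq_one hdim
  have h1 : extRadDim Y X = 1 := by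
    rw [extRadDim, hR, (Submodule.quotEquivOfEqBot _ rfl).finrank_eq, hdim]
  obtain ⟨ζ, hζ, hζ'⟩ : ∃ ζ : Fin 1 → OneCochain Y X,
      (∀ i, IsElementary BY BX (ζ i)) ∧ RepresentsExtBasis ζ :=
    h1 ▸ exists_isElementary_representsExtBasis BY BX
  obtain ⟨t, ht, ⟨I⟩⟩ := exists_iso_glue_ofMaps_one (span_extClass_eq_top hR hζ') f g h hS hM
  exact ⟨indecomposable_of_iso I.symm
      (indecomposable_glue hζ'.1 hX hY hXY (indecomposable_ofMaps_one ht)),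
    isTreeRep_of_iso I.symm
      (isTreeRep_glue hζ hζ'.injective hBX hBY (isTreeRep_ofMaps_one ht))⟩

end Kronecker

end

theorem lemma5p5p3 {k : Type u} [Field k] [IsAlgClosed k] {L : Type v} [Quiver.{w} L] [Finite L]
    [∀ a b : L, Finite (a ⟶ b)] (X Y : QuiverRep k L)
    (hX : Indecomposable X) (hXtree : X.IsTreeRep)
    (hY : Indecomposable Y) (hYtree : Y.IsTreeRep)
    (hXY : ∀ f : X ⟶ Y, f = 0) :
    -- the lemma: for all tree bases of `X` and `Y` ...
    (∀ (ιX ιY : L → Type) (BX : ∀ q : L, Module.Basis (ιX q) k (X.space q))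
        (BY : ∀ q : L, Module.Basis (ιY q) k (Y.space q)), X.IsTreeBasis BX → Y.IsTreeBasis BY →
      -- ... there are elementary matrices that form a basis of `Ext¹(Y, X)` modulo its radical,
      (∃ ζ : Fin (QuiverRep.extRadDim Y X) → QuiverRep.OneCochain Y X,
        (∀ i, QuiverRep.IsElementary BY BX (ζ i)) ∧ QuiverRep.RepresentsExtBasis ζ) ∧
      -- ... and every such choice gives a functor with the following properties:
      ∀ ζ : Fin (QuiverRep.extRadDim Y X) → QuiverRep.OneCochain Y X,
        (∀ i, QuiverRep.IsElementary BY BX (ζ i)) → QuiverRep.RepresentsExtBasis ζ →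
        ∃ F : QuiverRep k (Kronecker (QuiverRep.extRadDim Y X)) ⥤ QuiverRep k L,
          F = Kronecker.glue ζ ∧
          (∀ T, Indecomposable T → T.IsTreeRep →
            Indecomposable (F.obj T) ∧ (F.obj T).IsTreeRep) ∧
          (F.Additive ∧ F.Linear k) ∧
          (F.Faithful ∧ PreservesFiniteLimits F ∧ PreservesFiniteColimits F) ∧
          (∀ T, Indecomposable T → Indecomposable (F.obj T)) ∧
          (∀ T T', Nonempty (F.obj T ≅ F.obj T') → Nonempty (T ≅ T')) ∧
          (Nonempty (F.obj (Kronecker.simpleY k _) ≅ Y) ∧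
            Nonempty (F.obj (Kronecker.simpleX k _) ≅ X)) ∧
          ((∀ f : Y ⟶ X, f = 0) → (∀ f : X ⟶ X, ∃ c : k, f = c • 𝟙 X) →
            (∀ f : Y ⟶ Y, ∃ c : k, f = c • 𝟙 Y) →
            (QuiverRep.filtered Y X).IsClosedUnderKernels ∧
            (QuiverRep.filtered Y X).IsClosedUnderCokernels ∧
            ∃ h : ∀ T, QuiverRep.filtered Y X (F.obj T),
              ((QuiverRep.filtered Y X).lift F h).IsEquivalence)) ∧
    -- the corollary:
    (Module.finrank k (Ext Y X 1) = 1 →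
      ∀ (M : QuiverRep k L) (f : X ⟶ M) (g : M ⟶ Y) (h : f ≫ g = 0),
        (ShortComplex.mk f g h).ShortExact → IsEmpty (ShortComplex.mk f g h).Splitting →
        Indecomposable M ∧ M.IsTreeRep) := by
  refine ⟨fun ιX ιY BX BY hBX hBY =>
    ⟨QuiverRep.exists_isElementary_representsExtBasis BY BX, fun ζ hζ hζ' => ?_⟩,
    fun hdim M f g h hS hM => Kronecker.indecomposable_isTreeRep_of_finrank_eq_one
      hX hXtree hY hYtree hXY hdim f g h hS hM⟩
  have hind := fun T (hT : Indecomposable T) =>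
    Kronecker.indecomposable_glue (T := T) hζ'.1 hX hY hXY hT
  exact ⟨Kronecker.glue ζ, rfl,
    fun T hT hT' => ⟨hind T hT, Kronecker.isTreeRep_glue hζ hζ'.injective hBX hBY hT'⟩,
    ⟨inferInstance, inferInstance⟩,
    ⟨Kronecker.glue_faithful ζ hX.1 hY.1, Kronecker.glue_exact ζ⟩, hind,
    fun T T' ⟨I⟩ => Kronecker.nonempty_iso_of_glue_iso hζ'.1 hX hY hXY I,
    ⟨Kronecker.nonempty_glue_simpleY_iso ζ, Kronecker.nonempty_glue_simpleX_iso ζ⟩,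
    fun hYX hXX hYY => Kronecker.glue_equivalence hX hY hXY hYX hXX hYY hζ'⟩
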